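/- All logarithms are binary, $h_2$ is the binary entropy function, and $\mathcal B(m,k,q)=\binom mk q^k(1-q)^{m-k}$. **Setting.** Let $n\ge 2$ and consider the bidirected chain on the nodes $\mathcal V=\{1,\dots,n\}$ with directed edges $(i,i+1)$ and $(i+1,i)$, $1\le i<n$ (no self-loops). Each edge $e$ carries a memoryless channel $K_e$ with finite input and output alphabets, and the channels are independent. Node $v$ observes $W_v$, with values in a (standard Borel) space; $W=(W_v)_{v\in\mathcal V}$ has an arbitrary known joint law. The nodes want to compute $Z=f(W)$, with a nonnegative distortion function $d$. In a $T$-step algorithm each node $v$, at each step $t=1,\dots,T$, sends on its outgoing edges symbols that are a deterministic function of $W_v$ and of the channel outputs it received at steps $1,\dots,t-1$; after step $T$ it forms an estimate $\hat Z_v$ from $W_v$ and all the outputs it received. For $\varepsilon\ge0$ and $\delta\in[0,1)$ let $T(\varepsilon,\delta)\in\mathbb N\cup\{\infty\}$ be the least $T\ge 0$ for which some $T$-step algorithm has $\mathbb P[d(Z,\hat Z_v)>\varepsilon]\le\delta$ for all $v$. The SDPI constant of a channel $K$ is $\eta(K)=\sup_{P}\sup_{Q\ne P}D(QK\|PK)/D(Q\|P)$,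 over input laws $P,Q$ (pairs with $D(Q\|P)=\infty$ count as $0$). Let $\mathcal U=\mathcal V\setminus\{1\}$ and $$L(w_{\mathcal U},\varepsilon)=\sup_{z}\mathbb P[d(Z,z)\le\varepsilon\mid W_{\mathcal U}=w_{\mathcal U}],\qquad \ell=(1-\delta)\log\frac1{\mathbb E[L(W_{\mathcal U},\varepsilon)]}-h_2(\delta)\in(-\infty,\infty],$$ let $H=H(W_1\mid W_{\mathcal U})\in[0,\infty]$ (which is $\infty$ if the conditional law is not almost surely discrete), and let $C_{(1,2)}$ be the Shannon capacity of $K_{(1,2)}$. Assume $\mathbb E[L(W_{\mathcal U},\varepsilon)]\le 1-\delta$ and $\ell>0$. **General chains.** Suppose that $\eta(K_e)\le\eta$ for all edges $e$, where $\eta\in[0,1]$, and put $\tilde\eta=1-(1-\eta)^2$. 1. If $T=T(\varepsilon,\delta)<\infty$, then $T\ge n-1$ and $$\ell\le H\,\tilde\eta\sum_{i=1}^{T-n+2}\mathcal B(T-i,n-2,\tilde\eta),\qquad \ell\le C_{(1,2)}\,\tilde\eta\sum_{i=1}^{T-n+2}\mathcal B(T-i-1,n-3,\tilde\eta)\,i\quad(\text{if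 } n\ge3),$$ $$\ell\le H\prod_{i=2}^n\bigl(1-(1-\eta)^{2(T-n+2)}\bigr),\qquad \ell\le C_{(1,2)}(T-n+2)\prod_{i=3}^n\bigl(1-(1-\eta)^{2(T-n+2)}\bigr),$$ with $0\cdot\infty=0$. 2. Consequently, with $r=\ell/H$ (and $r=0$ if $H=\infty$), $$T(\varepsilon,\delta)\ge\frac{\log\bigl(1-r^{1/(n-1)}\bigr)^{-1}}{2\log(1-\eta)^{-1}}+n-2,\qquad T(\varepsilon,\delta)\ge\frac{\ell}{C_{(1,2)}}+n-2,$$ where the fraction in the first bound is read as $0$ if $\eta=1$, and $\ell/0=\infty$ in the second; if $\eta=0$, then $T(\varepsilon,\delta)=\infty$ by part 1. Moreover, for every fixed $\eta\in(0,1)$ and every sequence $r_n\in[0,1)$, $$\frac{\log\bigl(1-r_n^{1/(n-1)}\bigr)^{-1}}{2\log(1-\eta)^{-1}}+n-2\;\sim\;\frac{\log(n-1)+\log(1-r_n)^{-1}}{2\log(1-\eta)^{-1}}+n-2\qquad(n\to\infty).$$ 3. There is an absolute constant $c>0$ such that, if $n\ge4$, $\eta>0$, all edge capacities are at most $C$,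 and $\frac{C n^2(n-3)^2}{4\eta}\exp(-2\eta^2(n-3))<\ell$, then $T(\varepsilon,\delta)\ge c\,n/\tilde\eta$. **BSC chains.** Let $p\in[0,1]$ and $\delta\in[0,1)$. There is an $N$, depending only on $p$ and $\delta$, such that for all $n\ge N$ (with $n\ge 2$), all $W$, $f$, $d$, $\varepsilon$ as above, if all channels are binary symmetric with crossover probability $p\ne\frac12$, then $$T(\varepsilon,\delta)\ge\max\left\{\frac{\ell}{1-h_2(p)},\ \frac{\log(n-1)+\log(1-r)^{-1}}{2\log\bigl(4p(1-p)\bigr)^{-1}}\right\}+n-2,$$ where the second term in the maximum is read as $0$ if $p\in\{0,1\}$. If $p=\frac12$, then $T(\varepsilon,\delta)=\infty$. -/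

import Mathlib

open MeasureTheory ProbabilityTheory Filter
open scoped ENNReal NNReal

noncomputable section

/-! ### Discrete channels (information is measured in bits) -/

/-- Relative entropy `D(q ‖ p)` (in nats) of two laws on a discrete alphabet. -/
def relEntropy {α : Type*} (q p : PMF α) : ℝ≥0∞ :=
  letI : MeasurableSpace α := ⊤
  InformationTheory.klDiv q.toMeasure p.toMeasure

/-- The SDPI constant `η(K) = sup_{p} sup_{q ≠ p} D(qK ‖ pK) / D(q ‖ p)`. In `ℝ≥0∞` a quotient
with infinite denominator is `0`, so that only pairs with `D(q ‖ p) < ∞` contribute. -/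
def sdpiConst {X Y : Type*} (K : X → PMF Y) : ℝ≥0∞ :=
  ⨆ (p : PMF X) (q : PMF X) (_ : q ≠ p), relEntropy (q.bind K) (p.bind K) / relEntropy q p

/-- Mutual information (in nats) between the input (with law `p`) and the output of `K`. -/
def mutualInfo {X Y : Type*} (p : PMF X) (K : X → PMF Y) : ℝ≥0∞ :=
  relEntropy (p.bind fun x => (K x).map fun y => (x, y))
    (p.bind fun x => (p.bind K).map fun y => (x, y))

/-- Shannon capacity of the channel `K`, in bits. -/
def capacity {X Y : Type*} (K : X → PMF Y) : ℝ≥0∞ :=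
  (⨆ p : PMF X, mutualInfo p K) / ENNReal.ofReal (Real.log 2)

/-- The binary symmetric channel with crossover probability `p`. -/
def bsc (p : ℝ≥0) (hp : p ≤ 1) (x : Bool) : PMF Bool :=
  PMF.ofFintype (fun y => if y = x then ((1 - p : ℝ≥0) : ℝ≥0∞) else (p : ℝ≥0∞)) (by
    cases x <;> simp [← ENNReal.coe_add, tsub_add_cancel_of_le hp, add_tsub_cancel_of_le hp,
      -ENNReal.coe_sub])

/-- Binary entropy function `h₂`, in bits. -/
def h2 (p : ℝ) : ℝ := Real.binEntropy p / Real.log 2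

/-- Binary logarithm on `[0, ∞]`, with `log 0 = -∞` and `log ∞ = ∞`. -/
def log2 (x : ℝ≥0∞) : EReal := ENNReal.log x / (Real.log 2 : ℝ)

/-- The binomial probability `ℬ(m, k, p) = (m choose k) p ^ k (1 - p) ^ (m - k)`. -/
def binomProb (m k : ℕ) (p : ℝ) : ℝ := (m.choose k : ℝ) * p ^ k * (1 - p) ^ (m - k)

open scoped Classical in
/-- Shannon entropy (in bits) of a probability law: the usual sum if the law is discrete, that is
concentrated on a countable set, and `∞` otherwise. -/
def shannonEntropy {α : Type*} [MeasurableSpace α] (μ : Measure α) : ℝ≥0∞ :=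
  if ∃ s : Set α, s.Countable ∧ μ sᶜ = 0 then
    (∑' x, ENNReal.ofReal (Real.negMulLog (μ.real {x}))) / ENNReal.ofReal (Real.log 2)
  else ⊤

/-! ### Networks and algorithms -/

section Network

variable {V : Type*}

/-- The edges of the directed graph on `V` whose edge relation is `E`. -/
abbrev Edge (E : V → V → Prop) := {e : V × V // E e.1 e.2}

/-- The edges that enter `v`. -/
abbrev InEdge (E : V → V → Prop) (v : V) := {e : Edge E // e.1.2 = v}

/-- The edges that leave `v`. -/
abbrev OutEdge (E : V → V → Prop) (v : V) := {e : Edge E // e.1.1 = v}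

/-- The data of a function computation problem: the law of the vector of all observations, the
function to be computed, and the distortion function. -/
structure Problem (W : V → Type*) (Z : Type*) [∀ v, MeasurableSpace (W v)]
    [MeasurableSpace Z] where
  /-- the joint law of the observations -/
  law : Measure (∀ v, W v)
  isProb : IsProbabilityMeasure law
  /-- the function of the observations that is to be computed -/
  f : (∀ v, W v) → Z
  measurable_f : Measurable f
  /-- the distortion function -/
  d : Z → Z → ℝ≥0
  measurable_d : Measurable fun z : Z × Z => d z.1 z.2

attribute [instance] Problem.isProb

/-- `T`-step algorithms: deterministic (measurable) encoders and estimators. The time steps are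
`0, …, T - 1`, so that exactly `t` batches of channel outputs have been received before step `t`. -/
structure Algorithm (E : V → V → Prop) (W : V → Type*) (X Y : Edge E → Type*) (Z : Type*)
    [∀ v, MeasurableSpace (W v)] [MeasurableSpace Z] (T : ℕ) where
  /-- the encoder of node `v` at step `t` -/
  enc : ∀ (v : V) (t : Fin T), W v → (Fin t → ∀ e : InEdge E v, Y e.1) →
    ∀ e : OutEdge E v, X e.1
  /-- the estimator of node `v` -/
  est : ∀ v : V, W v → (Fin T → ∀ e : InEdge E v, Y e.1) → Z
  measurableSet_enc : ∀ v t past out, MeasurableSet {w | enc v t w past = out}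
  measurable_est : ∀ v y, Measurable fun w => est v w y

namespace Algorithm

variable {E : V → V → Prop} {W : V → Type*} {X Y : Edge E → Type*} {Z : Type*}
  [∀ v, MeasurableSpace (W v)] [MeasurableSpace Z] {T : ℕ}

/-- The symbol transmitted on edge `e` at step `t`, if the observations are `w` and the channel
outputs are `y` (only the outputs before step `t` matter). -/
def message (A : Algorithm E W X Y Z T) (w : ∀ v, W v) (y : Fin T → ∀ e, Y e) (t : Fin T)
    (e : Edge E) : X e :=
  A.enc e.1.1 t (w e.1.1) (fun s e' => y (Fin.castLE t.2.le s) e'.1) ⟨e, rfl⟩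

/-- The estimate of node `v`. -/
def estimate (A : Algorithm E W X Y Z T) (v : V) (w : ∀ v, W v) (y : Fin T → ∀ e, Y e) : Z :=
  A.est v (w v) fun t e => y t e.1

variable [Fintype V] [DecidableEq V] [DecidableRel E] [∀ e, Fintype (Y e)]

/-- The conditional probability, given that the observations are `w`, that the channel outputs
of the `T` steps are `y`; the channels are memoryless and independent. -/
def outputProb (A : Algorithm E W X Y Z T) (K : ∀ e, X e → PMF (Y e)) (w : ∀ v, W v)
    (y : Fin T → ∀ e, Y e) : ℝ≥0∞ :=
  ∏ t : Fin T, ∏ e : Edge E, K e (A.message w y t e) (y t e)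

/-- The excess distortion probability `P[d(Z, Ẑ_v) > ε]` of node `v`. -/
def errorProb (A : Algorithm E W X Y Z T) (K : ∀ e, X e → PMF (Y e)) (P : Problem W Z)
    (ε : ℝ≥0) (v : V) : ℝ≥0∞ :=
  ∫⁻ w, ∑ y : Fin T → ∀ e, Y e,
    (if ε < P.d (P.f w) (A.estimate v w y) then A.outputProb K w y else 0) ∂P.law

end Algorithm

/-- The `(ε, δ)`-computation time: the least `T` for which some `T`-step algorithm has excess
distortion probability at most `δ` at every node (`⊤` if there is none). -/
def compTime {E : V → V → Prop} [Fintype V] [DecidableEq V] [DecidableRel E] {W : V → Type*}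
    {X Y : Edge E → Type*} [∀ e, Fintype (Y e)] {Z : Type*} [∀ v, MeasurableSpace (W v)]
    [MeasurableSpace Z] (K : ∀ e, X e → PMF (Y e)) (P : Problem W Z) (ε : ℝ≥0) (δ : ℝ) : ℕ∞ :=
  ⨅ (T : ℕ) (_ : ∃ A : Algorithm E W X Y Z T, ∀ v, A.errorProb K P ε v ≤ ENNReal.ofReal δ),
    (T : ℕ∞)

/-- The cutset capacity `C_S`: the sum of the capacities of the edges from `Sᶜ` into `S`. -/
def cutsetCapacity {E : V → V → Prop} [Fintype V] [DecidableEq V] [DecidableRel E]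
    {X Y : Edge E → Type*} (K : ∀ e, X e → PMF (Y e)) (S : Finset V) : ℝ≥0∞ :=
  ∑ e : Edge E with e.1.1 ∉ S ∧ e.1.2 ∈ S, capacity (K e)

namespace Problem

variable {W : V → Type*} {Z : Type*} [∀ v, MeasurableSpace (W v)] [MeasurableSpace Z]
  [Fintype V] [∀ v, StandardBorelSpace (W v)] [∀ v, Nonempty (W v)]

/-- The conditional small ball probability `L(w_S, ε) = sup_z P[d(Z, z) ≤ ε | W_S = w_S]`. -/
def smallBall (P : Problem W Z) (S : Finset V) (ε : ℝ≥0) (wS : ∀ v : S, W v) : ℝ≥0∞ :=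
  ⨆ z : Z, condDistrib id S.restrict P.law wS {w | P.d (P.f w) z ≤ ε}

/-- `E[L(W_S, ε)]`. -/
def meanSmallBall (P : Problem W Z) (S : Finset V) (ε : ℝ≥0) : ℝ≥0∞ :=
  ∫⁻ w, P.smallBall S ε (S.restrict w) ∂P.law

/-- `ℓ(S, ε, δ) = (1 - δ) log (1 / E[L(W_S, ε)]) - h₂(δ)`, which is `∞` if `E[L(W_S, ε)] = 0`. -/
def ell (P : Problem W Z) (S : Finset V) (ε : ℝ≥0) (δ : ℝ) : EReal :=
  ((1 - δ : ℝ) : EReal) * log2 (P.meanSmallBall S ε)⁻¹ - ((h2 δ : ℝ) : EReal)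

/-- The conditional entropy `H(W_A | W_B)`, in bits. -/
def condEntropy (P : Problem W Z) (A B : Finset V) : ℝ≥0∞ :=
  ∫⁻ w, shannonEntropy (condDistrib A.restrict B.restrict P.law (B.restrict w)) ∂P.law

end Problem

end Network

/-! ### Chains -/

/-- The edges of the `n`-node bidirected chain without self-loops. -/
def chainAdj (n : ℕ) (i j : Fin n) : Prop := (i : ℕ) + 1 = j ∨ (j : ℕ) + 1 = i

instance (n : ℕ) : DecidableRel (chainAdj n) := fun _ _ => inferInstanceAs (Decidable (_ ∨ _))

/-- The set that consists of the first node of the `n`-node chain. -/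
def firstNode {n : ℕ} (hn : 2 ≤ n) : Finset (Fin n) := {⟨0, by omega⟩}

end

/-! Number the nodes from 0 and condition on the observations of all nodes but node 0. Then every
other node uses fixed encoders, and all that the channels see of the observations is the table `φ`
of encoding maps, a random variable in a finite type. Its conditional entropy is at most that of the
observation of node 0 (`ae_entropy_table_le`), so all information quantities become finite sums.

Let `I_i(t)` (`blockInfo`) be the information between `φ` and everything that the nodes `i, i + 1,
…` receive in `t` steps. The only edge into the block `i + 1, i + 2, …` from outside is `i → i + 1`;
all other symbols received in the block are produced by fixed encoders from what the block already
knows. One step therefore reveals at most `η` times the information in the symbol sent on that edge,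
and for `i ≥ 1` this symbol is a function of what the block starting at `i` knows. Hence
`I_{i+1}(t+1) ≤ (1 - η) I_{i+1}(t) + η I_i(t)`, with the entropy of `φ` in place of `I_0`
(`blockInfo_step`), while the capacity of the first edge gives `I_1(t) ≤ C t` (`blockInfo_one_le`).
Solving the recursion exactly gives the binomial sums (`recursion_le_sum`); bounding it link by link
gives the products (`recursion_le_prod_const`, `recursion_le_prod_linear`).

Conversely, a small error probability forces `I_{n-1}(T)` to be large. A Donsker–Varadhan bound
(`le_sum_klTerm`) compares the success probability with that of a blind guess, which is at most the
conditional small ball probability. The tangent parameters do not depend on the conditioning, so the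
bound can be averaged (`le_lintegral_of_blockInfo_le`) and then optimised to produce `ℓ`
(`ellOf_le`).

The recursion holds with `η` itself. The general bounds use the larger constant `1 - (1 - η)²`, so
they follow by monotonicity. For binary symmetric channels `1 - η = 4p(1 - p)`, and the factor 2
thus lost in the exponent pays for a nonasymptotic logarithmic bound. If `r ≥ 1/2`, the entropy
product suffices (`log_add_log_le_of_half_le`). If `r < 1/2`, a smaller `T` would make the capacity
product fall below a constant that `ℓ > 0` forces on the information (`exists_pos_le_of_ellOf_pos`,
`exists_forall_mul_pow_lt`). The case `δ = 0` is separate: with fully supported channels, an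
algorithm without errors is a blind guess. -/

noncomputable section

/-! ### Finite information sums -/

/-- The summand `u log (u / v)` of a relative entropy (in nats). -/
def klTerm (u v : ℝ) : ℝ := u * Real.log (u / v)

lemma klTerm_zero_left (v : ℝ) : klTerm 0 v = 0 := by simp [klTerm]

lemma klTerm_self (u : ℝ) : klTerm u u = 0 := by
  by_cases h : u = 0 <;> simp [klTerm, h]

lemma klTerm_mul_right (u v c : ℝ) : klTerm (u * c) (v * c) = klTerm u v * c := by
  by_cases h : c = 0
  · simp [klTerm, h]
  · rw [klTerm, mul_div_mul_right _ _ h, klTerm]; ring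

lemma klTerm_nonpos {u v : ℝ} (hu : 0 ≤ u) (h : u ≤ v) : klTerm u v ≤ 0 := by
  refine mul_nonpos_of_nonneg_of_nonpos hu (Real.log_nonpos (div_nonneg hu (hu.trans h)) ?_)
  exact div_le_one_of_le₀ h (hu.trans h)

/-- The left side is the tangent plane at `(U, V)` of the convex, homogeneous function `klTerm`; the
proof is `log y ≤ y - 1`. Summed, it yields the log-sum inequality; with a free point `(U, V)` it
yields the Donsker–Varadhan bound `le_sum_klTerm`. -/
lemma klTerm_ge {u v U V : ℝ} (hu : 0 ≤ u) (hv : 0 ≤ v) (huv : v = 0 → u = 0) (hU : 0 < U)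
    (hV : 0 < V) : u * Real.log (U / V) + u - v * (U / V) ≤ klTerm u v := by
  rcases hu.eq_or_lt with rfl | hu'
  · simp only [klTerm, zero_mul, zero_add, zero_sub, Left.neg_nonpos_iff]; positivity
  have hv' : 0 < v := hv.lt_of_ne fun h => hu'.ne' (huv h.symm)
  have h1 := Real.log_le_sub_one_of_pos (x := v * (U / V) / u) (by positivity)
  rw [Real.log_div (by positivity) hu'.ne', Real.log_mul hv'.ne' (by positivity)] at h1
  rw [klTerm, Real.log_div hu'.ne' hv'.ne']
  have h2 := mul_le_mul_of_nonneg_left h1 hu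
  have h3 : u * (v * (U / V) / u - 1) = v * (U / V) - u := by field_simp
  rw [h3] at h2
  linarith

/-- The log-sum inequality. -/
lemma klTerm_sum_le {ι : Type*} (s : Finset ι) (u v : ι → ℝ) (hu : ∀ i ∈ s, 0 ≤ u i)
    (hv : ∀ i ∈ s, 0 ≤ v i) (huv : ∀ i ∈ s, v i = 0 → u i = 0) :
    klTerm (∑ i ∈ s, u i) (∑ i ∈ s, v i) ≤ ∑ i ∈ s, klTerm (u i) (v i) := by
  rcases (Finset.sum_nonneg hu).eq_or_lt with h | hU
  · have h0 := (Finset.sum_eq_zero_iff_of_nonneg hu).1 h.symm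
    rw [← h, klTerm_zero_left, Finset.sum_eq_zero]
    intro i hi
    rw [h0 i hi, klTerm_zero_left]
  have hV : 0 < ∑ i ∈ s, v i := by
    refine (Finset.sum_nonneg hv).lt_of_ne fun h => hU.ne' ?_
    exact Finset.sum_eq_zero fun i hi =>
      huv i hi ((Finset.sum_eq_zero_iff_of_nonneg hv).1 h.symm i hi)
  refine le_trans (le_of_eq ?_)
    (Finset.sum_le_sum fun i hi => klTerm_ge (hu i hi) (hv i hi) (huv i hi) hU hV)
  rw [Finset.sum_sub_distrib, Finset.sum_add_distrib, ← Finset.sum_mul, ← Finset.sum_mul, klTerm]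
  field_simp
  ring

/-- The strong data processing inequality with constant `η` for a (nonnegative) matrix `κ`, for
unnormalised laws. -/
def HasSDPI {X Z : Type*} [Fintype X] [Fintype Z] (κ : X → Z → ℝ) (η : ℝ) : Prop :=
  ∀ u v : X → ℝ, (∀ x, 0 ≤ u x) → (∀ x, 0 ≤ v x) → (∀ x, v x = 0 → u x = 0) →
    ∑ z, klTerm (∑ x, u x * κ x z) (∑ x, v x * κ x z) - klTerm (∑ x, u x) (∑ x, v x) ≤
      η * (∑ x, klTerm (u x) (v x) - klTerm (∑ x, u x) (∑ x, v x))

/-- The information between input and output of `κ` is at most `C` for every input law,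
in unnormalised form. -/
def HasCapacityBound {X Z : Type*} [Fintype X] [Fintype Z] (κ : X → Z → ℝ) (C : ℝ) : Prop :=
  ∀ v : X → ℝ, (∀ x, 0 ≤ v x) →
    ∑ x, ∑ z, klTerm (v x * κ x z) (v x * ∑ x', v x' * κ x' z) + klTerm (∑ x, v x) 1 ≤
      C * ∑ x, v x

/-! ### Conditional entropy of finite laws and its monotonicity. -/

section CondEnt

variable {Φ B : Type*} [Fintype Φ] [Fintype B]

/-- Conditional entropy (in nats) of the first coordinate given the second one. -/
def condEnt (p : Φ → B → ℝ) : ℝ := -∑ b, ∑ φ, klTerm (p φ b) (∑ φ', p φ' b)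

lemma condEnt_nonneg {p : Φ → B → ℝ} (hp : ∀ φ b, 0 ≤ p φ b) : 0 ≤ condEnt p := by
  rw [condEnt, neg_nonneg]
  exact Finset.sum_nonpos fun b _ => Finset.sum_nonpos fun φ _ => klTerm_nonpos (hp φ b)
    (Finset.single_le_sum (f := fun φ' => p φ' b) (fun φ' _ => hp φ' b) (Finset.mem_univ φ))

lemma condEnt_equiv {B' : Type*} [Fintype B'] (e : B' ≃ B) (p : Φ → B → ℝ) :
    condEnt (fun φ b => p φ (e b)) = condEnt p := by
  rw [condEnt, condEnt, ← e.sum_comp]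

variable {Ω : Type*} [Fintype Ω]

open scoped Classical in
/-- The joint law of `φ` and `g φ ω` if `J` is the joint law of `φ` and `ω`. -/
def pushLaw (J : Φ → Ω → ℝ) (g : Φ → Ω → B) (φ : Φ) (b : B) : ℝ :=
  ∑ ω, if g φ ω = b then J φ ω else 0

omit [Fintype Φ] [Fintype B] in
lemma pushLaw_nonneg {J : Φ → Ω → ℝ} (hJ : ∀ φ ω, 0 ≤ J φ ω) (g : Φ → Ω → B) (φ : Φ) (b : B) :
    0 ≤ pushLaw J g φ b :=
  Finset.sum_nonneg fun ω _ => by split_ifs <;> simp [hJ]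

omit [Fintype Φ] in
lemma sum_pushLaw_mul (J : Φ → Ω → ℝ) (g : Φ → Ω → B) (φ : Φ) (f : B → ℝ) :
    ∑ b, pushLaw J g φ b * f b = ∑ ω, J φ ω * f (g φ ω) := by
  classical
  simp only [pushLaw, Finset.sum_mul]
  rw [Finset.sum_comm]
  refine Finset.sum_congr rfl fun ω _ => ?_
  simp [ite_mul]

omit [Fintype Φ] in
lemma sum_pushLaw (J : Φ → Ω → ℝ) (g : Φ → Ω → B) (φ : Φ) :
    ∑ b, pushLaw J g φ b = ∑ ω, J φ ω := by
  simpa using sum_pushLaw_mul J g φ fun _ => 1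

omit [Fintype Φ] in
lemma pushLaw_pushLaw {B' : Type*} [Fintype B'] (J : Φ → Ω → ℝ) (g : Φ → Ω → B)
    (g' : Φ → Ω → B') (f : B → B') (h : ∀ φ ω, J φ ω ≠ 0 → g' φ ω = f (g φ ω)) (φ : Φ) (b' : B') :
    pushLaw (pushLaw J g) (fun _ => f) φ b' = pushLaw J g' φ b' := by
  classical
  have := sum_pushLaw_mul J g φ (fun b => if f b = b' then 1 else 0)
  simp only [mul_ite, mul_one, mul_zero] at this
  rw [pushLaw, pushLaw]
  refine Eq.trans ?_ (this.trans ?_)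
  · refine Finset.sum_congr rfl fun b _ => ?_
    congr
  · refine Finset.sum_congr rfl fun ω _ => ?_
    by_cases hJ : J φ ω = 0
    · simp [hJ]
    · rw [h φ ω hJ]

/-- Conditioning on less increases the entropy. -/
lemma condEnt_le_pushLaw {B' : Type*} [Fintype B'] {p : Φ → B → ℝ} (hp : ∀ φ b, 0 ≤ p φ b)
    (f : B → B') : condEnt p ≤ condEnt (pushLaw p fun _ => f) := by
  classical
  rw [condEnt, condEnt, neg_le_neg_iff, Finset.sum_comm, Finset.sum_comm (γ := B)]
  refine Finset.sum_le_sum fun φ _ => ?_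
  have key : ∀ b' : B', klTerm (pushLaw p (fun _ => f) φ b') (∑ φ', pushLaw p (fun _ => f) φ' b') ≤
      ∑ b, if f b = b' then klTerm (p φ b) (∑ φ', p φ' b) else 0 := by
    intro b'
    have h1 : ∀ φ, pushLaw p (fun _ => f) φ b' = ∑ b with f b = b', p φ b := by
      intro φ
      rw [Finset.sum_filter, pushLaw]
    simp only [h1]
    rw [Finset.sum_comm, ← Finset.sum_filter]
    -- The log-sum inequality over the fibre of `f` above `b'`.
    refine klTerm_sum_le _ _ _ (fun b _ => hp φ b)
      (fun b _ => Finset.sum_nonneg fun φ _ => hp φ b) fun b _ h => ?_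
    exact (Finset.sum_eq_zero_iff_of_nonneg fun φ _ => hp φ b).1 h φ (Finset.mem_univ _)
  refine (Finset.sum_le_sum fun b' _ => key b').trans (le_of_eq ?_)
  rw [Finset.sum_comm]
  simp

/-- Data processing. The map `f` must not depend on `φ`, although `g` and `g'` may. Agreement is
required only on the support of `J`; this is where encoders that are almost surely fixed can be
exploited. -/
lemma condEnt_pushLaw_le {B' : Type*} [Fintype B'] {J : Φ → Ω → ℝ} (hJ : ∀ φ ω, 0 ≤ J φ ω)
    (g : Φ → Ω → B) (g' : Φ → Ω → B') (f : B → B')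
    (h : ∀ φ ω, J φ ω ≠ 0 → g' φ ω = f (g φ ω)) :
    condEnt (pushLaw J g) ≤ condEnt (pushLaw J g') := by
  have := condEnt_le_pushLaw (pushLaw_nonneg hJ g) f
  rwa [show pushLaw (pushLaw J g) (fun _ => f) = pushLaw J g' from
    funext fun φ => funext fun b' => pushLaw_pushLaw J g g' f h φ b'] at this

end CondEnt

/-! ### The effect of one channel use on conditional entropy. -/

section Step

variable {Φ B A X Z : Type*} [Fintype Φ] [Fintype B] [Fintype A] [Fintype X] [Fintype Z]

/-- The output of a channel, observed together with symbols that depend only on what is known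
already. -/
lemma condEnt_channel {u : Φ → B × X → ℝ} {q : Φ → B × A → ℝ} {κ : X → Z → ℝ} {R : B → A → ℝ}
    {ζ : A → Z} (hR : ∀ b (f : Z → ℝ), ∑ a, f (ζ a) * R b a = ∑ z, f z)
    (hq : ∀ φ b a, q φ (b, a) = (∑ x, u φ (b, x) * κ x (ζ a)) * R b a) :
    condEnt q = -∑ b, ∑ φ, ∑ z, klTerm (∑ x, u φ (b, x) * κ x z)
      (∑ x, (∑ φ', u φ' (b, x)) * κ x z) := by
  rw [condEnt, Fintype.sum_prod_type]
  congr 1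
  refine Finset.sum_congr rfl fun b _ => ?_
  rw [Finset.sum_comm]
  refine Finset.sum_congr rfl fun φ _ => ?_
  rw [← hR b]
  refine Finset.sum_congr rfl fun a _ => ?_
  simp only [hq]
  rw [← Finset.sum_mul, klTerm_mul_right]
  simp only [Finset.sum_mul]
  rw [Finset.sum_comm]

/-- This is `I(φ; a | b) ≤ η I(φ; x | b)`. For every `b` and `φ` the contraction is applied to `u φ
(b, ·)` and its sum over `φ`. Since `HasSDPI` is homogeneous, no conditional laws need to be formed,
so null events cause no trouble. -/
lemma condEnt_sub_le_of_hasSDPI {p : Φ → B → ℝ} {u : Φ → B × X → ℝ} {q : Φ → B × A → ℝ}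
    {κ : X → Z → ℝ} {R : B → A → ℝ} {ζ : A → Z} {η : ℝ} (hκ : HasSDPI κ η)
    (hu : ∀ φ c, 0 ≤ u φ c)
    (hR : ∀ b (f : Z → ℝ), ∑ a, f (ζ a) * R b a = ∑ z, f z)
    (hp : ∀ φ b, p φ b = ∑ x, u φ (b, x))
    (hq : ∀ φ b a, q φ (b, a) = (∑ x, u φ (b, x) * κ x (ζ a)) * R b a) :
    condEnt p - condEnt q ≤ η * (condEnt p - condEnt u) := by
  rw [condEnt_channel hR hq, condEnt, condEnt, Fintype.sum_prod_type]
  have key : ∀ b φ, ∑ z, klTerm (∑ x, u φ (b, x) * κ x z) (∑ x, (∑ φ', u φ' (b, x)) * κ x z) -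
      klTerm (p φ b) (∑ φ', p φ' b) ≤ η * (∑ x, klTerm (u φ (b, x)) (∑ φ', u φ' (b, x)) -
      klTerm (p φ b) (∑ φ', p φ' b)) := by
    intro b φ
    simp only [hp]
    rw [Finset.sum_comm (γ := Φ)]
    refine hκ _ _ (fun x => hu φ _) (fun x => Finset.sum_nonneg fun φ' _ => hu φ' _) fun x h => ?_
    exact (Finset.sum_eq_zero_iff_of_nonneg fun φ _ => hu φ _).1 h φ (Finset.mem_univ _)
  have := Finset.sum_le_sum fun b (_ : b ∈ Finset.univ) =>
    Finset.sum_le_sum fun φ (_ : φ ∈ Finset.univ) => key b φ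
  simp only [Finset.sum_sub_distrib, ← Finset.mul_sum] at this
  rw [show ∑ b, ∑ x, ∑ φ, klTerm (u φ (b, x)) (∑ φ', u φ' (b, x)) =
    ∑ b, ∑ φ, ∑ x, klTerm (u φ (b, x)) (∑ φ', u φ' (b, x)) from
      Finset.sum_congr rfl fun b _ => Finset.sum_comm]
  linarith

/-- Along the Markov chain `φ → x → z`, `I(φ; z) ≤ I(x; z)` by the log-sum inequality over `x`, and
the latter is bounded by the capacity. All terms are scaled by the total mass `S`, which produces
the logarithms of `s` and `S` in the proof. -/
lemma sum_klTerm_mul_le (u : Φ → X → ℝ) (κ : X → Z → ℝ) (hu : ∀ φ x, 0 ≤ u φ x)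
    (hκ : ∀ x z, 0 ≤ κ x z) (hκ1 : ∀ x, ∑ z, κ x z = 1) {C : ℝ} (hC : HasCapacityBound κ C) :
    ∑ φ, ∑ z, klTerm (∑ x, u φ x * κ x z) (∑ x, (∑ φ', u φ' x) * κ x z) -
      ∑ φ, klTerm (∑ x, u φ x) (∑ φ', ∑ x, u φ' x) ≤ C * ∑ φ, ∑ x, u φ x := by
  set v : X → ℝ := fun x => ∑ φ', u φ' x with hv
  set V : Z → ℝ := fun z => ∑ x, v x * κ x z with hV
  have hv0 : ∀ x, 0 ≤ v x := fun x => Finset.sum_nonneg fun φ _ => hu φ x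
  have hV0 : ∀ z, 0 ≤ V z := fun z => Finset.sum_nonneg fun x _ => mul_nonneg (hv0 x) (hκ x z)
  have hS : ∑ φ, ∑ x, u φ x = ∑ x, v x := Finset.sum_comm
  set S := ∑ x, v x with hSdef
  have hVS : ∑ z, V z = S := by
    rw [hV, Finset.sum_comm]
    simp [← Finset.mul_sum, hκ1, hSdef]
  rw [hS]
  have hVz : ∀ z x, V z = 0 → v x * κ x z = 0 := fun z x h =>
    (Finset.sum_eq_zero_iff_of_nonneg fun x _ => mul_nonneg (hv0 x) (hκ x z)).1 h x
      (Finset.mem_univ _)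
  have huv : ∀ φ x, u φ x ≤ v x := fun φ x =>
    Finset.single_le_sum (f := fun φ' => u φ' x) (fun φ' _ => hu φ' x) (Finset.mem_univ φ)
  have huV : ∀ φ z x, V z = 0 → u φ x * κ x z = 0 := by
    intro φ z x h
    rcases mul_eq_zero.1 (hVz z x h) with h' | h'
    · rw [le_antisymm ((huv φ x).trans h'.le) (hu φ x), zero_mul]
    · rw [h', mul_zero]
  have h0 : ∀ φ, 0 ≤ ∑ x, u φ x := fun φ => Finset.sum_nonneg fun x _ => hu φ x
  have h0S : 0 ≤ S := Finset.sum_nonneg fun x _ => hv0 x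
  have key : ∀ φ, ∑ z, klTerm (∑ x, u φ x * κ x z) (V z) - klTerm (∑ x, u φ x) S ≤
      ∑ z, ∑ x, klTerm (u φ x * κ x z) (u φ x * V z) + (∑ x, u φ x) * Real.log S := by
    intro φ
    set s := ∑ x, u φ x with hs
    have hus : ∀ x, u φ x ≤ s := fun x =>
      Finset.single_le_sum (fun x _ => hu φ x) (Finset.mem_univ x)
    have h1 : ∀ z, klTerm (∑ x, u φ x * κ x z) (s * V z) ≤
        ∑ x, klTerm (u φ x * κ x z) (u φ x * V z) := by
      intro z
      rw [hs, Finset.sum_mul]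
      refine klTerm_sum_le _ _ _ (fun x _ => mul_nonneg (hu φ x) (hκ x z))
        (fun x _ => mul_nonneg (hu φ x) (hV0 z)) fun x _ h => ?_
      rcases mul_eq_zero.1 h with h' | h'
      · rw [h', zero_mul]
      · exact huV φ z x h'
    have h2 : ∀ z, klTerm (∑ x, u φ x * κ x z) (s * V z) = klTerm (∑ x, u φ x * κ x z) (V z) -
        (∑ x, u φ x * κ x z) * Real.log s := by
      intro z
      by_cases hz : ∑ x, u φ x * κ x z = 0
      · simp [klTerm, hz]
      have hVne : V z ≠ 0 := fun h => hz (Finset.sum_eq_zero fun x _ => huV φ z x h)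
      have hsne : s ≠ 0 := fun h => hz (Finset.sum_eq_zero fun x _ => by
        rw [le_antisymm ((hus x).trans h.le) (hu φ x), zero_mul])
      rw [klTerm, klTerm, Real.log_div hz (mul_ne_zero hsne hVne), Real.log_div hz hVne,
        Real.log_mul hsne hVne]
      ring
    have h3 : ∑ z, (∑ x, u φ x * κ x z) * Real.log s = s * Real.log s := by
      rw [← Finset.sum_mul, Finset.sum_comm]
      simp [← Finset.mul_sum, hκ1, hs]
    have h4 : klTerm s S = s * Real.log s - s * Real.log S := by
      by_cases hsne : s = 0
      · simp [klTerm, hsne]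
      have : S ≠ 0 := by
        intro h
        refine hsne (le_antisymm ?_ (h0 φ))
        rw [← h, ← hS]
        exact Finset.single_le_sum (f := fun φ => ∑ x, u φ x) (fun φ _ => h0 φ) (Finset.mem_univ φ)
      rw [klTerm, Real.log_div hsne this]; ring
    have h5 := Finset.sum_le_sum fun z (_ : z ∈ Finset.univ) => h1 z
    simp only [h2, Finset.sum_sub_distrib, h3] at h5
    rw [h4]
    linarith
  have h6 := Finset.sum_le_sum fun φ (_ : φ ∈ Finset.univ) => key φ
  rw [Finset.sum_sub_distrib, Finset.sum_add_distrib, ← Finset.sum_mul, hS] at h6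
  refine h6.trans (le_trans (le_of_eq ?_) (hC v hv0))
  rw [Finset.sum_comm]
  congr 1
  · rw [Finset.sum_comm (γ := X)]
    refine Finset.sum_congr rfl fun z _ => ?_
    rw [Finset.sum_comm]
    refine Finset.sum_congr rfl fun x _ => ?_
    have h7 : ∀ a, klTerm (a * κ x z) (a * V z) = a * klTerm (κ x z) (V z) := by
      intro a
      rw [mul_comm a, mul_comm a, klTerm_mul_right, mul_comm]
    simp only [h7, ← Finset.sum_mul]
    exact (h7 (v x)).symm
  · simp [klTerm, hSdef]

lemma condEnt_sub_le_of_hasCapacityBound {p : Φ → B → ℝ} {u : Φ → B × X → ℝ} {q : Φ → B × A → ℝ}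
    {κ : X → Z → ℝ} {R : B → A → ℝ} {ζ : A → Z} {C : ℝ} (hC : HasCapacityBound κ C)
    (hu : ∀ φ c, 0 ≤ u φ c) (hκ : ∀ x z, 0 ≤ κ x z) (hκ1 : ∀ x, ∑ z, κ x z = 1)
    (hR : ∀ b (f : Z → ℝ), ∑ a, f (ζ a) * R b a = ∑ z, f z)
    (hp : ∀ φ b, p φ b = ∑ x, u φ (b, x))
    (hq : ∀ φ b a, q φ (b, a) = (∑ x, u φ (b, x) * κ x (ζ a)) * R b a) :
    condEnt p - condEnt q ≤ C * ∑ φ, ∑ b, p φ b := by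
  rw [condEnt_channel hR hq, condEnt]
  have := Finset.sum_le_sum fun b (_ : b ∈ Finset.univ) =>
    sum_klTerm_mul_le (fun φ x => u φ (b, x)) κ (fun φ x => hu φ _) hκ hκ1 hC
  simp only [Finset.sum_sub_distrib, ← Finset.mul_sum, ← hp] at this
  rw [Finset.sum_comm (γ := Φ)]
  linarith

end Step

end

noncomputable section

/-! ### Relative entropy, contraction and capacity on finite alphabets -/

lemma PMF.sum_toReal {α : Type*} [Fintype α] (p : PMF α) : ∑ a, (p a).toReal = 1 := by
  rw [← ENNReal.toReal_sum fun a _ => p.apply_ne_top a, ← tsum_fintype (L := .unconditional _),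
    p.tsum_coe, ENNReal.toReal_one]

lemma PMF.toReal_bind_apply {α β : Type*} [Fintype α] (p : PMF α) (K : α → PMF β) (b : β) :
    (p.bind K b).toReal = ∑ a, (p a).toReal * (K a b).toReal := by
  rw [PMF.bind_apply, tsum_fintype, ENNReal.toReal_sum]
  · simp
  · exact fun a _ => ENNReal.mul_ne_top (p.apply_ne_top a) ((K a).apply_ne_top b)

lemma relEntropy_of_not_ac {α : Type*} {q p : PMF α} {a : α} (h : p a = 0) (h' : q a ≠ 0) :
    relEntropy q p = ∞ := by
  let : MeasurableSpace α := ⊤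
  refine InformationTheory.klDiv_of_not_ac fun hac => h' ?_
  have hms : MeasurableSet {a} := trivial
  have := @hac {a}
  rwa [PMF.toMeasure_apply_singleton _ _ hms, PMF.toMeasure_apply_singleton _ _ hms,
    imp_iff_right h] at this

lemma relEntropy_of_ac {α : Type*} [Fintype α] {q p : PMF α} (h : ∀ a, p a = 0 → q a = 0) :
    relEntropy q p = ENNReal.ofReal (∑ a, klTerm (q a).toReal (p a).toReal) := by
  let : MeasurableSpace α := ⊤
  have hms : ∀ a : α, MeasurableSet {a} := fun a => trivial
  have hac : q.toMeasure ≪ p.toMeasure := by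
    refine Measure.AbsolutelyContinuous.mk fun s hs h0 => ?_
    rw [PMF.toMeasure_apply_eq_zero_iff _ hs] at h0 ⊢
    exact h0.mono_left fun a ha => fun h1 => ha (h a h1)
  have hint : Integrable (llr q.toMeasure p.toMeasure) q.toMeasure := Integrable.of_finite
  have htop := InformationTheory.klDiv_ne_top hac hint
  have hval := InformationTheory.toReal_klDiv_of_measure_eq hac (by simp)
  rw [relEntropy, ← ENNReal.ofReal_toReal htop, hval, PMF.integral_eq_sum]
  congr 1
  refine Finset.sum_congr rfl fun a _ => ?_
  by_cases hqa : q a = 0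
  · simp [hqa, klTerm]
  have hpa : p a ≠ 0 := fun h1 => hqa (h a h1)
  -- Integrating the density over an atom identifies it there as `q a / p a`.
  have h1 := Measure.setLIntegral_rnDeriv hac {a}
  rw [Measure.restrict_singleton, lintegral_smul_measure, lintegral_dirac,
    PMF.toMeasure_apply_singleton _ _ (hms a), PMF.toMeasure_apply_singleton _ _ (hms a)] at h1
  have h2 : (q.toMeasure.rnDeriv p.toMeasure a) = q a / p a := by
    rw [ENNReal.eq_div_iff hpa (p.apply_ne_top a)]
    exact h1
  rw [llr, h2, ENNReal.toReal_div, klTerm, smul_eq_mul]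

/-- The normalisation of a nonnegative vector. -/
def normPMF {X : Type*} [Fintype X] (v : X → ℝ) (hv : ∀ x, 0 ≤ v x) (h : 0 < ∑ x, v x) : PMF X :=
  PMF.ofFintype (fun x => ENNReal.ofReal (v x / ∑ x, v x)) (by
    rw [← ENNReal.ofReal_sum_of_nonneg fun x _ => div_nonneg (hv x) h.le, ← Finset.sum_div,
      div_self h.ne', ENNReal.ofReal_one])

lemma normPMF_toReal {X : Type*} [Fintype X] (v : X → ℝ) (hv : ∀ x, 0 ≤ v x)
    (h : 0 < ∑ x, v x) (x : X) : v x = (∑ x, v x) * (normPMF v hv h x).toReal := by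
  rw [normPMF, PMF.ofFintype_apply, ENNReal.toReal_ofReal (div_nonneg (hv x) h.le)]
  field_simp

lemma klTerm_mul_mul {q p : ℝ} (h : p = 0 → q = 0) {U V : ℝ} (hU : 0 < U) (hV : 0 < V) :
    klTerm (U * q) (V * p) = U * (klTerm q p + q * Real.log (U / V)) := by
  by_cases hq : q = 0
  · simp [hq, klTerm]
  have hp : p ≠ 0 := fun h1 => hq (h h1)
  rw [klTerm, klTerm, mul_div_mul_comm, Real.log_mul (by positivity) (by positivity)]
  ring

/-! ### From `sdpiConst` and `capacity` to homogeneous finite inequalities. -/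

section Channel

variable {X Y : Type*} [Fintype X] [Fintype Y]

/-- Normalising by `U = ∑ u` and `V = ∑ v` turns both differences in `HasSDPI` into `U` times a
relative entropy, because the terms `U log (U / V)` cancel against `klTerm U V`. -/
lemma hasSDPI_of_sdpiConst_le {K : X → PMF Y} {η : ℝ} (hη : 0 ≤ η)
    (h : sdpiConst K ≤ ENNReal.ofReal η) : HasSDPI (fun x y => (K x y).toReal) η := by
  intro u v hu hv huv
  rcases (Finset.sum_nonneg fun x _ => hu x).eq_or_lt with h0 | hU
  · have h1 := fun x => (Finset.sum_eq_zero_iff_of_nonneg fun x _ => hu x).1 h0.symm x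
      (Finset.mem_univ x)
    simp [h1, klTerm]
  have hV : 0 < ∑ x, v x := by
    refine (Finset.sum_nonneg fun x _ => hv x).lt_of_ne fun h => hU.ne' ?_
    exact Finset.sum_eq_zero fun i hi =>
      huv i ((Finset.sum_eq_zero_iff_of_nonneg fun x _ => hv x).1 h.symm i hi)
  set q := normPMF u hu hU with hq
  set p := normPMF v hv hV with hp
  have hqv : ∀ x, u x = (∑ x, u x) * (q x).toReal := normPMF_toReal u hu hU
  have hpv : ∀ x, v x = (∑ x, v x) * (p x).toReal := normPMF_toReal v hv hV
  set U := ∑ x, u x with hUd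
  set V := ∑ x, v x with hVd
  have hac : ∀ x, (p x).toReal = 0 → (q x).toReal = 0 := by
    intro x hx
    have := huv x (by rw [hpv x, hx, mul_zero])
    rw [hqv x] at this
    exact (mul_eq_zero.1 this).resolve_left hU.ne'
  have hac' : ∀ x, p x = 0 → q x = 0 := by
    intro x hx
    have := hac x (by rw [hx]; rfl)
    exact (ENNReal.toReal_eq_zero_iff _).1 this |>.resolve_right (q.apply_ne_top x)
  have hacK : ∀ y, p.bind K y = 0 → q.bind K y = 0 := by
    intro y hy
    rw [PMF.bind_apply, ENNReal.tsum_eq_zero] at hy ⊢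
    intro x
    rcases mul_eq_zero.1 (hy x) with h1 | h1
    · rw [hac' x h1, zero_mul]
    · rw [h1, mul_zero]
  have hacK' : ∀ y, (p.bind K y).toReal = 0 → (q.bind K y).toReal = 0 := by
    intro y hy
    rw [hacK y ((ENNReal.toReal_eq_zero_iff _).1 hy |>.resolve_right ((p.bind K).apply_ne_top y))]
    rfl
  have hmain : ∑ y, klTerm (q.bind K y).toReal (p.bind K y).toReal ≤
      η * ∑ x, klTerm (q x).toReal (p x).toReal := by
    -- Equal laws are excluded from the supremum, but then both sides vanish.
    by_cases hqp : q = p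
    · simp [hqp, klTerm_self]
    have h1 : relEntropy (q.bind K) (p.bind K) / relEntropy q p ≤ ENNReal.ofReal η :=
      le_trans (le_iSup_of_le p (le_iSup_of_le q
        (le_iSup_of_le (f := fun _ : q ≠ p => _) hqp le_rfl))) h
    have h2 : 0 ≤ ∑ x, klTerm (q x).toReal (p x).toReal := by
      have := klTerm_sum_le Finset.univ (fun x => (q x).toReal) (fun x => (p x).toReal)
        (fun x _ => ENNReal.toReal_nonneg) (fun x _ => ENNReal.toReal_nonneg) fun x _ => hac x
      rwa [PMF.sum_toReal, PMF.sum_toReal, klTerm_self] at this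
    have hne : relEntropy q p ≠ 0 := by
      let : MeasurableSpace X := ⊤
      intro h0
      exact hqp (PMF.toMeasure_injective (InformationTheory.klDiv_eq_zero_iff.1 h0))
    have htop : relEntropy q p ≠ ∞ := by rw [relEntropy_of_ac hac']; exact ENNReal.ofReal_ne_top
    rw [ENNReal.div_le_iff hne htop, relEntropy_of_ac hac', relEntropy_of_ac hacK,
      ← ENNReal.ofReal_mul hη] at h1
    exact (ENNReal.ofReal_le_ofReal_iff (mul_nonneg hη h2)).1 h1
  have e1 : ∀ y, klTerm (∑ x, u x * (K x y).toReal) (∑ x, v x * (K x y).toReal) =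
      U * (klTerm (q.bind K y).toReal (p.bind K y).toReal +
        (q.bind K y).toReal * Real.log (U / V)) := by
    intro y
    rw [← klTerm_mul_mul (hacK' y) hU hV, PMF.toReal_bind_apply, PMF.toReal_bind_apply,
      Finset.mul_sum, Finset.mul_sum]
    congr 1
    · exact Finset.sum_congr rfl fun x _ => by rw [hqv x, mul_assoc]
    · exact Finset.sum_congr rfl fun x _ => by rw [hpv x, mul_assoc]
  have e2 : ∀ x, klTerm (u x) (v x) =
      U * (klTerm (q x).toReal (p x).toReal + (q x).toReal * Real.log (U / V)) := by
    intro x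
    rw [← klTerm_mul_mul (hac x) hU hV, ← hqv, ← hpv]
  simp only [e1, e2, ← Finset.mul_sum, Finset.sum_add_distrib, ← Finset.sum_mul, PMF.sum_toReal]
  have e3 : klTerm U V = U * Real.log (U / V) := rfl
  rw [e3]
  have := mul_le_mul_of_nonneg_left hmain hU.le
  linarith

/-- Mutual information (in nats) as a finite sum. -/
def mutualInfoReal (p : PMF X) (K : X → PMF Y) : ℝ :=
  ∑ x, ∑ y, klTerm ((p x).toReal * (K x y).toReal) ((p x).toReal * (p.bind K y).toReal)

omit [Fintype X] [Fintype Y] in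
lemma bind_map_mk_apply (p : PMF X) (K : X → PMF Y) (x : X) (y : Y) :
    (p.bind fun x => (K x).map fun y => (x, y)) (x, y) = p x * K x y := by
  classical
  rw [PMF.bind_apply, tsum_eq_single x]
  · rw [PMF.map_apply, tsum_eq_single y]
    · simp
    · intro y' hy'
      simp [hy'.symm]
  · intro x' hx'
    simp only [mul_eq_zero]
    right
    rw [PMF.map_apply, ENNReal.tsum_eq_zero]
    intro y'
    simp [hx'.symm]

omit [Fintype X] [Fintype Y] in
lemma bind_apply_eq_zero {p : PMF X} {K : X → PMF Y} {x : X} {y : Y}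
    (h : p.bind K y = 0) : p x * K x y = 0 := by
  rw [PMF.bind_apply, ENNReal.tsum_eq_zero] at h
  exact h x

lemma mutualInfo_eq (p : PMF X) (K : X → PMF Y) :
    mutualInfo p K = ENNReal.ofReal (mutualInfoReal p K) := by
  rw [mutualInfo, relEntropy_of_ac, Fintype.sum_prod_type]
  · simp only [bind_map_mk_apply p K, bind_map_mk_apply p fun _ => p.bind K, ENNReal.toReal_mul,
      mutualInfoReal]
  · rintro ⟨x, y⟩ h
    rw [bind_map_mk_apply p fun _ => p.bind K, mul_eq_zero] at h
    rw [bind_map_mk_apply p K]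
    rcases h with h | h
    · rw [h, zero_mul]
    · exact bind_apply_eq_zero h

/-- Output entropy minus the conditional entropy of the output given the input; this makes capacity
bounds immediate. -/
lemma mutualInfoReal_eq (p : PMF X) (K : X → PMF Y) :
    mutualInfoReal p K = ∑ y, Real.negMulLog (p.bind K y).toReal -
      ∑ x, (p x).toReal * ∑ y, Real.negMulLog (K x y).toReal := by
  have h : ∀ x y, klTerm ((p x).toReal * (K x y).toReal) ((p x).toReal * (p.bind K y).toReal) =
      -((p x).toReal * Real.negMulLog (K x y).toReal) -
        (p x).toReal * (K x y).toReal * Real.log (p.bind K y).toReal := by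
    intro x y
    by_cases h0 : (p x).toReal * (K x y).toReal = 0
    · rcases mul_eq_zero.1 h0 with h1 | h1 <;> simp [h1, klTerm]
    have h1 : (p.bind K y).toReal ≠ 0 := by
      intro h2
      rw [ENNReal.toReal_eq_zero_iff, or_iff_left ((p.bind K).apply_ne_top y)] at h2
      exact h0 (by rw [← ENNReal.toReal_mul, bind_apply_eq_zero h2, ENNReal.toReal_zero])
    have h3 := mul_ne_zero_iff.1 h0
    rw [klTerm, mul_div_mul_left _ _ h3.1, Real.log_div h3.2 h1, Real.negMulLog]
    ring
  simp only [mutualInfoReal, h, Finset.sum_sub_distrib]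
  rw [Finset.sum_comm (f := fun x y => (p x).toReal * (K x y).toReal * _)]
  simp only [← Finset.sum_mul, ← PMF.toReal_bind_apply, Finset.mul_sum, Finset.sum_neg_distrib,
    Real.negMulLog]
  simp only [neg_mul, Finset.sum_neg_distrib]
  ring

lemma sum_negMulLog_le_log_card (q : PMF Y) :
    ∑ y, Real.negMulLog (q y).toReal ≤ Real.log (Fintype.card Y) := by
  have := klTerm_sum_le Finset.univ (fun y => (q y).toReal) (fun _ => (1 : ℝ))
    (fun x _ => ENNReal.toReal_nonneg) (fun x _ => zero_le_one) (by simp)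
  rw [PMF.sum_toReal] at this
  simp only [klTerm, Finset.sum_const, Finset.card_univ, nsmul_eq_mul, mul_one, one_mul, one_div,
    Real.log_inv, div_one] at this
  simp only [Real.negMulLog, neg_mul, Finset.sum_neg_distrib]
  linarith

lemma capacity_le_of_forall {K : X → PMF Y} {C : ℝ} (h : ∀ p, mutualInfoReal p K ≤ C) :
    capacity K ≤ ENNReal.ofReal (C / Real.log 2) := by
  rw [capacity, ENNReal.ofReal_div_of_pos (Real.log_pos one_lt_two)]
  refine ENNReal.div_le_div_right (iSup_le fun p => ?_) _
  rw [mutualInfo_eq]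
  exact ENNReal.ofReal_le_ofReal (h p)

lemma capacity_ne_top (K : X → PMF Y) : capacity K ≠ ∞ := by
  refine ne_top_of_le_ne_top ENNReal.ofReal_ne_top (capacity_le_of_forall
    (C := Real.log (Fintype.card Y)) fun p => ?_)
  rw [mutualInfoReal_eq]
  have h1 := sum_negMulLog_le_log_card (p.bind K)
  have h2 : 0 ≤ ∑ x, (p x).toReal * ∑ y, Real.negMulLog (K x y).toReal :=
    Finset.sum_nonneg fun x _ => mul_nonneg ENNReal.toReal_nonneg
      (Finset.sum_nonneg fun y _ => Real.negMulLog_nonneg ENNReal.toReal_nonneg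
        (ENNReal.toReal_le_of_le_ofReal zero_le_one (by simpa using (K x).coe_le_one y)))
  linarith

/-- The factor `log 2` converts bits to nats. If `v` has mass `V`, the product `v x * ∑ v x' * κ x'
z` scales like `V²`; the term `klTerm V 1 = V log V` in `HasCapacityBound` compensates for the
second factor. -/
lemma hasCapacityBound_of_capacity_le {K : X → PMF Y} {C : ℝ} (hC : 0 ≤ C)
    (h : capacity K ≤ ENNReal.ofReal C) :
    HasCapacityBound (fun x y => (K x y).toReal) (C * Real.log 2) := by
  intro v hv
  have hlog := Real.log_pos one_lt_two
  rcases (Finset.sum_nonneg fun x _ => hv x).eq_or_lt with h0 | hV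
  · have h1 := fun x => (Finset.sum_eq_zero_iff_of_nonneg fun x _ => hv x).1 h0.symm x
      (Finset.mem_univ x)
    simp [h1, klTerm]
  set p := normPMF v hv hV with hp
  have hpv : ∀ x, v x = (∑ x, v x) * (p x).toReal := normPMF_toReal v hv hV
  set V := ∑ x, v x with hVd
  have hI : mutualInfoReal p K ≤ C * Real.log 2 := by
    have h1 : mutualInfo p K ≤ ENNReal.ofReal (C * Real.log 2) := by
      rw [ENNReal.ofReal_mul hC, ← ENNReal.div_le_iff (by simpa using hlog) ENNReal.ofReal_ne_top]
      exact le_trans (ENNReal.div_le_div_right (le_iSup (fun p => mutualInfo p K) p) _) h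
    rw [mutualInfo_eq] at h1
    exact (ENNReal.ofReal_le_ofReal_iff (by positivity)).1 h1
  have e1 : ∀ x y, klTerm (v x * (K x y).toReal) (v x * ∑ x', v x' * (K x' y).toReal) =
      V * (klTerm ((p x).toReal * (K x y).toReal) ((p x).toReal * (p.bind K y).toReal) -
        (p x).toReal * (K x y).toReal * Real.log V) := by
    intro x y
    have h2 : ∑ x', v x' * (K x' y).toReal = V * (p.bind K y).toReal := by
      rw [PMF.toReal_bind_apply, Finset.mul_sum]
      exact Finset.sum_congr rfl fun x _ => by rw [hpv x, mul_assoc]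
    have h3 : (p x).toReal * (p.bind K y).toReal = 0 → (p x).toReal * (K x y).toReal = 0 := by
      intro h4
      rcases mul_eq_zero.1 h4 with h4 | h4
      · rw [h4, zero_mul]
      · rw [ENNReal.toReal_eq_zero_iff, or_iff_left ((p.bind K).apply_ne_top y)] at h4
        rw [← ENNReal.toReal_mul, bind_apply_eq_zero h4, ENNReal.toReal_zero]
    have h5 := klTerm_mul_mul h3 hV (mul_pos hV hV)
    rw [h2, hpv x, mul_assoc, show V * (p x).toReal * (V * (p.bind K y).toReal) =
      V * V * ((p x).toReal * (p.bind K y).toReal) by ring, h5, div_mul_cancel_left₀ hV.ne',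
      Real.log_inv]
    ring
  simp only [e1, ← Finset.mul_sum, Finset.sum_sub_distrib, ← Finset.sum_mul, PMF.sum_toReal,
    mul_one, one_mul]
  have e3 : klTerm V 1 = V * Real.log V := by simp [klTerm]
  rw [e3]
  have := mul_le_mul_of_nonneg_left hI hV.le
  rw [mutualInfoReal] at this
  linarith

end Channel

/-! ### The binary symmetric channel -/

lemma bsc_toReal (p : ℝ≥0) (hp : p ≤ 1) (x y : Bool) :
    (bsc p hp x y).toReal = if y = x then 1 - (p : ℝ) else p := by
  rw [bsc, PMF.ofFintype_apply]
  split_ifs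
  · rw [ENNReal.coe_toReal, NNReal.coe_sub hp, NNReal.coe_one]
  · simp

/-- The output entropy is at most `log 2`, and every input leaves the conditional output entropy
`binEntropy p`. -/
lemma capacity_bsc_le (p : ℝ≥0) (hp : p ≤ 1) :
    capacity (bsc p hp) ≤ ENNReal.ofReal (1 - h2 p) := by
  have hlog := Real.log_pos one_lt_two
  have : 1 - h2 p = (Real.log 2 - Real.binEntropy p) / Real.log 2 := by
    rw [h2]; field_simp
  rw [this]
  refine capacity_le_of_forall fun q => ?_
  rw [mutualInfoReal_eq]
  have h1 : ∀ x, ∑ y, Real.negMulLog (bsc p hp x y).toReal = Real.binEntropy p := by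
    intro x
    rw [Real.binEntropy_eq_negMulLog_add_negMulLog_one_sub]
    cases x <;> simp [bsc_toReal, add_comm]
  have h2 := sum_negMulLog_le_log_card (q.bind (bsc p hp))
  simp only [h1, ← Finset.sum_mul, PMF.sum_toReal, one_mul]
  simpa using h2

/-- The relative entropy of two Bernoulli laws, in nats, up to a term that depends on `a` only. -/
def binCross (a b : ℝ) : ℝ := -(a * Real.log b) - (1 - a) * Real.log (1 - b)

lemma hasDerivAt_binCross (a : ℝ) {b : ℝ} (h0 : 0 < b) (h1 : b < 1) :
    HasDerivAt (binCross a) ((b - a) / (b * (1 - b))) b := by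
  have h1' : 0 < 1 - b := by linarith
  have := (((Real.hasDerivAt_log h0.ne').const_mul a).neg).sub
    ((((hasDerivAt_id b).const_sub 1).log h1'.ne').const_mul (1 - a))
  refine this.congr_deriv ?_
  simp only [id]
  field_simp
  ring

/-- The relative entropy of two Bernoulli laws, in nats. -/
def binKL (a b : ℝ) : ℝ := binCross a b - binCross a a

lemma klTerm_add_klTerm {a b : ℝ} (h0 : 0 < b) (h1 : b < 1) :
    klTerm a b + klTerm (1 - a) (1 - b) = binKL a b := by
  have h : ∀ a b : ℝ, b ≠ 0 → klTerm a b = a * Real.log a - a * Real.log b := by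
    intro a b hb
    by_cases ha : a = 0
    · simp [ha, klTerm]
    rw [klTerm, Real.log_div ha hb]; ring
  rw [h a b h0.ne', h _ _ (by linarith), binKL, binCross, binCross]
  ring

/-- For fixed `a`, the right side minus the left has derivative `c² (t - a) (1 / (t (1 - t)) - 1 /
(s (1 - s)))` at `b = t`, where `s = p + c t`. Since `s - 1/2 = c (t - 1/2)`, noise moves `t`
towards `1/2` and the last factor is nonnegative. The difference is therefore minimal at `t = a`,
where it vanishes. The endpoints `a = 0, 1` follow by continuity. -/
lemma binKL_flip_le {c p a b : ℝ} (hp0 : 0 ≤ p) (hp1 : p ≤ 1) (hc : c = 1 - 2 * p) (ha0 : 0 ≤ a)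
    (ha1 : a ≤ 1) (hb0 : 0 < b) (hb1 : b < 1) :
    binKL (p + c * a) (p + c * b) ≤ c ^ 2 * binKL a b := by
  have hpos : ∀ t, 0 < t → t < 1 → 0 < p + c * t ∧ p + c * t < 1 := by
    intro t h0 h1
    constructor <;> rw [hc]
    · rcases hp0.eq_or_lt with rfl | h
      · simpa using h0
      · nlinarith [mul_pos h (sub_pos.2 h1), mul_nonneg (sub_nonneg.2 hp1) h0.le]
    · rcases hp0.eq_or_lt with rfl | h
      · simpa using h1
      · nlinarith [mul_pos h h0, mul_nonneg (sub_nonneg.2 hp1) (sub_pos.2 h1).le]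
  have hc2 : c ^ 2 ≤ 1 := by rw [hc]; nlinarith
  -- the difference of the two sides as a function of `b`
  set g : ℝ → ℝ → ℝ := fun a t => c ^ 2 * binCross a t - binCross (p + c * a) (p + c * t) with hg
  have hderiv : ∀ a t, 0 < t → t < 1 → HasDerivAt (g a)
      (c ^ 2 * (t - a) * (1 / (t * (1 - t)) - 1 / ((p + c * t) * (1 - (p + c * t))))) t := by
    intro a t h0 h1
    obtain ⟨h2, h3⟩ := hpos t h0 h1
    have d1 := (hasDerivAt_binCross a h0 h1).const_mul (c ^ 2)
    have d2 : HasDerivAt (fun t => p + c * t) c t := by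
      simpa using ((hasDerivAt_id t).const_mul c).const_add p
    have d3 := (hasDerivAt_binCross (p + c * a) h2 h3).comp t d2
    refine (d1.sub d3).congr_deriv ?_
    ring
  have hsign : ∀ t, 0 < t → t < 1 →
      0 ≤ 1 / (t * (1 - t)) - 1 / ((p + c * t) * (1 - (p + c * t))) := by
    intro t h0 h1
    obtain ⟨h2, h3⟩ := hpos t h0 h1
    rw [sub_nonneg]
    refine one_div_le_one_div_of_le (mul_pos h0 (sub_pos.2 h1)) ?_
    rw [hc] at *
    nlinarith [mul_nonneg (sub_nonneg.2 hc2) (sq_nonneg (t - 1 / 2))]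
  have hint : ∀ a, 0 < a → a < 1 → g a a ≤ g a b := by
    intro a ha0 ha1
    rcases lt_trichotomy a b with h | h | h
    · obtain ⟨t, ht, hs⟩ := exists_hasDerivAt_eq_slope (g a) _ h
        (fun t ht => (hderiv a t (ha0.trans_le ht.1)
          (ht.2.trans_lt hb1)).continuousAt.continuousWithinAt)
        (fun t ht => hderiv a t (ha0.trans ht.1) (ht.2.trans hb1))
      have h1 := mul_nonneg (mul_nonneg (sq_nonneg c) (sub_nonneg.2 ht.1.le))
        (hsign t (ha0.trans ht.1) (ht.2.trans hb1))
      rw [hs] at h1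
      have := mul_nonneg h1 (sub_pos.2 h).le
      rw [div_mul_cancel₀ _ (sub_pos.2 h).ne'] at this
      linarith
    · rw [h]
    · obtain ⟨t, ht, hs⟩ := exists_hasDerivAt_eq_slope (g a) _ h
        (fun t ht => (hderiv a t (hb0.trans_le ht.1)
          (ht.2.trans_lt ha1)).continuousAt.continuousWithinAt)
        (fun t ht => hderiv a t (hb0.trans ht.1) (ht.2.trans ha1))
      have h1 := mul_nonneg (mul_nonneg (sq_nonneg c) (sub_nonneg.2 ht.2.le))
        (hsign t (hb0.trans ht.1) (ht.2.trans ha1))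
      have h2 : 0 ≤ -((g a a - g a b) / (a - b)) := by rw [← hs]; linarith
      rw [neg_nonneg] at h2
      have := (div_le_iff₀ (sub_pos.2 h)).1 h2
      linarith
  have hself : Continuous fun a => binCross a a := by
    have : (fun a => binCross a a) =
      fun a : ℝ => -(a * Real.log a) - (1 - a) * Real.log (1 - a) := rfl
    rw [this]
    exact Real.continuous_mul_log.neg.sub
      (Real.continuous_mul_log.comp (continuous_const.sub continuous_id))
  have hlin : ∀ b, Continuous fun a => binCross a b := by
    intro b
    unfold binCross
    fun_prop
  have haff : Continuous fun a : ℝ => p + c * a := by fun_prop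
  have hclos : a ∈ closure (Set.Ioo (0 : ℝ) 1) := by
    rw [closure_Ioo zero_ne_one]; exact ⟨ha0, ha1⟩
  refine le_on_closure (f := fun a => binKL (p + c * a) (p + c * b))
    (g := fun a => c ^ 2 * binKL a b) (s := Set.Ioo 0 1) (fun a ha => ?_) ?_ ?_ hclos
  · have := hint a ha.1 ha.2
    simp only [hg, binKL] at this ⊢
    linarith
  · exact ((((hlin _).comp haff).sub (hself.comp haff)).continuousOn)
  · exact (continuous_const.mul ((hlin _).sub hself)).continuousOn

lemma sdpiConst_bsc_le (p : ℝ≥0) (hp : p ≤ 1) :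
    sdpiConst (bsc p hp) ≤ ENNReal.ofReal ((1 - 2 * p) ^ 2) := by
  refine iSup_le fun P => iSup_le fun Q => iSup_le fun hne => ?_
  by_cases hac : ∀ x, P x = 0 → Q x = 0
  swap
  · push Not at hac
    obtain ⟨x, h1, h2⟩ := hac
    rw [relEntropy_of_not_ac h1 h2, ENNReal.div_top]
    exact zero_le
  have hsum : ∀ R : PMF Bool, (R false).toReal = 1 - (R true).toReal := by
    intro R
    have := R.sum_toReal
    rw [Fintype.sum_bool] at this
    linarith
  have hle : ∀ R : PMF Bool, (R true).toReal ≤ 1 := by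
    intro R
    have := hsum R
    have : 0 ≤ (R false).toReal := ENNReal.toReal_nonneg
    linarith
  have hacr : ∀ x, (P x).toReal = 0 → (Q x).toReal = 0 := by
    intro x hx
    rw [hac x ((ENNReal.toReal_eq_zero_iff _).1 hx |>.resolve_right (P.apply_ne_top x))]
    rfl
  have hext : (Q true).toReal = (P true).toReal → False := by
    intro h
    refine hne (PMF.ext fun x => ?_)
    rw [← ENNReal.toReal_eq_toReal_iff' (Q.apply_ne_top x) (P.apply_ne_top x)]
    cases x
    · rw [hsum, hsum, h]
    · exact h
  have hacK : ∀ y, P.bind (bsc p hp) y = 0 → Q.bind (bsc p hp) y = 0 := by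
    intro y hy
    rw [PMF.bind_apply, ENNReal.tsum_eq_zero] at hy ⊢
    intro x
    rcases mul_eq_zero.1 (hy x) with h1 | h1
    · rw [hac x h1, zero_mul]
    · rw [h1, mul_zero]
  set a := (Q true).toReal with ha
  set b := (P true).toReal with hb
  -- If `P` were a point mass, absolute continuity would force `Q = P`.
  have hb0 : 0 < b := ENNReal.toReal_nonneg.lt_of_ne fun h => hext ((hacr true h.symm).trans h)
  have hb1 : b < 1 := by
    refine (hle P).lt_of_ne fun h => hext ?_
    have h1 : (P false).toReal = 0 := by rw [hsum]; linarith
    have h2 := hacr false h1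
    rw [hsum] at h2
    linarith
  have hp1 : (p : ℝ) ≤ 1 := by exact_mod_cast hp
  have hbind : ∀ R : PMF Bool, (R.bind (bsc p hp) true).toReal =
      p + (1 - 2 * p) * (R true).toReal := by
    intro R
    rw [PMF.toReal_bind_apply, Fintype.sum_bool, hsum R]
    simp only [bsc_toReal]
    simp
    ring
  have h0 : relEntropy Q P = ENNReal.ofReal (binKL a b) := by
    rw [relEntropy_of_ac hac, Fintype.sum_bool, hsum, hsum, klTerm_add_klTerm hb0 hb1]
  have h1 : relEntropy (Q.bind (bsc p hp)) (P.bind (bsc p hp)) ≤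
      ENNReal.ofReal ((1 - 2 * p) ^ 2 * binKL a b) := by
    rw [relEntropy_of_ac hacK, Fintype.sum_bool, hsum, hsum, hbind, hbind]
    refine ENNReal.ofReal_le_ofReal (le_trans (le_of_eq ?_)
      (binKL_flip_le p.2 hp1 rfl ENNReal.toReal_nonneg (hle Q) hb0 hb1))
    have h2 : 0 < (p : ℝ) + (1 - 2 * p) * b ∧ (p : ℝ) + (1 - 2 * p) * b < 1 := by
      have hp0 : (0 : ℝ) ≤ p := p.2
      constructor
      · rcases hp0.eq_or_lt with h | h
        · simpa [← h] using hb0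
        · nlinarith [mul_pos h (sub_pos.2 hb1), mul_nonneg (sub_nonneg.2 hp1) hb0.le]
      · rcases hp0.eq_or_lt with h | h
        · simpa [← h] using hb1
        · nlinarith [mul_pos h hb0, mul_nonneg (sub_nonneg.2 hp1) (sub_pos.2 hb1).le]
    exact klTerm_add_klTerm h2.1 h2.2
  refine ENNReal.div_le_of_le_mul ?_
  rwa [h0, ← ENNReal.ofReal_mul (sq_nonneg _)]

end

noncomputable section

/-! ### Sums over product alphabets -/

/-- Sums out all coordinates but one under a product law; it supplies the hypothesis `hR` of the
one-step estimates. -/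
lemma sum_mul_prod_ne {ι : Type*} [Fintype ι] [DecidableEq ι] {Y : ι → Type*} [∀ i, Fintype (Y i)]
    (i : ι) (f : Y i → ℝ) (g : ∀ j : {j // j ≠ i}, Y j → ℝ) (hg : ∀ j, ∑ y, g j y = 1) :
    ∑ a : ∀ j, Y j, f (a i) * ∏ j : {j // j ≠ i}, g j (a j) = ∑ y, f y := by
  rw [← (Equiv.piSplitAt i Y).symm.sum_comp, Fintype.sum_prod_type]
  have h : ∀ (y : Y i) (b : ∀ j : {j // j ≠ i}, Y j) (j : {j // j ≠ i}),
      (Equiv.piSplitAt i Y).symm (y, b) j = b j := by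
    intro y b j
    simp [Equiv.piSplitAt, j.2]
  have h' : ∀ (y : Y i) (b : ∀ j : {j // j ≠ i}, Y j),
      (Equiv.piSplitAt i Y).symm (y, b) i = y := by
    intro y b
    simp [Equiv.piSplitAt]
  simp only [h, h', ← Finset.mul_sum]
  refine Finset.sum_congr rfl fun y _ => ?_
  have := Finset.prod_univ_sum (fun j : {j // j ≠ i} => (Finset.univ : Finset (Y j))) g
  rw [Fintype.piFinset_univ] at this
  rw [← this, Finset.prod_eq_one fun j _ => hg j, mul_one]

lemma sum_prod_of_restrict_eq {ι : Type*} [Fintype ι] [DecidableEq ι] (p : ι → Prop)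
    [DecidablePred p] {Y : ι → Type*} [∀ i, Fintype (Y i)] [DecidableEq (∀ i : {i // p i}, Y i)] (g : ∀ i, Y i → ℝ) (hg : ∀ i, ∑ y, g i y = 1)
    (b : ∀ i : {i // p i}, Y i) :
    ∑ a : ∀ i, Y i, (if (fun i : {i // p i} => a i) = b then ∏ i, g i (a i) else 0) =
      ∏ i : {i // p i}, g i (b i) := by
  rw [← (Equiv.piEquivPiSubtypeProd p Y).symm.sum_comp, Fintype.sum_prod_type]
  have h : ∀ (x : ∀ i : {i // p i}, Y i) (z : ∀ i : {i // ¬p i}, Y i) (i : {i // p i}),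
      (Equiv.piEquivPiSubtypeProd p Y).symm (x, z) i = x i := by
    intro x z i
    simp [Equiv.piEquivPiSubtypeProd, i.2]
  have h' : ∀ (x : ∀ i : {i // p i}, Y i) (z : ∀ i : {i // ¬p i}, Y i) (i : {i // ¬p i}),
      (Equiv.piEquivPiSubtypeProd p Y).symm (x, z) i = z i := by
    intro x z i
    simp [Equiv.piEquivPiSubtypeProd, i.2]
  simp only [← Fintype.prod_subtype_mul_prod_subtype p, h, h']
  rw [Finset.sum_eq_single b]
  · simp only [if_true, ← Finset.mul_sum]
    have := Finset.prod_univ_sum (fun j : {j // ¬p j} => (Finset.univ : Finset (Y j)))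
      fun j => g j
    rw [Fintype.piFinset_univ] at this
    rw [← this, Finset.prod_eq_one fun (j : {j // ¬p j}) _ => hg j.1, mul_one]
  · intro x _ hx
    simp [hx]
  · simp

/-! ### Algorithms on chains -/

section Chain

variable {n : ℕ} {X Y : Edge (chainAdj n) → Type*} {T : ℕ}

/-- The encoding maps of all nodes, for fixed observations. -/
abbrev EncTable (X Y : Edge (chainAdj n) → Type*) (T : ℕ) : Type _ :=
  ∀ (v : Fin n) (t : Fin T), (Fin t → ∀ e : InEdge (chainAdj n) v, Y e.1) →
    ∀ e : OutEdge (chainAdj n) v, X e.1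

/-- The channel outputs of `t` steps. -/
abbrev Hist (Y : Edge (chainAdj n) → Type*) (t : ℕ) : Type _ := Fin t → ∀ e, Y e

/-- The symbol sent on edge `e` at step `t`. -/
def EncTable.msg (φ : EncTable X Y T) {t : ℕ} (ht : t < T) (y : Hist Y t) (e : Edge (chainAdj n)) :
    X e :=
  φ e.1.1 ⟨t, ht⟩ (fun s e' => y s e'.1) ⟨e, rfl⟩

variable [∀ e, Fintype (X e)] [∀ e, Fintype (Y e)] (K : ∀ e, X e → PMF (Y e))

/-- The conditional law of the first `t` batches of channel outputs. -/
def EncTable.histProb (φ : EncTable X Y T) {t : ℕ} (ht : t ≤ T) (y : Hist Y t) : ℝ :=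
  ∏ s : Fin t, ∏ e, (K e (φ.msg (s.2.trans_le ht) (fun s' => y (Fin.castLE s.2.le s')) e)
    (y s e)).toReal

lemma EncTable.histProb_nonneg (φ : EncTable X Y T) {t : ℕ} (ht : t ≤ T) (y : Hist Y t) :
    0 ≤ φ.histProb K ht y :=
  Finset.prod_nonneg fun _ _ => Finset.prod_nonneg fun _ _ => ENNReal.toReal_nonneg

lemma EncTable.histProb_snoc (φ : EncTable X Y T) {t : ℕ} (ht : t + 1 ≤ T) (y : Hist Y t)
    (a : ∀ e, Y e) :
    φ.histProb K ht (Fin.snoc (α := fun _ => ∀ e, Y e) y a) = φ.histProb K (Nat.le_of_succ_le ht) y *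
      ∏ e, (K e (φ.msg ht y e) (a e)).toReal := by
  rw [EncTable.histProb, Fin.prod_univ_castSucc]
  congr 1
  · refine Finset.prod_congr rfl fun s _ => Finset.prod_congr rfl fun e _ => ?_
    rw [Fin.snoc_castSucc]
    congr 3
    refine congrArg (fun z => φ.msg _ z e) (funext fun s' => ?_)
    exact Fin.snoc_castSucc (α := fun _ => ∀ e, Y e) a y (Fin.castLE s.2.le s')
  · refine Finset.prod_congr rfl fun e _ => ?_
    rw [Fin.snoc_last]
    congr 3
    refine congrArg (fun z => φ.msg _ z e) (funext fun s' => ?_)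
    exact Fin.snoc_castSucc (α := fun _ => ∀ e, Y e) a y s'

lemma sum_hist_succ {t : ℕ} (f : Hist Y (t + 1) → ℝ) :
    ∑ y, f y = ∑ y : Hist Y t, ∑ a, f (Fin.snoc (α := fun _ => ∀ e, Y e) y a) := by
  rw [← (Fin.snocEquiv fun _ => ∀ e, Y e).sum_comp, Fintype.sum_prod_type, Finset.sum_comm]
  rfl

lemma EncTable.sum_prod_msg (φ : EncTable X Y T) {t : ℕ} (ht : t < T) (y : Hist Y t) :
    ∑ a : ∀ e, Y e, ∏ e, (K e (φ.msg ht y e) (a e)).toReal = 1 := by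
  have := Finset.prod_univ_sum (fun e => (Finset.univ : Finset (Y e)))
    fun e z => (K e (φ.msg ht y e) z).toReal
  rw [Fintype.piFinset_univ] at this
  rw [← this, Finset.prod_eq_one fun e _ => (K e (φ.msg ht y e)).sum_toReal]

lemma EncTable.sum_histProb (φ : EncTable X Y T) {t : ℕ} (ht : t ≤ T) :
    ∑ y, φ.histProb K ht y = 1 := by
  induction t with
  | zero => simp [EncTable.histProb]
  | succ t ih =>
    rw [sum_hist_succ]
    simp only [EncTable.histProb_snoc, ← Finset.mul_sum, EncTable.sum_prod_msg, mul_one]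
    exact ih _

/-- The edges that enter the nodes `i, i + 1, …`. -/
abbrev BlockEdge (n i : ℕ) := {e : Edge (chainAdj n) // i ≤ (e.1.2 : ℕ)}

/-- The channel outputs of `t` steps that are received by the nodes `i, i + 1, …`. -/
abbrev BlockHist (Y : Edge (chainAdj n) → Type*) (i t : ℕ) : Type _ :=
  Fin t → ∀ e : BlockEdge n i, Y e.1

/-- The outputs that are received by the nodes `i, i + 1, …`. -/
def Hist.block (i : ℕ) {t : ℕ} (y : Hist Y t) : BlockHist Y i t := fun s e => y s e.1

/-- The symbol sent on an edge that leaves one of the nodes `i, i + 1, …`, as a function of what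
these nodes received. -/
def EncTable.blockMsg (φ : EncTable X Y T) {t : ℕ} (ht : t < T) {i : ℕ} (b : BlockHist Y i t)
    (e : Edge (chainAdj n)) (he : i ≤ (e.1.1 : ℕ)) : X e :=
  φ e.1.1 ⟨t, ht⟩ (fun s e' => b s ⟨e'.1, he.trans (by rw [e'.2])⟩) ⟨e, rfl⟩

/-- The edge from node `i` to node `i + 1`. -/
abbrev fwdEdge {i : ℕ} (hi : i + 1 < n) : Edge (chainAdj n) :=
  ⟨(⟨i, by omega⟩, ⟨i + 1, hi⟩), Or.inl rfl⟩

/-- The edge from node `i` to node `i + 1` as an edge that enters the nodes `i + 1, i + 2, …`. -/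
abbrev fwdBlock {i : ℕ} (hi : i + 1 < n) : BlockEdge n (i + 1) := ⟨fwdEdge hi, le_rfl⟩

/-- The geometry of the chain: a final block can be entered from outside through a single edge only.
-/
lemma le_tail_of_ne_fwdBlock {i : ℕ} (hi : i + 1 < n) (e : BlockEdge n (i + 1))
    (he : e ≠ fwdBlock hi) : i + 1 ≤ (e.1.1.1 : ℕ) := by
  obtain ⟨⟨⟨u, v⟩, h⟩, h'⟩ := e
  by_contra hlt
  refine he ?_
  simp only [not_le] at hlt h'
  rcases h with h | h
  · simp only at h
    refine Subtype.ext (Subtype.ext (Prod.ext (Fin.ext ?_) (Fin.ext ?_))) <;>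
      simp only <;> omega
  · simp only at h
    omega

noncomputable instance : Fintype (EncTable X Y T) := Fintype.ofFinite _

variable (m : EncTable X Y T → ℝ)

/-- The joint law of the encoding maps and the channel outputs of `t` steps. -/
def jointLaw {t : ℕ} (ht : t ≤ T) (φ : EncTable X Y T) (y : Hist Y t) : ℝ :=
  m φ * φ.histProb K ht y

/-- The conditional entropy of the encoding maps given the outputs received by `i, i + 1, …` in
`t` steps. -/
def blockEnt (i : ℕ) {t : ℕ} (ht : t ≤ T) : ℝ :=
  condEnt (pushLaw (jointLaw K m ht) fun _ => Hist.block i)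

variable {m} (hm : ∀ φ, 0 ≤ m φ) (hm1 : ∑ φ, m φ = 1)

include hm in
lemma jointLaw_nonneg {t : ℕ} (ht : t ≤ T) (φ : EncTable X Y T) (y : Hist Y t) :
    0 ≤ jointLaw K m ht φ y := mul_nonneg (hm φ) (φ.histProb_nonneg K ht y)

include hm1 in
lemma blockEnt_zero (i : ℕ) :
    blockEnt K m i (Nat.zero_le T) = ∑ φ, Real.negMulLog (m φ) := by
  have h : ∀ φ b, pushLaw (jointLaw K m (Nat.zero_le T)) (fun _ => Hist.block i) φ b = m φ := by
    intro φ b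
    rw [pushLaw, Fintype.sum_unique, if_pos (Subsingleton.elim _ _)]
    simp [jointLaw, EncTable.histProb]
  rw [blockEnt, condEnt, Fintype.sum_unique]
  simp only [h, hm1, klTerm, div_one, Real.negMulLog, neg_mul, Finset.sum_neg_distrib]

lemma sum_jointLaw {t : ℕ} (ht : t ≤ T) (φ : EncTable X Y T) :
    ∑ y, jointLaw K m ht φ y = m φ := by
  simp only [jointLaw, ← Finset.mul_sum, EncTable.sum_histProb, mul_one]

/-- The joint law of encoding maps, received outputs and the next symbol on the edge that enters
the block. -/
def inputLaw (m : EncTable X Y T → ℝ) {i : ℕ} (hi : i + 1 < n) {t : ℕ} (ht : t < T) :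
    EncTable X Y T → BlockHist Y (i + 1) t × X (fwdEdge hi) → ℝ :=
  pushLaw (jointLaw K m ht.le) fun φ y => (Hist.block (i + 1) y, φ.msg ht y (fwdEdge hi))

open scoped Classical in
/-- The conditional law of the symbols received within the block of nodes `i + 1, i + 2, …`,
except for those that come from node `i`. -/
def innerProb (c : EncTable X Y T) {i : ℕ} (hi : i + 1 < n) {t : ℕ} (ht : t < T)
    (b : BlockHist Y (i + 1) t) (a : ∀ e : BlockEdge n (i + 1), Y e.1) : ℝ :=
  ∏ e : {e : BlockEdge n (i + 1) // e ≠ fwdBlock hi},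
    (K e.1.1 (c.blockMsg ht b e.1.1 (le_tail_of_ne_fwdBlock hi e.1 e.2)) (a e.1)).toReal

lemma sum_mul_innerProb (c : EncTable X Y T) {i : ℕ} (hi : i + 1 < n) {t : ℕ} (ht : t < T)
    (b : BlockHist Y (i + 1) t) (f : Y (fwdEdge hi) → ℝ) :
    ∑ a : ∀ e : BlockEdge n (i + 1), Y e.1, f (a (fwdBlock hi)) * innerProb K c hi ht b a =
      ∑ z, f z := by
  classical
  unfold innerProb
  have := sum_mul_prod_ne (Y := fun e : BlockEdge n (i + 1) => Y e.1) (fwdBlock hi) f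
    (fun e z => (K e.1.1 (c.blockMsg ht b e.1.1 (le_tail_of_ne_fwdBlock hi e.1 e.2)) z).toReal)
    (fun e => PMF.sum_toReal _)
  refine Eq.trans (Finset.sum_congr rfl fun a _ => ?_) this
  congr

omit [∀ e, Fintype (X e)] in
lemma block_snoc_eq_iff {i t : ℕ} (y : Hist Y t) (a : ∀ e, Y e) (b : BlockHist Y i t)
    (a' : ∀ e : BlockEdge n i, Y e.1) :
    Hist.block i (Fin.snoc (α := fun _ => ∀ e, Y e) y a) =
      (Fin.snoc (α := fun _ => ∀ e : BlockEdge n i, Y e.1) b a' : BlockHist Y i (t + 1)) ↔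
      Hist.block i y = b ∧ (fun e : BlockEdge n i => a e.1) = a' := by
  have h : Hist.block i (Fin.snoc (α := fun _ => ∀ e, Y e) y a) =
      (Fin.snoc (α := fun _ => ∀ e : BlockEdge n i, Y e.1) (Hist.block i y)
        (fun e : BlockEdge n i => a e.1) : BlockHist Y i (t + 1)) := by
    funext s e
    refine Fin.lastCases ?_ (fun s => ?_) s
    · simp [Hist.block]
    · simp [Hist.block]
  rw [h]
  constructor
  · intro h1
    have h2 := (Fin.snocEquiv fun _ => ∀ e : BlockEdge n i, Y e.1).injective
      (a₁ := (fun e : BlockEdge n i => a e.1, Hist.block i y)) (a₂ := (a', b)) h1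
    exact ⟨congrArg Prod.snd h2, congrArg Prod.fst h2⟩
  · rintro ⟨rfl, rfl⟩
    rfl

variable {c : EncTable X Y T} (hc : ∀ φ, m φ ≠ 0 → ∀ v : Fin n, (v : ℕ) ≠ 0 → φ v = c v)

include hc in
-- Given `φ` and the past, the channels act independently, so the law of the new outputs is a
-- product. Apart from the factor of the edge `i → i + 1`, only encoders of nodes in the block
-- occur. None of these is node 0, so on the support of `m` they are those of `c`, and the inner
-- factor does not depend on `φ`.
lemma pushLaw_jointLaw_succ {i : ℕ} (hi : i + 1 < n) {t : ℕ} (ht : t < T) (φ : EncTable X Y T)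
    (b : BlockHist Y (i + 1) t) (a : ∀ e : BlockEdge n (i + 1), Y e.1) :
    pushLaw (jointLaw K m (t := t + 1) ht) (fun _ => Hist.block (i + 1)) φ
        (Fin.snoc (α := fun _ => ∀ e : BlockEdge n (i + 1), Y e.1) b a) =
      (∑ x, inputLaw K m hi ht φ (b, x) * (K (fwdEdge hi) x (a (fwdBlock hi))).toReal) *
        innerProb K c hi ht b a := by
  classical
  by_cases h0 : m φ = 0
  · simp [pushLaw, inputLaw, jointLaw, h0]
  have h1 : ∑ x, inputLaw K m hi ht φ (b, x) * (K (fwdEdge hi) x (a (fwdBlock hi))).toReal =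
      ∑ y, if Hist.block (i + 1) y = b then jointLaw K m ht.le φ y *
        (K (fwdEdge hi) (φ.msg ht y (fwdEdge hi)) (a (fwdBlock hi))).toReal else 0 := by
    have := sum_pushLaw_mul (jointLaw K m ht.le)
      (fun φ y => (Hist.block (i + 1) y, φ.msg ht y (fwdEdge hi))) φ
      (fun bx => if bx.1 = b then (K (fwdEdge hi) bx.2 (a (fwdBlock hi))).toReal else 0)
    rw [Fintype.sum_prod_type, Finset.sum_eq_single b] at this
    · simp only [if_true, mul_ite, mul_zero] at this
      exact this
    · intro b' _ hb'
      simp [hb']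
    · simp
  rw [h1, pushLaw, sum_hist_succ, Finset.sum_mul]
  refine Finset.sum_congr rfl fun y _ => ?_
  simp only [block_snoc_eq_iff]
  by_cases hb : Hist.block (i + 1) y = b
  swap
  · simp [hb]
  simp only [hb, true_and, if_true, jointLaw, EncTable.histProb_snoc]
  have h2 := sum_prod_of_restrict_eq (fun e : Edge (chainAdj n) => i + 1 ≤ (e.1.2 : ℕ))
    (fun e z => (K e (φ.msg ht y e) z).toReal) (fun e => PMF.sum_toReal _) a
  have h3 : ∀ a' : ∀ e, Y e, (if (fun e : BlockEdge n (i + 1) => a' e.1) = a then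
      m φ * (φ.histProb K ht.le y * ∏ e, (K e (φ.msg ht y e) (a' e)).toReal) else 0) =
      m φ * φ.histProb K ht.le y * (if (fun e : BlockEdge n (i + 1) => a' e.1) = a then
      ∏ e, (K e (φ.msg ht y e) (a' e)).toReal else 0) := by
    intro a'
    split_ifs <;> ring
  rw [Finset.sum_congr rfl fun a' _ => h3 a', ← Finset.mul_sum, h2,
    Fintype.prod_eq_mul_prod_subtype_ne _ (fwdBlock hi), ← mul_assoc]
  congr 1
  unfold innerProb
  refine Finset.prod_congr (by congr) fun e _ => ?_
  congr 3
  have ht' := le_tail_of_ne_fwdBlock hi e.1 e.2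
  rw [← hb]
  exact congrFun (congrFun (congrFun (hc φ h0 e.1.1.1.1 (by omega)) ⟨t, ht⟩) _) _

lemma condEnt_hist_succ {i t : ℕ} (p : EncTable X Y T → BlockHist Y i (t + 1) → ℝ) :
    condEnt (fun φ (ba : BlockHist Y i t × (∀ e : BlockEdge n i, Y e.1)) =>
      p φ (Fin.snoc (α := fun _ => ∀ e : BlockEdge n i, Y e.1) ba.1 ba.2)) = condEnt p :=
  condEnt_equiv ((Equiv.prodComm _ _).trans
    (Fin.snocEquiv fun _ => ∀ e : BlockEdge n i, Y e.1)) p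

lemma pushLaw_block_eq_sum {i : ℕ} (hi : i + 1 < n) {t : ℕ} (ht : t < T) (φ : EncTable X Y T)
    (b : BlockHist Y (i + 1) t) :
    pushLaw (jointLaw K m ht.le) (fun _ => Hist.block (i + 1)) φ b =
      ∑ x, inputLaw K m hi ht φ (b, x) := by
  classical
  have := sum_pushLaw_mul (jointLaw K m ht.le)
    (fun φ y => (Hist.block (i + 1) y, φ.msg ht y (fwdEdge hi))) φ
    (fun bx => if bx.1 = b then 1 else 0)
  rw [Fintype.sum_prod_type, Finset.sum_eq_single b] at this
  · simp only [if_true, mul_ite, mul_zero, mul_one] at this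
    rw [inputLaw, this, pushLaw]
    exact Finset.sum_congr rfl fun y _ => by congr
  · intro b' _ hb'
    simp [hb']
  · simp

include hm hc in
lemma blockEnt_sub_le {i : ℕ} (hi : i + 1 < n) {t : ℕ} (ht : t < T) {η : ℝ}
    (hK : HasSDPI (fun x y => (K (fwdEdge hi) x y).toReal) η) :
    blockEnt K m (i + 1) ht.le - blockEnt K m (i + 1) (t := t + 1) ht ≤
      η * (blockEnt K m (i + 1) ht.le - condEnt (inputLaw K m hi ht)) := by
  rw [blockEnt, blockEnt, ← condEnt_hist_succ]
  exact condEnt_sub_le_of_hasSDPI (R := innerProb K c hi ht) (ζ := fun a => a (fwdBlock hi)) hK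
    (pushLaw_nonneg (jointLaw_nonneg K hm ht.le) _) (sum_mul_innerProb K c hi ht)
    (pushLaw_block_eq_sum K hi ht) (pushLaw_jointLaw_succ K hc hi ht)

include hm hm1 hc in
lemma blockEnt_sub_le_capacity {i : ℕ} (hi : i + 1 < n) {t : ℕ} (ht : t < T) {C : ℝ}
    (hK : HasCapacityBound (fun x y => (K (fwdEdge hi) x y).toReal) C) :
    blockEnt K m (i + 1) ht.le - blockEnt K m (i + 1) (t := t + 1) ht ≤ C := by
  rw [blockEnt, blockEnt, ← condEnt_hist_succ]
  have := condEnt_sub_le_of_hasCapacityBound (u := inputLaw K m hi ht)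
    (p := pushLaw (jointLaw K m ht.le) fun _ => Hist.block (i + 1))
    (q := fun φ ba => pushLaw (jointLaw K m (t := t + 1) ht) (fun _ => Hist.block (i + 1)) φ
      (Fin.snoc (α := fun _ => ∀ e : BlockEdge n (i + 1), Y e.1) ba.1 ba.2)) (R := innerProb K c hi ht)
    (ζ := fun a => a (fwdBlock hi)) hK
    (pushLaw_nonneg (jointLaw_nonneg K hm ht.le) _) (fun _ _ => ENNReal.toReal_nonneg)
    (fun _ => PMF.sum_toReal _) (sum_mul_innerProb K c hi ht)
    (pushLaw_block_eq_sum K hi ht) (pushLaw_jointLaw_succ K hc hi ht)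
  simpa only [sum_pushLaw, sum_jointLaw, hm1, mul_one] using this

include hm hc in
-- For `i ≠ 0` the encoder of node `i` is fixed, so its symbol is a function of what the block
-- starting at `i` has received. For `i = 0` this fails, and only the entropy of `φ` bounds the
-- information in the symbol.
lemma blockEnt_le_inputLaw {i : ℕ} (hi0 : i ≠ 0) (hi : i + 1 < n) {t : ℕ} (ht : t < T) :
    blockEnt K m i ht.le ≤ condEnt (inputLaw K m hi ht) := by
  refine condEnt_pushLaw_le (jointLaw_nonneg K hm ht.le) _ _
    (fun b => (fun s e => b s ⟨e.1, (Nat.le_succ i).trans e.2⟩,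
      c.blockMsg ht b (fwdEdge hi) le_rfl)) fun φ y hJ => ?_
  have h0 : m φ ≠ 0 := fun h => hJ (by simp [jointLaw, h])
  rw [Prod.mk.injEq]
  refine ⟨rfl, ?_⟩
  exact congrFun (congrFun (congrFun (hc φ h0 (fwdEdge hi).1.1 hi0) ⟨t, ht⟩) _) _

end Chain

end

noncomputable section

/-! ### Solving the recursion along the chain -/

lemma binomProb_zero_succ (k : ℕ) (η : ℝ) : binomProb 0 (k + 1) η = 0 := by simp [binomProb]

lemma binomProb_of_lt {m k : ℕ} (h : m < k) (η : ℝ) : binomProb m k η = 0 := by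
  simp [binomProb, Nat.choose_eq_zero_of_lt h]

lemma binomProb_succ_zero (m : ℕ) (η : ℝ) :
    binomProb (m + 1) 0 η = (1 - η) * binomProb m 0 η := by
  simp [binomProb, pow_succ, mul_comm]

/-- Pascal's rule. The cases are needed because the exponents are truncated differences. -/
lemma binomProb_succ_succ (m k : ℕ) (η : ℝ) :
    binomProb (m + 1) (k + 1) η = (1 - η) * binomProb m (k + 1) η + η * binomProb m k η := by
  rcases lt_trichotomy m k with h | rfl | h
  · rw [binomProb_of_lt h, binomProb_of_lt (by omega : m + 1 < k + 1),
      binomProb_of_lt (by omega : m < k + 1)]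
    ring
  · rw [binomProb_of_lt (by omega : m < m + 1)]
    simp [binomProb, pow_succ, mul_comm]
  · obtain ⟨d, rfl⟩ : ∃ d, m = k + 1 + d := ⟨m - (k + 1), by omega⟩
    rw [binomProb, binomProb, binomProb, Nat.choose_succ_succ,
      show k + 1 + d + 1 - (k + 1) = d + 1 by omega, show k + 1 + d - (k + 1) = d by omega,
      show k + 1 + d - k = d + 1 by omega]
    push_cast
    ring

lemma binomProb_nonneg (m k : ℕ) {η : ℝ} (h0 : 0 ≤ η) (h1 : η ≤ 1) : 0 ≤ binomProb m k η :=
  mul_nonneg (mul_nonneg (Nat.cast_nonneg _) (pow_nonneg h0 _)) (pow_nonneg (sub_nonneg.2 h1) _)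

/-! ### The scalar recursion: exact solution and product bounds. -/

section Recursion

variable {N T : ℕ} {η : ℝ} (h0 : 0 ≤ η) (h1 : η ≤ 1) {u : ℕ → ℕ → ℝ}
  (hu0 : ∀ j < N, u (j + 1) 0 ≤ 0)
  (hu : ∀ j < N, ∀ t < T, u (j + 1) (t + 1) ≤ (1 - η) * u (j + 1) t + η * u j t)

include h0 h1 hu0 hu

/-- `η * binomProb m j η` is the probability that the `(j + 1)`-st success in independent trials
occurs at trial `m + 1`. The bound is thus an expectation of `w` at the time left after crossing `j
+ 1` links. The right side solves the recursion with equality (`hsum`, `hsum0`) and is zero at time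
0. -/
lemma recursion_le_sum {w : ℕ → ℝ} (hw : ∀ t ≤ T, u 0 t ≤ w t) (j : ℕ) (hj : j < N) (t : ℕ)
    (ht : t ≤ T) :
    u (j + 1) t ≤ η * ∑ m ∈ Finset.range t, binomProb m j η * w (t - 1 - m) := by
  have hsum : ∀ j t, ∑ m ∈ Finset.range (t + 1), binomProb m (j + 1) η * w (t - m) =
      (1 - η) * ∑ m ∈ Finset.range t, binomProb m (j + 1) η * w (t - 1 - m) +
        η * ∑ m ∈ Finset.range t, binomProb m j η * w (t - 1 - m) := by
    intro j t
    rw [Finset.sum_range_succ', binomProb_zero_succ, zero_mul, add_zero, Finset.mul_sum,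
      Finset.mul_sum, ← Finset.sum_add_distrib]
    refine Finset.sum_congr rfl fun m _ => ?_
    rw [binomProb_succ_succ, show t - (m + 1) = t - 1 - m by omega]
    ring
  have hsum0 : ∀ t, ∑ m ∈ Finset.range (t + 1), binomProb m 0 η * w (t - m) =
      (1 - η) * ∑ m ∈ Finset.range t, binomProb m 0 η * w (t - 1 - m) + w t := by
    intro t
    rw [Finset.sum_range_succ', Finset.mul_sum]
    congr 1
    · refine Finset.sum_congr rfl fun m _ => ?_
      rw [binomProb_succ_zero, show t - (m + 1) = t - 1 - m by omega]
      ring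
    · simp [binomProb]
  have hq : 0 ≤ 1 - η := by linarith
  induction j generalizing t with
  | zero =>
    induction t with
    | zero => simpa using hu0 0 hj
    | succ t ih =>
      have h2 := mul_le_mul_of_nonneg_left (ih (by omega)) hq
      have h3 := mul_le_mul_of_nonneg_left (hw t (by omega)) h0
      refine (hu 0 hj t ht).trans ?_
      rw [Nat.add_sub_cancel, hsum0]
      linarith
  | succ j ihj =>
    induction t with
    | zero => simpa using hu0 (j + 1) hj
    | succ t ih =>
      have h2 := mul_le_mul_of_nonneg_left (ih (by omega)) hq
      have h3 := mul_le_mul_of_nonneg_left (ihj (by omega) t (by omega)) h0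
      refine (hu (j + 1) hj t ht).trans ?_
      rw [Nat.add_sub_cancel, hsum]
      linarith

/-- One link whose input is at most `W` and carries nothing before time `t₀`. The truncated
difference `t - t₀` makes the bound zero until then. -/
lemma recursion_step {j t₀ t₁ : ℕ} (hj : j < N) (ht₁ : t₁ ≤ T) {W : ℝ}
    (hW0 : ∀ t < t₀, t < t₁ → u j t ≤ 0) (hW : ∀ t < t₁, u j t ≤ W) (t : ℕ) (ht : t ≤ t₁) :
    u (j + 1) t ≤ (1 - (1 - η) ^ (t - t₀)) * W := by
  have hq : 0 ≤ 1 - η := by linarith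
  induction t with
  | zero => simpa using hu0 j hj
  | succ t ih =>
    have h2 := mul_le_mul_of_nonneg_left (ih (by omega)) hq
    have h4 := hu j hj t (by omega)
    rcases lt_or_ge t t₀ with h | h
    · have h3 := mul_le_mul_of_nonneg_left (hW0 t h (by omega)) h0
      rw [show t - t₀ = 0 by omega] at h2
      rw [show t + 1 - t₀ = 0 by omega]
      simp only [pow_zero, sub_self, zero_mul, mul_zero] at h2 h3 ⊢
      linarith
    · have h3 := mul_le_mul_of_nonneg_left (hW t (by omega)) h0
      rw [show t + 1 - t₀ = t - t₀ + 1 by omega, pow_succ]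
      nlinarith

/-- Each link starts one step later than its predecessor, and the predecessor is bounded by its
value at the last time that matters, `t - 1`. Both shifts agree, so all `j` factors have the same
exponent. -/
lemma recursion_le_prod_const {M : ℝ} (hM : 0 ≤ M) (hw : ∀ t ≤ T, u 0 t ≤ M) (j : ℕ) (hj : j ≤ N)
    (t : ℕ) (ht : t ≤ T) : u j t ≤ M * (1 - (1 - η) ^ (t + 1 - j)) ^ j := by
  have hq : 0 ≤ 1 - η := by linarith
  have hq1 : 1 - η ≤ 1 := by linarith
  have hb : ∀ s, 0 ≤ 1 - (1 - η) ^ s := fun s => sub_nonneg.2 (pow_le_one₀ hq hq1)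
  induction j generalizing t with
  | zero => simpa using hw t ht
  | succ j ih =>
    have := recursion_step h0 h1 hu0 hu (j := j) (t₀ := j) (t₁ := t) (by omega) ht
      (W := M * (1 - (1 - η) ^ (t - j)) ^ j) ?_ ?_ t le_rfl
    · rw [show t + 1 - (j + 1) = t - j by omega, pow_succ]
      linarith
    · intro t' ht' ht''
      refine (ih (by omega) t' (by omega)).trans (le_of_eq ?_)
      rw [show t' + 1 - j = 0 by omega, pow_zero, sub_self, zero_pow (by omega), mul_zero]
    · intro t' ht'
      refine (ih (by omega) t' (by omega)).trans (mul_le_mul_of_nonneg_left ?_ hM)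
      refine pow_le_pow_left₀ (hb _) (sub_le_sub_left ?_ _) _
      exact pow_le_pow_of_le_one hq hq1 (by omega)

lemma recursion_le_prod_linear {C : ℝ} (hC : 0 ≤ C) (hw : ∀ t ≤ T, u 0 t ≤ C * t) (j : ℕ)
    (hj : j ≤ N) (t : ℕ) (ht : t ≤ T) :
    u j t ≤ C * ((t - j : ℕ) * (1 - (1 - η) ^ (t - j)) ^ j) := by
  have hq : 0 ≤ 1 - η := by linarith
  have hq1 : 1 - η ≤ 1 := by linarith
  have hb : ∀ s, 0 ≤ 1 - (1 - η) ^ s := fun s => sub_nonneg.2 (pow_le_one₀ hq hq1)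
  induction j generalizing t with
  | zero => simpa using hw t ht
  | succ j ih =>
    -- The onset is one later than for constant input, because linear input already vanishes at time
    -- 0.
    have := recursion_step h0 h1 hu0 hu (j := j) (t₀ := j + 1) (t₁ := t) (by omega) ht
      (W := C * ((t - (j + 1) : ℕ) * (1 - (1 - η) ^ (t - (j + 1))) ^ j)) ?_ ?_ t le_rfl
    · rw [pow_succ]
      linarith
    · intro t' ht' ht''
      refine (ih (by omega) t' (by omega)).trans (le_of_eq ?_)
      rw [show t' - j = 0 by omega, Nat.cast_zero, zero_mul, mul_zero]
    · intro t' ht'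
      refine (ih (by omega) t' (by omega)).trans (mul_le_mul_of_nonneg_left ?_ hC)
      refine mul_le_mul ?_ (pow_le_pow_left₀ (hb _) (sub_le_sub_left ?_ _) _)
        (pow_nonneg (hb _) _) (Nat.cast_nonneg _)
      · exact_mod_cast (by omega : t' - j ≤ t - (j + 1))
      · exact pow_le_pow_of_le_one hq hq1 (by omega)

end Recursion

lemma sum_range_binomProb {j T : ℕ} (η : ℝ) (w : ℕ → ℝ) :
    ∑ m ∈ Finset.range T, binomProb m j η * w (T - 1 - m) =
      ∑ i ∈ Finset.Icc 1 (T - j), binomProb (T - i) j η * w (i - 1) := by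
  rw [← Finset.sum_subset (s₁ := Finset.Ico j T)]
  · refine Finset.sum_nbij' (fun m => T - m) (fun i => T - i) ?_ ?_ ?_ ?_ ?_
    · intro m hm; simp only [Finset.mem_Ico, Finset.mem_Icc] at *; omega
    · intro m hm; simp only [Finset.mem_Ico, Finset.mem_Icc] at *; omega
    · intro m hm; simp only [Finset.mem_Ico] at *; omega
    · intro m hm; simp only [Finset.mem_Icc] at *; omega
    · intro m hm
      simp only [Finset.mem_Ico] at hm
      rw [show T - (T - m) = m by omega, show T - m - 1 = T - 1 - m by omega]
  · intro m hm
    simp only [Finset.mem_Ico, Finset.mem_range] at *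
    omega
  · intro m hm hm'
    simp only [Finset.mem_Ico, Finset.mem_range] at hm hm'
    rw [binomProb_of_lt (by omega), zero_mul]

lemma sum_range_binomProb_linear {j T : ℕ} (η : ℝ) :
    ∑ m ∈ Finset.range T, binomProb m j η * ((T - 1 - m : ℕ) : ℝ) =
      ∑ i ∈ Finset.Icc 1 (T - 1 - j), binomProb (T - i - 1) j η * i := by
  rw [sum_range_binomProb η fun t => (t : ℝ)]
  rcases Nat.lt_or_ge j T with h | h
  swap
  · rw [show T - j = 0 by omega, show T - 1 - j = 0 by omega]
    simp
  rw [show Finset.Icc 1 (T - j) = Finset.Ico 1 (T - j + 1) by rfl,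
    Finset.sum_Ico_eq_sum_range, show T - j + 1 - 1 = T - 1 - j + 1 by omega,
    Finset.sum_range_succ', show Finset.Icc 1 (T - 1 - j) = Finset.Ico 1 (T - 1 - j + 1) by rfl,
    Finset.sum_Ico_eq_sum_range]
  simp only [add_zero, Nat.sub_self, Nat.cast_zero, mul_zero, Nat.add_sub_cancel]
  refine Finset.sum_congr rfl fun i _ => ?_
  rw [show 1 + (i + 1) - 1 = 1 + i by omega, show T - (1 + (i + 1)) = T - (1 + i) - 1 by omega]

/-! ### Bounds on the information that reaches the last node. -/

section ChainBounds

variable {n : ℕ} {X Y : Edge (chainAdj n) → Type*} {T : ℕ}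
  [∀ e, Fintype (X e)] [∀ e, Fintype (Y e)] (K : ∀ e, X e → PMF (Y e))
  (m : EncTable X Y T → ℝ)

/-- The information (in nats) between the encoding maps and the outputs that are received by the
nodes `i, i + 1, …` in `t ≤ T` steps; for `i = 0` the entropy of the encoding maps. -/
def blockInfo (i t : ℕ) : ℝ :=
  if i = 0 then ∑ φ, Real.negMulLog (m φ)
  else if ht : t ≤ T then ∑ φ, Real.negMulLog (m φ) - blockEnt K m i ht else 0

variable {m} {c : EncTable X Y T} {η C : ℝ} (hm : ∀ φ, 0 ≤ m φ) (hm1 : ∑ φ, m φ = 1)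
  (hc : ∀ φ, m φ ≠ 0 → ∀ v : Fin n, (v : ℕ) ≠ 0 → φ v = c v)

include hm1 in
lemma blockInfo_succ_zero (i : ℕ) : blockInfo K m (i + 1) 0 = 0 := by
  rw [blockInfo, if_neg (Nat.succ_ne_zero i), dif_pos (Nat.zero_le T), blockEnt_zero K hm1,
    sub_self]

include hm hc in
lemma blockInfo_step (h0 : 0 ≤ η) (hK : ∀ e, HasSDPI (fun x y => (K e x y).toReal) η) {i : ℕ}
    (hi : i + 1 < n) {t : ℕ} (ht : t < T) :
    blockInfo K m (i + 1) (t + 1) ≤ (1 - η) * blockInfo K m (i + 1) t + η * blockInfo K m i t := by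
  have h2 := blockEnt_sub_le K hm hc hi ht (hK _)
  have h3 : ∑ φ, Real.negMulLog (m φ) - condEnt (inputLaw K m hi ht) ≤ blockInfo K m i t := by
    rw [blockInfo]
    split_ifs with hi0 ht'
    -- At the first link the information in the symbol is bounded by the full entropy of `φ`.
    · linarith [condEnt_nonneg (pushLaw_nonneg (jointLaw_nonneg K hm ht.le)
        fun φ y => (Hist.block (i + 1) y, φ.msg ht y (fwdEdge hi))),
        show condEnt (inputLaw K m hi ht) = condEnt (pushLaw (jointLaw K m ht.le)
          fun φ y => (Hist.block (i + 1) y, φ.msg ht y (fwdEdge hi))) from rfl]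
    · linarith [blockEnt_le_inputLaw K hm hc hi0 hi ht]
    · omega
  have h4 := mul_le_mul_of_nonneg_left h3 h0
  simp only [blockInfo, Nat.succ_ne_zero, if_false, dif_pos ht.le, dif_pos (Nat.succ_le_of_lt ht)]
    at h4 ⊢
  linarith

include hm hm1 hc in
lemma blockInfo_one_le (hn : 1 < n)
    (hC : HasCapacityBound (fun x y => (K (fwdEdge (i := 0) hn) x y).toReal) C) {t : ℕ}
    (ht : t ≤ T) : blockInfo K m 1 t ≤ C * t := by
  induction t with
  | zero => rw [blockInfo_succ_zero K hm1 0, Nat.cast_zero, mul_zero]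
  | succ t ih =>
    have h2 := blockEnt_sub_le_capacity K hm hm1 hc (i := 0) hn (t := t) ht hC
    have h3 := ih (by omega)
    rw [blockInfo, if_neg one_ne_zero, dif_pos (by omega)] at h3 ⊢
    push_cast
    linarith

include hm hm1 in
lemma entropy_nonneg_of_sum_eq_one : 0 ≤ ∑ φ, Real.negMulLog (m φ) :=
  Finset.sum_nonneg fun φ _ => Real.negMulLog_nonneg (hm φ) (by
    rw [← hm1]; exact Finset.single_le_sum (fun φ _ => hm φ) (Finset.mem_univ φ))

variable (hn : 2 ≤ n) (h0 : 0 ≤ η) (h1 : η ≤ 1)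
  (hK : ∀ e, HasSDPI (fun x y => (K e x y).toReal) η) (hC0 : 0 ≤ C)
  (hC : HasCapacityBound (fun x y => (K (fwdEdge (i := 0) hn) x y).toReal) C)

include hm hm1 hc hn h0 h1 hK in
lemma blockInfo_last_le_entropy_sum :
    blockInfo K m (n - 1) T ≤ (∑ φ, Real.negMulLog (m φ)) *
      (η * ∑ i ∈ Finset.Icc 1 (T + 2 - n), binomProb (T - i) (n - 2) η) := by
  have := recursion_le_sum (N := n - 1) (T := T) (u := blockInfo K m) h0 h1
    (fun j _ => (blockInfo_succ_zero K hm1 j).le)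
    (fun j hj t ht => blockInfo_step K hm hc h0 hK (by omega) ht)
    (w := fun _ => ∑ φ, Real.negMulLog (m φ))
    (fun t _ => by rw [blockInfo, if_pos rfl]) (n - 2) (by omega) T le_rfl
  rw [sum_range_binomProb η fun _ => ∑ φ, Real.negMulLog (m φ), ← Finset.sum_mul,
    show n - 2 + 1 = n - 1 by omega, show T - (n - 2) = T + 2 - n by omega] at this
  linarith

include hm hm1 hc hn h0 h1 hK in
lemma blockInfo_last_le_entropy_prod :
    blockInfo K m (n - 1) T ≤ (∑ φ, Real.negMulLog (m φ)) *
      (1 - (1 - η) ^ (T + 2 - n)) ^ (n - 1) := by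
  have := recursion_le_prod_const (N := n - 1) (T := T) (u := blockInfo K m) h0 h1
    (fun j _ => (blockInfo_succ_zero K hm1 j).le)
    (fun j hj t ht => blockInfo_step K hm hc h0 hK (by omega) ht)
    (entropy_nonneg_of_sum_eq_one hm hm1)
    (fun t _ => by rw [blockInfo, if_pos rfl]) (n - 1) (by omega) T le_rfl
  rwa [show T + 1 - (n - 1) = T + 2 - n by omega] at this

include hm hm1 hc h0 h1 hK hC in
lemma blockInfo_last_le_capacity_sum (hn3 : 3 ≤ n) :
    blockInfo K m (n - 1) T ≤ C *
      (η * ∑ i ∈ Finset.Icc 1 (T + 2 - n), binomProb (T - i - 1) (n - 3) η * i) := by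
  -- The capacity accounts for the first link, so the recursion starts at node 1 and has `n - 2`
  -- links left.
  have := recursion_le_sum (N := n - 2) (T := T) (u := fun j => blockInfo K m (j + 1)) h0 h1
    (fun j _ => (blockInfo_succ_zero K hm1 _).le)
    (fun j hj t ht => blockInfo_step K hm hc h0 hK (by omega) ht)
    (w := fun t => C * t)
    (fun t ht => blockInfo_one_le K hm hm1 hc hn hC ht) (n - 3) (by omega) T le_rfl
  have h2 : ∀ m, binomProb m (n - 3) η * (C * ((T - 1 - m : ℕ) : ℝ)) =
      C * (binomProb m (n - 3) η * ((T - 1 - m : ℕ) : ℝ)) := fun m => by ring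
  simp only [h2, ← Finset.mul_sum] at this
  rw [sum_range_binomProb_linear, show n - 3 + 1 + 1 = n - 1 by omega,
    show T - 1 - (n - 3) = T + 2 - n by omega] at this
  linarith

include hm hm1 hc h0 h1 hK hC hC0 in
lemma blockInfo_last_le_capacity_prod :
    blockInfo K m (n - 1) T ≤ C *
      ((T + 2 - n : ℕ) * (1 - (1 - η) ^ (T + 2 - n)) ^ (n - 2)) := by
  have := recursion_le_prod_linear (N := n - 2) (T := T) (u := fun j => blockInfo K m (j + 1)) h0 h1
    (fun j _ => (blockInfo_succ_zero K hm1 _).le)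
    (fun j hj t ht => blockInfo_step K hm hc h0 hK (by omega) ht) hC0
    (fun t ht => blockInfo_one_le K hm hm1 hc hn hC ht) (n - 2) le_rfl T le_rfl
  rwa [show n - 2 + 1 = n - 1 by omega, show T - (n - 2) = T + 2 - n by omega] at this

end ChainBounds

end

noncomputable section

/-! ### Information and the probability of success -/

/-- Concavity of the logarithm. It is needed because `φ` does not determine the observations, so
given `φ` and `b` success has a probability `s` strictly between 0 and 1 in general. -/
lemma mul_log_one_add_le {s x : ℝ} (hs0 : 0 ≤ s) (hs1 : s ≤ 1) (hx : 0 < x) :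
    s * Real.log (1 + x) ≤ Real.log (1 + x * s) := by
  have := strictConcaveOn_log_Ioi.concaveOn.2 (x := 1 + x) (y := 1)
    (by simp only [Set.mem_Ioi]; linarith) (by simp) hs0 (sub_nonneg.2 hs1) (by ring)
  simp only [smul_eq_mul, Real.log_one, mul_zero, add_zero] at this
  rwa [show s * (1 + x) + (1 - s) * 1 = 1 + x * s by ring] at this

/-! ### A Donsker–Varadhan bound on a finite alphabet. -/

section Discrete

variable {Φ B : Type*} [Fintype Φ] [Fintype B] {m : Φ → ℝ} {q E : Φ → B → ℝ}

/-- A lower bound of Donsker–Varadhan type for the mutual information of a channel `q` with input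
law `m`. The number `E φ b` is the probability that the input is `φ` and that `b` is a success. -/
lemma le_sum_klTerm (hm : ∀ φ, 0 ≤ m φ) (hm1 : ∑ φ, m φ = 1) (hq : ∀ φ b, 0 ≤ q φ b)
    (hq1 : ∀ φ, ∑ b, q φ b = 1) (hE0 : ∀ φ b, 0 ≤ E φ b) (hE1 : ∀ φ b, E φ b ≤ m φ)
    {x x₀ : ℝ} (hx : 0 < x) (hx₀ : 0 < x₀) :
    Real.log (1 + x) * ∑ φ, ∑ b, q φ b * E φ b - (Real.log x₀ +
      (1 + x * ∑ b, (∑ φ, m φ * q φ b) * ∑ φ, E φ b) / x₀ - 1) ≤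
      ∑ φ, ∑ b, klTerm (m φ * q φ b) (m φ * ∑ φ', m φ' * q φ' b) := by
  set Q : B → ℝ := fun b => ∑ φ, m φ * q φ b with hQ
  have hQ0 : ∀ b, 0 ≤ Q b := fun b => Finset.sum_nonneg fun φ _ => mul_nonneg (hm φ) (hq φ b)
  have hQ1 : ∑ b, Q b = 1 := by
    rw [hQ, Finset.sum_comm]
    simp only [← Finset.mul_sum, hq1, mul_one, hm1]
  have key : ∀ φ b, Real.log (1 + x) * (q φ b * E φ b) - m φ * q φ b * Real.log x₀ + m φ * q φ b -
      (m φ * Q b + x * (Q b * E φ b)) / x₀ ≤ klTerm (m φ * q φ b) (m φ * Q b) := by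
    intro φ b
    rcases (hm φ).eq_or_lt with h | h
    · have hE : E φ b = 0 := le_antisymm ((hE1 φ b).trans h.symm.le) (hE0 φ b)
      simp [← h, hE, klTerm]
    have hs0 : 0 ≤ E φ b / m φ := div_nonneg (hE0 φ b) h.le
    have hs1 : E φ b / m φ ≤ 1 := div_le_one_of_le₀ (hE1 φ b) h.le
    have hpos : 0 < 1 + x * (E φ b / m φ) := by positivity
    -- The test function rewards success with weight `x`. The free `x₀` replaces the logarithm of
    -- its mean under the product law by a tangent, which keeps the bound affine in the blind
    -- success probability.
    have h1 := klTerm_ge (u := m φ * q φ b) (v := m φ * Q b) (U := 1 + x * (E φ b / m φ))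
      (mul_nonneg (hm φ) (hq φ b)) (mul_nonneg (hm φ) (hQ0 b)) (fun h0 => ?_) hpos hx₀
    · refine le_trans ?_ h1
      rw [Real.log_div hpos.ne' hx₀.ne']
      have h2 := mul_le_mul_of_nonneg_left (mul_log_one_add_le hs0 hs1 hx)
        (mul_nonneg (hm φ) (hq φ b))
      have h3 : m φ * q φ b * (E φ b / m φ * Real.log (1 + x)) =
          Real.log (1 + x) * (q φ b * E φ b) := by field_simp
      have h4 : m φ * Q b * ((1 + x * (E φ b / m φ)) / x₀) =
          (m φ * Q b + x * (Q b * E φ b)) / x₀ := by field_simp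
      rw [h3] at h2
      rw [h4]
      linarith
    · have := (mul_eq_zero.1 h0).resolve_left h.ne'
      exact (Finset.sum_eq_zero_iff_of_nonneg fun φ _ => mul_nonneg (hm φ) (hq φ b)).1 this φ
        (Finset.mem_univ φ)
  refine le_trans (le_of_eq ?_)
    (Finset.sum_le_sum fun φ _ => Finset.sum_le_sum fun b _ => key φ b)
  simp only [Finset.sum_sub_distrib, Finset.sum_add_distrib, ← Finset.mul_sum, ← Finset.sum_mul,
    ← Finset.sum_div, hq1, hm1, hQ1, mul_one]
  rw [Finset.sum_comm (f := fun φ b => Q b * E φ b)]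
  simp only [← Finset.mul_sum]
  ring

lemma sum_negMulLog_sub_condEnt {p : Φ → B → ℝ} (hp : ∀ φ b, 0 ≤ p φ b)
    (hp1 : ∀ φ, ∑ b, p φ b = m φ) :
    ∑ φ, Real.negMulLog (m φ) - condEnt p =
      ∑ φ, ∑ b, klTerm (p φ b) (m φ * ∑ φ', p φ' b) := by
  have h : ∀ φ b, klTerm (p φ b) (m φ * ∑ φ', p φ' b) =
      klTerm (p φ b) (∑ φ', p φ' b) - p φ b * Real.log (m φ) := by
    intro φ b
    by_cases h0 : p φ b = 0
    · simp [h0, klTerm]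
    have h1 : m φ ≠ 0 := fun h => h0 ((Finset.sum_eq_zero_iff_of_nonneg fun b _ => hp φ b).1
      ((hp1 φ).trans h) b (Finset.mem_univ b))
    have h2 : ∑ φ', p φ' b ≠ 0 := fun h => h0
      ((Finset.sum_eq_zero_iff_of_nonneg fun φ _ => hp φ b).1 h φ (Finset.mem_univ φ))
    rw [klTerm, klTerm, Real.log_div h0 (mul_ne_zero h1 h2), Real.log_div h0 h2,
      Real.log_mul h1 h2]
    ring
  simp only [h, Finset.sum_sub_distrib, ← Finset.sum_mul, hp1, condEnt, Real.negMulLog]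
  rw [Finset.sum_comm (γ := B)]
  simp only [neg_mul, Finset.sum_neg_distrib]
  ring

end Discrete

/-! ### Success and error probabilities in terms of encoding tables. -/

section Measure

variable {n : ℕ} {W : Fin n → Type*} {Z : Type*} [∀ v, MeasurableSpace (W v)]
  [MeasurableSpace Z] {X Y : Edge (chainAdj n) → Type*}
  {T : ℕ} (A : Algorithm (chainAdj n) W X Y Z T)

/-- The encoding maps that are used if the observations are `w`. -/
def Algorithm.table (w : ∀ v, W v) : EncTable X Y T := fun v t => A.enc v t (w v)

/-- The law of the encoding maps if `μ` is the law of the observations. -/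
def Algorithm.tableLaw (μ : Measure (∀ v, W v)) (φ : EncTable X Y T) : ℝ :=
  μ.real {w | A.table w = φ}

variable [∀ e, Fintype (X e)] [∀ e, Fintype (Y e)] (K : ∀ e, X e → PMF (Y e))

lemma Algorithm.measurableSet_table (φ : EncTable X Y T) : MeasurableSet {w | A.table w = φ} := by
  have : {w | A.table w = φ} = ⋂ v, ⋂ t, ⋂ past, (fun w : ∀ v, W v => w v) ⁻¹'
      {w | A.enc v t w past = φ v t past} := by
    ext w
    simp only [Set.mem_ofPred_eq, Set.mem_iInter, Set.mem_preimage]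
    constructor
    · rintro rfl v t past
      rfl
    · intro h
      funext v t past
      exact h v t past
  rw [this]
  exact MeasurableSet.iInter fun v => MeasurableSet.iInter fun t => MeasurableSet.iInter fun past =>
    measurable_pi_apply v (A.measurableSet_enc v t past _)

lemma Algorithm.tableLaw_nonneg (μ : Measure (∀ v, W v)) (φ : EncTable X Y T) :
    0 ≤ A.tableLaw μ φ := measureReal_nonneg

lemma sum_measureReal_inter_table (μ : Measure (∀ v, W v)) [IsFiniteMeasure μ]
    {s : Set (∀ v, W v)} (hs : MeasurableSet s) :
    ∑ φ, μ.real (s ∩ {w | A.table w = φ}) = μ.real s := by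
  rw [← measureReal_iUnion_fintype]
  · congr 1
    ext w
    exact ⟨fun h => (Set.mem_iUnion.1 h).elim fun _ h => h.1,
      fun h => Set.mem_iUnion.2 ⟨_, h, rfl⟩⟩
  · intro φ φ' h
    refine Set.disjoint_left.2 fun w hw hw' => h ?_
    exact hw.2.symm.trans hw'.2
  · exact fun φ => hs.inter (A.measurableSet_table φ)

lemma Algorithm.sum_tableLaw (μ : Measure (∀ v, W v)) [IsProbabilityMeasure μ] :
    ∑ φ, A.tableLaw μ φ = 1 := by
  have := sum_measureReal_inter_table A μ MeasurableSet.univ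
  simp only [Set.univ_inter, probReal_univ] at this
  exact this

lemma Algorithm.outputProb_eq (w : ∀ v, W v) (y : Hist Y T) :
    A.outputProb K w y = ENNReal.ofReal ((A.table w).histProb K le_rfl y) := by
  rw [EncTable.histProb, ENNReal.ofReal_prod_of_nonneg
    fun s _ => Finset.prod_nonneg fun e _ => ENNReal.toReal_nonneg, Algorithm.outputProb]
  refine Finset.prod_congr rfl fun s _ => ?_
  rw [ENNReal.ofReal_prod_of_nonneg fun e _ => ENNReal.toReal_nonneg]
  refine Finset.prod_congr rfl fun e _ => ?_
  rw [ENNReal.ofReal_toReal (PMF.apply_ne_top _ _)]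
  rfl

variable (P : Problem W Z) (ε : ℝ≥0) (v : Fin n)

/-- The observations for which node `v` succeeds if it receives `b`. -/
def Algorithm.successSet (b : BlockHist Y v T) : Set (∀ v, W v) :=
  {w | P.d (P.f w) (A.est v (w v) fun t e => b t ⟨e.1, by rw [e.2]⟩) ≤ ε}

lemma Algorithm.measurableSet_successSet (b : BlockHist Y v T) :
    MeasurableSet (A.successSet P ε v b) := by
  refine measurableSet_le ?_ measurable_const
  exact P.measurable_d.comp (P.measurable_f.prodMk
    ((A.measurable_est v _).comp (measurable_pi_apply v)))

/-- The conditional law of the outputs that are received by the nodes `v, v + 1, …`, given the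
encoding maps. -/
def EncTable.blockProb (φ : EncTable X Y T) (i : ℕ) (b : BlockHist Y i T) : ℝ :=
  pushLaw (fun (φ : EncTable X Y T) y => φ.histProb K le_rfl y) (fun _ => Hist.block i) φ b

lemma EncTable.blockProb_nonneg (φ : EncTable X Y T) (i : ℕ) (b : BlockHist Y i T) :
    0 ≤ φ.blockProb K i b :=
  pushLaw_nonneg (fun φ y => EncTable.histProb_nonneg K φ le_rfl y) _ φ b

lemma EncTable.sum_blockProb (φ : EncTable X Y T) (i : ℕ) : ∑ b, φ.blockProb K i b = 1 := by
  unfold EncTable.blockProb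
  rw [sum_pushLaw, EncTable.sum_histProb]

lemma blockInfo_eq_sum_klTerm {m : EncTable X Y T → ℝ} (hm : ∀ φ, 0 ≤ m φ) {i : ℕ} (hi : i ≠ 0) :
    blockInfo K m i T = ∑ φ : EncTable X Y T, ∑ b : BlockHist Y i T,
      klTerm (m φ * φ.blockProb K i b)
        (m φ * ∑ φ' : EncTable X Y T, m φ' * φ'.blockProb K i b) := by
  have h : ∀ φ b, pushLaw (jointLaw K m (le_refl T)) (fun _ => Hist.block i) φ b =
      m φ * φ.blockProb K i b := by
    intro φ b
    simp only [pushLaw, jointLaw, EncTable.blockProb, Finset.mul_sum, mul_ite, mul_zero]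
  rw [blockInfo, if_neg hi, dif_pos le_rfl, blockEnt, sum_negMulLog_sub_condEnt
    (pushLaw_nonneg (jointLaw_nonneg K hm le_rfl) _)]
  · simp only [h]
  · intro φ
    rw [sum_pushLaw, sum_jointLaw]

/-- The probability that node `v` succeeds. -/
def Algorithm.successProb (μ : Measure (∀ v, W v)) : ℝ :=
  ∑ φ : EncTable X Y T, ∑ b, φ.blockProb K v b *
    μ.real (A.successSet P ε v b ∩ {w | A.table w = φ})

/-- The probability that node `v` would succeed if what it receives was independent of the
observations. -/
def Algorithm.blindProb (μ : Measure (∀ v, W v)) : ℝ :=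
  ∑ b, (∑ φ : EncTable X Y T, A.tableLaw μ φ * φ.blockProb K v b) * μ.real (A.successSet P ε v b)

lemma Algorithm.le_blockInfo (μ : Measure (∀ v, W v)) [IsProbabilityMeasure μ] (hv : (v : ℕ) ≠ 0)
    {x x₀ : ℝ} (hx : 0 < x) (hx₀ : 0 < x₀) :
    Real.log (1 + x) * A.successProb K P ε v μ -
      (Real.log x₀ + (1 + x * A.blindProb K P ε v μ) / x₀ - 1) ≤
      blockInfo K (A.tableLaw μ) v T := by
  rw [blockInfo_eq_sum_klTerm K (A.tableLaw_nonneg μ) hv]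
  have := le_sum_klTerm (m := A.tableLaw μ) (q := fun φ b => φ.blockProb K v b)
    (E := fun φ b => μ.real (A.successSet P ε v b ∩ {w | A.table w = φ}))
    (A.tableLaw_nonneg μ) (A.sum_tableLaw μ) (fun φ b => φ.blockProb_nonneg K v b)
    (fun φ => φ.sum_blockProb K v) (fun φ b => measureReal_nonneg)
    (fun φ b => measureReal_mono Set.inter_subset_right) hx hx₀
  simp only [fun b => sum_measureReal_inter_table A μ (A.measurableSet_successSet P ε v b)] at this
  exact this

/-- Splitting the observations according to their table makes the integrand a finite sum of
constants on measurable sets. Unused outputs are then summed out. -/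
lemma Algorithm.errorProb_eq :
    A.errorProb K P ε v = ENNReal.ofReal (∑ φ : EncTable X Y T, ∑ b, φ.blockProb K v b *
      P.law.real ((A.successSet P ε v b)ᶜ ∩ {w | A.table w = φ})) := by
  classical
  have h1 : ∀ w y, (if ε < P.d (P.f w) (A.estimate v w y) then A.outputProb K w y else 0) =
      ∑ φ : EncTable X Y T, ((A.successSet P ε v (Hist.block v y))ᶜ ∩
        {w | A.table w = φ}).indicator (fun _ => ENNReal.ofReal (φ.histProb K le_rfl y)) w := by
    intro w y
    rw [Finset.sum_eq_single (A.table w)]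
    · have h2 : w ∈ (A.successSet P ε v (Hist.block v y))ᶜ ∩ {w' | A.table w' = A.table w} ↔
          ε < P.d (P.f w) (A.estimate v w y) := by
        simp only [Set.mem_inter_iff, Set.mem_ofPred_eq, and_true, Set.mem_compl_iff,
          Algorithm.successSet, not_le]
        rfl
      rw [Set.indicator_apply, ← A.outputProb_eq]
      simp only [h2]
    · intro φ _ hφ
      exact Set.indicator_of_notMem (fun h => hφ h.2.symm) _
    · exact fun h => (h (Finset.mem_univ _)).elim
  have hms : ∀ (φ : EncTable X Y T) (y : Hist Y T), MeasurableSet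
      ((A.successSet P ε v (Hist.block v y))ᶜ ∩ {w | A.table w = φ}) := fun φ y =>
    (A.measurableSet_successSet P ε v _).compl.inter (A.measurableSet_table φ)
  rw [Algorithm.errorProb]
  simp only [h1]
  rw [lintegral_finsetSum _ fun y _ => Finset.measurable_sum _ fun φ _ =>
    measurable_const.indicator (hms φ y)]
  simp only [lintegral_finsetSum _ fun (φ : EncTable X Y T) _ =>
    measurable_const.indicator (hms φ _), lintegral_indicator_const (hms _ _)]
  unfold EncTable.blockProb
  simp only [sum_pushLaw_mul]
  rw [ENNReal.ofReal_sum_of_nonneg fun φ _ => Finset.sum_nonneg fun y _ =>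
    mul_nonneg (EncTable.histProb_nonneg K φ le_rfl y) measureReal_nonneg, Finset.sum_comm]
  refine Finset.sum_congr rfl fun φ _ => ?_
  rw [ENNReal.ofReal_sum_of_nonneg fun y _ =>
    mul_nonneg (EncTable.histProb_nonneg K φ le_rfl y) measureReal_nonneg]
  refine Finset.sum_congr rfl fun y _ => ?_
  rw [ENNReal.ofReal_mul (EncTable.histProb_nonneg K φ le_rfl y), ofReal_measureReal]

lemma Algorithm.le_successProb {δ : ℝ} (hδ : 0 ≤ δ)
    (h : A.errorProb K P ε v ≤ ENNReal.ofReal δ) : 1 - δ ≤ A.successProb K P ε v P.law := by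
  rw [A.errorProb_eq, ENNReal.ofReal_le_ofReal_iff hδ] at h
  have h1 : ∀ (φ : EncTable X Y T) b, P.law.real (A.successSet P ε v b ∩ {w | A.table w = φ}) =
      A.tableLaw P.law φ - P.law.real ((A.successSet P ε v b)ᶜ ∩ {w | A.table w = φ}) := by
    intro φ b
    have := measureReal_inter_add_sdiff (μ := P.law) (s := {w | A.table w = φ})
      (A.measurableSet_successSet P ε v b)
    rw [Set.inter_comm, Set.inter_comm _ᶜ, ← Set.sdiff_eq, Algorithm.tableLaw, ← this]
    ring
  rw [Algorithm.successProb]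
  simp only [h1, mul_sub, Finset.sum_sub_distrib, ← Finset.sum_mul, EncTable.sum_blockProb, one_mul,
    A.sum_tableLaw]
  linarith

end Measure

end

noncomputable section

/-! ### Conditioning on the observations of a set of nodes -/

lemma ofReal_integral_le_lintegral {α : Type*} [MeasurableSpace α] {μ : Measure α} {f : α → ℝ}
    (hf : Integrable f μ) : ENNReal.ofReal (∫ a, f a ∂μ) ≤ ∫⁻ a, ENNReal.ofReal (f a) ∂μ := by
  calc ENNReal.ofReal (∫ a, f a ∂μ) ≤ ENNReal.ofReal (∫ a, max (f a) 0 ∂μ) :=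
        ENNReal.ofReal_le_ofReal (integral_mono hf hf.pos_part fun a => le_max_left _ _)
    _ = ∫⁻ a, ENNReal.ofReal (max (f a) 0) ∂μ :=
        ofReal_integral_eq_lintegral_ofReal hf.pos_part (ae_of_all _ fun a => le_max_right _ _)
    _ = ∫⁻ a, ENNReal.ofReal (f a) ∂μ := by simp [ENNReal.ofReal_max]

/-- Merging atoms decreases entropy: `-log ρ(t) ≤ -log ρ{x}` for every atom `x` of `t`. -/
lemma ofReal_negMulLog_measureReal_le {α : Type*} [MeasurableSpace α] [MeasurableSingletonClass α]
    (ρ : Measure α) [IsProbabilityMeasure ρ] {t : Set α} (ht : t.Countable) :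
    ENNReal.ofReal (Real.negMulLog (ρ.real t)) ≤
      ∑' x : t, ENNReal.ofReal (Real.negMulLog (ρ.real {(x : α)})) := by
  have hsum : ρ t = ∑' x : t, ρ {(x : α)} := by
    rw [← measure_biUnion ht, Set.biUnion_of_singleton]
    · intro x _ y _ hxy
      simpa using hxy
    · exact fun x _ => MeasurableSet.singleton x
  have hterm : ∀ s : Set α, ENNReal.ofReal (Real.negMulLog (ρ.real s)) =
      ρ s * ENNReal.ofReal (-Real.log (ρ.real s)) := by
    intro s
    rw [Real.negMulLog, neg_mul_comm, ENNReal.ofReal_mul measureReal_nonneg, ofReal_measureReal]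
  rw [hterm, hsum, ← ENNReal.tsum_mul_right]
  refine ENNReal.tsum_le_tsum fun x => ?_
  rw [hterm]
  by_cases h0 : ρ {(x : α)} = 0
  · simp [h0]
  · refine mul_le_mul_right (ENNReal.ofReal_le_ofReal (neg_le_neg (Real.log_le_log ?_ ?_))) _
    · exact ENNReal.toReal_pos h0 (measure_ne_top _ _)
    · exact measureReal_mono (by simp)

lemma sum_negMulLog_le_shannonEntropy {α Φ : Type*} [MeasurableSpace α]
    [MeasurableSingletonClass α] [Fintype Φ] (ρ : Measure α) [IsProbabilityMeasure ρ] (ψ : α → Φ) :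
    ENNReal.ofReal (∑ φ, Real.negMulLog (ρ.real (ψ ⁻¹' {φ}))) ≤
      ENNReal.ofReal (Real.log 2) * shannonEntropy ρ := by
  classical
  have hlog : 0 < Real.log 2 := Real.log_pos one_lt_two
  have hlog' : ENNReal.ofReal (Real.log 2) ≠ 0 := by simpa using hlog
  rw [shannonEntropy]
  split_ifs with h
  swap
  · rw [ENNReal.mul_top hlog']
    exact le_top
  obtain ⟨s, hs, hs0⟩ := h
  rw [ENNReal.mul_div_cancel hlog' ENNReal.ofReal_ne_top, ENNReal.ofReal_sum_of_nonneg
    fun φ _ => Real.negMulLog_nonneg measureReal_nonneg measureReal_le_one]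
  set g : α → ℝ≥0∞ := fun x => ENNReal.ofReal (Real.negMulLog (ρ.real {x})) with hg
  have h1 : ∀ φ, ENNReal.ofReal (Real.negMulLog (ρ.real (ψ ⁻¹' {φ}))) ≤
      ∑' x, if ψ x = φ then g x else 0 := by
    intro φ
    have h2 : ρ (ψ ⁻¹' {φ}) = ρ (ψ ⁻¹' {φ} ∩ s) := by
      rw [measure_inter_conull hs0]
    rw [measureReal_def, h2, ← measureReal_def]
    refine (ofReal_negMulLog_measureReal_le ρ (hs.mono Set.inter_subset_right)).trans ?_
    rw [tsum_subtype (ψ ⁻¹' {φ} ∩ s) g]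
    refine ENNReal.tsum_le_tsum fun x => ?_
    by_cases hx : x ∈ ψ ⁻¹' {φ} ∩ s
    · rw [Set.indicator_of_mem hx]
      exact (if_pos hx.1).ge
    · rw [Set.indicator_of_notMem hx]
      exact zero_le
  refine (Finset.sum_le_sum fun φ _ => h1 φ).trans (le_of_eq ?_)
  rw [← Summable.tsum_finsetSum fun φ _ => ENNReal.summable]
  refine tsum_congr fun x => ?_
  rw [Finset.sum_ite_eq, if_pos (Finset.mem_univ _)]

/-! ### Conditional laws, small balls and the averaged converse. -/

section Cond

variable {n : ℕ} {W : Fin n → Type*} {Z : Type*} [∀ v, MeasurableSpace (W v)]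
  [∀ v, StandardBorelSpace (W v)] [∀ v, Nonempty (W v)] [MeasurableSpace Z]
  (P : Problem W Z) (S : Finset (Fin n))

/-- The conditional law of all observations, given those of the nodes in `S`. -/
def Problem.condLaw (w : ∀ v, W v) : Measure (∀ v, W v) :=
  condDistrib id S.restrict P.law (S.restrict w)

instance (w : ∀ v, W v) : IsProbabilityMeasure (P.condLaw S w) := by
  unfold Problem.condLaw; infer_instance

lemma measurable_restrict_finset : Measurable (S.restrict : (∀ v, W v) → ∀ v : S, W v) := by
  fun_prop

lemma Problem.measurable_condLaw {s : Set (∀ v, W v)} (hs : MeasurableSet s) :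
    Measurable fun w => (P.condLaw S w).real s :=
  ((Kernel.measurable_coe _ hs).comp (measurable_restrict_finset S)).ennreal_toReal

lemma Problem.integrable_condLaw {s : Set (∀ v, W v)} (hs : MeasurableSet s) :
    Integrable (fun w => (P.condLaw S w).real s) P.law :=
  Integrable.of_bound (P.measurable_condLaw S hs).aestronglyMeasurable 1
    (ae_of_all _ fun w => by
      rw [Real.norm_of_nonneg measureReal_nonneg]; exact measureReal_le_one)

lemma Problem.integral_condLaw {s : Set (∀ v, W v)} (hs : MeasurableSet s) :
    ∫ w, (P.condLaw S w).real s ∂P.law = P.law.real s := by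
  have h := setLIntegral_condDistrib_of_measurableSet (μ := P.law) (Y := id) (t := Set.univ)
    (measurable_restrict_finset S) aemeasurable_id hs MeasurableSet.univ
  rw [setLIntegral_univ, Set.univ_inter, Set.preimage_id] at h
  rw [measureReal_def, ← h, ← integral_toReal]
  · rfl
  · exact ((Kernel.measurable_coe _ hs).comp (measurable_restrict_finset S)).aemeasurable
  · exact ae_of_all _ fun w => measure_lt_top _ _

/-- The conditional law lives on its fibre: the joint law of `(W_S, W)` is concentrated on the graph
of the restriction map. -/
lemma Problem.ae_condLaw_restrict :
    ∀ᵐ w ∂P.law, ∀ᵐ w' ∂P.condLaw S w, S.restrict w' = S.restrict w := by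
  refine ae_of_ae_map (measurable_restrict_finset S).aemeasurable
    (p := fun wS => ∀ᵐ w' ∂condDistrib id S.restrict P.law wS, S.restrict w' = wS) ?_
  refine Measure.ae_ae_of_ae_compProd (p := fun x => S.restrict x.2 = x.1) ?_
  rw [compProd_map_condDistrib aemeasurable_id, ae_map_iff]
  · exact ae_of_all _ fun w => rfl
  · exact ((measurable_restrict_finset S).prodMk measurable_id).aemeasurable
  · exact measurableSet_eq_fun ((measurable_restrict_finset S).comp measurable_snd) measurable_fst

lemma Problem.smallBall_le_one (ε : ℝ≥0) (wS : ∀ v : S, W v) : P.smallBall S ε wS ≤ 1 :=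
  iSup_le fun _ => prob_le_one

lemma Problem.meanSmallBall_le_one (ε : ℝ≥0) : P.meanSmallBall S ε ≤ 1 := by
  refine (lintegral_mono fun w => P.smallBall_le_one S ε _).trans ?_
  simp

variable {X Y : Edge (chainAdj n) → Type*} {T : ℕ} (A : Algorithm (chainAdj n) W X Y Z T)
  [∀ e, Fintype (X e)] [∀ e, Fintype (Y e)] (K : ∀ e, X e → PMF (Y e)) (ε : ℝ≥0) (v : Fin n)

lemma integrable_successProb :
    Integrable (fun w => A.successProb K P ε v (P.condLaw S w)) P.law := by
  unfold Algorithm.successProb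
  exact integrable_finsetSum _ fun φ _ => integrable_finsetSum _ fun b _ =>
    (P.integrable_condLaw S ((A.measurableSet_successSet P ε v b).inter
      (A.measurableSet_table φ))).const_mul _

lemma integral_successProb :
    ∫ w, A.successProb K P ε v (P.condLaw S w) ∂P.law = A.successProb K P ε v P.law := by
  unfold Algorithm.successProb
  have hms := fun (φ : EncTable X Y T) (b : BlockHist Y v T) =>
    (A.measurableSet_successSet P ε v b).inter (A.measurableSet_table φ)
  rw [integral_finsetSum _ fun φ _ => integrable_finsetSum _ fun b _ =>
    (P.integrable_condLaw S (hms φ b)).const_mul _]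
  refine Finset.sum_congr rfl fun φ _ => ?_
  rw [integral_finsetSum _ fun b _ => (P.integrable_condLaw S (hms φ b)).const_mul _]
  refine Finset.sum_congr rfl fun b _ => ?_
  rw [integral_const_mul, P.integral_condLaw S (hms φ b)]

lemma measurable_blindProb :
    Measurable fun w => A.blindProb K P ε v (P.condLaw S w) := by
  unfold Algorithm.blindProb Algorithm.tableLaw
  exact Finset.measurable_sum _ fun b _ => (Finset.measurable_sum _ fun φ _ =>
    (P.measurable_condLaw S (A.measurableSet_table φ)).mul_const _).mul
      (P.measurable_condLaw S (A.measurableSet_successSet P ε v b))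

lemma Algorithm.mix_nonneg (μ : Measure (∀ v, W v)) (b : BlockHist Y v T) :
    0 ≤ ∑ φ : EncTable X Y T, A.tableLaw μ φ * φ.blockProb K v b :=
  Finset.sum_nonneg fun φ _ => mul_nonneg (A.tableLaw_nonneg μ φ) (φ.blockProb_nonneg K v b)

lemma Algorithm.sum_mix (μ : Measure (∀ v, W v)) [IsProbabilityMeasure μ] :
    ∑ b : BlockHist Y v T, ∑ φ : EncTable X Y T, A.tableLaw μ φ * φ.blockProb K v b = 1 := by
  rw [Finset.sum_comm]
  simp only [← Finset.mul_sum, EncTable.sum_blockProb, mul_one, A.sum_tableLaw]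

lemma Algorithm.blindProb_nonneg (μ : Measure (∀ v, W v)) : 0 ≤ A.blindProb K P ε v μ :=
  Finset.sum_nonneg fun b _ => mul_nonneg (A.mix_nonneg K v μ b) measureReal_nonneg

lemma Algorithm.blindProb_le (μ : Measure (∀ v, W v)) [IsProbabilityMeasure μ] {L : ℝ}
    (h : ∀ b, μ.real (A.successSet P ε v b) ≤ L) : A.blindProb K P ε v μ ≤ L := by
  calc A.blindProb K P ε v μ
      ≤ ∑ b, (∑ φ : EncTable X Y T, A.tableLaw μ φ * φ.blockProb K v b) * L :=
        Finset.sum_le_sum fun b _ => mul_le_mul_of_nonneg_left (h b) (A.mix_nonneg K v μ b)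
    _ = L := by rw [← Finset.sum_mul, A.sum_mix, one_mul]

/-- On a fibre the observation of `v` is constant, so for given outputs `b` its estimate is a single
point `z`, and success is, up to a null set, the ball around `z`. -/
lemma ae_condLaw_successSet_le (hv : v ∈ S) : ∀ᵐ w ∂P.law, ∀ b,
    P.condLaw S w (A.successSet P ε v b) ≤ P.smallBall S ε (S.restrict w) := by
  filter_upwards [P.ae_condLaw_restrict S] with w hw b
  refine le_trans (le_of_eq (measure_congr ?_))
    (le_iSup (fun z => P.condLaw S w {w | P.d (P.f w) z ≤ ε})
      (A.est v (w v) fun t e => b t ⟨e.1, by rw [e.2]⟩))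
  filter_upwards [hw] with w' hw'
  have : w' v = w v := congrFun hw' ⟨v, hv⟩
  refine propext ?_
  change P.d (P.f w') _ ≤ ε ↔ P.d (P.f w') _ ≤ ε
  rw [this]

lemma ae_blindProb_le_smallBall (hv : v ∈ S) : ∀ᵐ w ∂P.law,
    ENNReal.ofReal (A.blindProb K P ε v (P.condLaw S w)) ≤ P.smallBall S ε (S.restrict w) := by
  filter_upwards [ae_condLaw_successSet_le P S A ε v hv] with w hw
  have htop : P.smallBall S ε (S.restrict w) ≠ ∞ :=
    ne_top_of_le_ne_top ENNReal.one_ne_top (P.smallBall_le_one S ε _)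
  rw [ENNReal.ofReal_le_iff_le_toReal htop]
  exact A.blindProb_le P K ε v _ fun b => ENNReal.toReal_mono htop (hw b)

/-- The small ball probability is a supremum over arbitrarily many `z` and need not be measurable.
Measurability is used only for the blind success probability below it. -/
lemma integral_blindProb_le (hv : v ∈ S) :
    ∫ w, A.blindProb K P ε v (P.condLaw S w) ∂P.law ≤ (P.meanSmallBall S ε).toReal := by
  rw [integral_eq_lintegral_of_nonneg_ae (ae_of_all _ fun w => A.blindProb_nonneg P K ε v _)
    (measurable_blindProb P S A K ε v).aestronglyMeasurable]
  refine ENNReal.toReal_mono (ne_top_of_le_ne_top ENNReal.one_ne_top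
    (P.meanSmallBall_le_one S ε)) ?_
  exact lintegral_mono_ae (ae_blindProb_le_smallBall P S A K ε v hv)

lemma le_lintegral_of_blockInfo_le {δ : ℝ} (hδ : 0 ≤ δ)
    (herr : A.errorProb K P ε v ≤ ENNReal.ofReal δ) (hv : v ∈ S) (hv0 : (v : ℕ) ≠ 0)
    {F : (∀ v, W v) → ℝ≥0∞}
    (hF : ∀ᵐ w ∂P.law, ENNReal.ofReal (blockInfo K (A.tableLaw (P.condLaw S w)) v T) ≤ F w)
    {x : ℝ} (hx : 0 < x) :
    ENNReal.ofReal ((1 - δ) * Real.log (1 + x) -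
      Real.log (1 + x * (P.meanSmallBall S ε).toReal)) ≤ ∫⁻ w, F w ∂P.law := by
  set L := (P.meanSmallBall S ε).toReal with hL
  have hL0 : 0 ≤ L := ENNReal.toReal_nonneg
  -- The tangent point `x₀ = 1 + x * L` is the same for all fibres. With it, the terms left over
  -- after averaging collapse to `log (1 + x * L)` (see `h3`).
  have hx₀ : 0 < 1 + x * L := by positivity
  have hint1 := (integrable_successProb P S A K ε v).const_mul (Real.log (1 + x))
  have hint2 : Integrable (fun w => A.blindProb K P ε v (P.condLaw S w)) P.law :=
    Integrable.of_bound (measurable_blindProb P S A K ε v).aestronglyMeasurable 1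
      (ae_of_all _ fun w => by
        rw [Real.norm_of_nonneg (A.blindProb_nonneg P K ε v _)]
        exact A.blindProb_le P K ε v _ fun b => measureReal_le_one)
  set α : ℝ := Real.log (1 + x * L) + 1 / (1 + x * L) - 1 with hα
  set β : ℝ := x / (1 + x * L) with hβ
  have hint3 : Integrable (fun w => α + β * A.blindProb K P ε v (P.condLaw S w)) P.law :=
    (integrable_const _).add (hint2.const_mul β)
  refine le_trans ?_ ((ofReal_integral_le_lintegral (hint1.sub hint3)).trans
    (lintegral_mono_ae ?_))
  · refine ENNReal.ofReal_le_ofReal ?_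
    simp only [Pi.sub_apply]
    rw [integral_sub hint1 hint3, integral_add (integrable_const α) (hint2.const_mul β),
      integral_const_mul, integral_const_mul, integral_successProb]
    simp only [integral_const, probReal_univ, smul_eq_mul, one_mul]
    have h1 := mul_le_mul_of_nonneg_left (A.le_successProb K P ε v hδ herr)
      (Real.log_nonneg (by linarith : 1 ≤ 1 + x))
    have h2 : β * ∫ w, A.blindProb K P ε v (P.condLaw S w) ∂P.law ≤ β * L :=
      mul_le_mul_of_nonneg_left (integral_blindProb_le P S A K ε v hv) (by positivity)
    have h3 : 1 / (1 + x * L) + β * L = 1 := by rw [hβ]; field_simp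
    linarith
  · filter_upwards [hF] with w hw
    refine le_trans (ENNReal.ofReal_le_ofReal ?_) hw
    refine le_trans (le_of_eq ?_) (A.le_blockInfo K P ε v _ hv0 hx hx₀)
    simp only [Pi.sub_apply, hα, hβ]
    ring

/-- If all channel outputs have positive probability, then an algorithm without errors is no better
than a blind guess. -/
lemma one_le_meanSmallBall_of_errorProb_eq_zero (hv : v ∈ S) (hK : ∀ e x y, K e x y ≠ 0)
    (y : Hist Y T) (herr : A.errorProb K P ε v = 0) : 1 ≤ P.meanSmallBall S ε := by
  classical
  have hnn : ∀ (φ : EncTable X Y T) (b : BlockHist Y v T), 0 ≤ φ.blockProb K v b *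
      P.law.real ((A.successSet P ε v b)ᶜ ∩ {w | A.table w = φ}) := fun φ b =>
    mul_nonneg (φ.blockProb_nonneg K v b) measureReal_nonneg
  rw [A.errorProb_eq, ENNReal.ofReal_eq_zero] at herr
  have h0 := (Finset.sum_eq_zero_iff_of_nonneg fun φ _ => Finset.sum_nonneg fun b _ =>
    hnn φ b).1 (le_antisymm herr (Finset.sum_nonneg fun φ _ => Finset.sum_nonneg fun b _ =>
      hnn φ b))
  -- One output pattern suffices: it has positive probability under every table, so zero error
  -- forces success on it almost surely.
  set b := Hist.block v y with hb
  have hpos : ∀ φ : EncTable X Y T, 0 < φ.blockProb K v b := by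
    intro φ
    have h1 : 0 < φ.histProb K le_rfl y := Finset.prod_pos fun t _ => Finset.prod_pos fun e _ =>
      ENNReal.toReal_pos (hK _ _ _) (PMF.apply_ne_top _ _)
    refine h1.trans_le ?_
    rw [EncTable.blockProb, pushLaw]
    refine le_trans ?_ (Finset.single_le_sum (fun y' _ => ?_) (Finset.mem_univ y))
    · rw [if_pos hb.symm]
    split_ifs
    · exact φ.histProb_nonneg K le_rfl y'
    · exact le_rfl
  have hE := A.measurableSet_successSet P ε v b
  have h2 : P.law.real (A.successSet P ε v b)ᶜ = 0 := by
    rw [← sum_measureReal_inter_table A P.law hE.compl]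
    refine Finset.sum_eq_zero fun φ _ => ?_
    have h3 := (Finset.sum_eq_zero_iff_of_nonneg fun b _ => hnn φ b).1 (h0 φ (Finset.mem_univ φ)) b
      (Finset.mem_univ b)
    exact (mul_eq_zero.1 h3).resolve_left (hpos φ).ne'
  have h4 : P.law (A.successSet P ε v b) = 1 := by
    rwa [measureReal_eq_zero_iff, prob_compl_eq_zero_iff hE] at h2
  have h5 := setLIntegral_condDistrib_of_measurableSet (μ := P.law) (Y := id) (t := Set.univ)
    (measurable_restrict_finset S) aemeasurable_id hE MeasurableSet.univ
  rw [setLIntegral_univ, Set.univ_inter, Set.preimage_id, h4] at h5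
  rw [← h5]
  exact lintegral_mono_ae ((ae_condLaw_successSet_le P S A ε v hv).mono fun w hw => hw b)

lemma ae_exists_table : ∀ᵐ w ∂P.law, ∃ c : EncTable X Y T, ∀ φ,
    A.tableLaw (P.condLaw S w) φ ≠ 0 → ∀ v ∈ S, φ v = c v := by
  filter_upwards [P.ae_condLaw_restrict S] with w hw
  -- On the fibre through `w`, the nodes in `S` encode as they do at `w` itself.
  refine ⟨A.table w, fun φ hφ v hv => ?_⟩
  have h1 : ∃ᵐ w' ∂P.condLaw S w, A.table w' = φ := by
    intro h
    refine hφ ?_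
    rw [Algorithm.tableLaw, measureReal_def, ENNReal.toReal_eq_zero_iff]
    left
    have := ae_iff.1 h
    simpa only [not_not] using this
  obtain ⟨w', h2, h3⟩ := (h1.and_eventually hw).exists
  have h4 : w' v = w v := congrFun h3 ⟨v, hv⟩
  rw [← h2]
  change (fun t => A.enc v t (w' v)) = fun t => A.enc v t (w v)
  rw [h4]

lemma ae_entropy_table_le (S' : Finset (Fin n)) : ∀ᵐ w ∂P.law,
    ENNReal.ofReal (∑ φ, Real.negMulLog (A.tableLaw (P.condLaw S'ᶜ w) φ)) ≤
      ENNReal.ofReal (Real.log 2) *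
        shannonEntropy (condDistrib S'.restrict S'ᶜ.restrict P.law (S'ᶜ.restrict w)) := by
  have h1 := condDistrib_comp (mβ := MeasurableSpace.pi) (μ := P.law) (Y := id) (S'ᶜ).restrict aemeasurable_id
    (measurable_restrict_finset (W := W) S')
  have h2 := ae_of_ae_map (measurable_restrict_finset S'ᶜ).aemeasurable h1
  filter_upwards [h2, P.ae_condLaw_restrict S'ᶜ] with w hw1 hw2
  have h3 : condDistrib S'.restrict S'ᶜ.restrict P.law (S'ᶜ.restrict w) =
      (P.condLaw S'ᶜ w).map S'.restrict := by
    exact hw1.trans (Kernel.map_apply _ (measurable_restrict_finset S') _)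
  classical
  rw [h3]
  have hprob : IsProbabilityMeasure ((P.condLaw S'ᶜ w).map S'.restrict) :=
    Measure.isProbabilityMeasure_map (measurable_restrict_finset S').aemeasurable
  -- On the fibre through `w`, gluing recovers all observations from those of `S'`, so the table is
  -- a function of the latter.
  set glue : (∀ v : S', W v) → ∀ v, W v := fun a v => if h : v ∈ S' then a ⟨v, h⟩ else w v
    with hglue
  have hglue_meas : Measurable glue := by
    refine measurable_pi_lambda _ fun v => ?_
    by_cases h : v ∈ S'
    · simp only [hglue, h, dif_pos]
      exact measurable_pi_apply _
    · simp only [hglue, h, dif_neg, not_false_eq_true]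
      exact measurable_const
  have h4 : ∀ φ, A.tableLaw (P.condLaw S'ᶜ w) φ =
      ((P.condLaw S'ᶜ w).map S'.restrict).real ((fun a => A.table (glue a)) ⁻¹' {φ}) := by
    intro φ
    have hms : MeasurableSet ((fun a => A.table (glue a)) ⁻¹' {φ}) :=
      hglue_meas (A.measurableSet_table φ)
    rw [map_measureReal_apply (measurable_restrict_finset S') hms, Algorithm.tableLaw]
    refine measureReal_congr ?_
    filter_upwards [hw2] with w' hw'
    refine propext ?_
    change A.table w' = φ ↔ A.table (glue (S'.restrict w')) = φ
    have : glue (S'.restrict w') = w' := by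
      funext v
      by_cases h : v ∈ S'
      · simp [hglue, h]
      · simp only [hglue, h, dif_neg, not_false_eq_true]
        exact (congrFun hw' ⟨v, Finset.mem_compl.2 h⟩).symm
    rw [this]
  simp only [h4]
  exact sum_negMulLog_le_shannonEntropy _ _

end Cond

end

noncomputable section

/-! ### The lower bound on the information in terms of small ball probabilities -/

/-- After weakening `log (1 + x)` to `log x`, the optimal weight is `x = (1 - δ) / (δ l)`. For `δ =
0` the optimum is at infinity, hence the limit with `x = 1 / t`. -/
lemma real_ell_le {δ l R : ℝ} (hδ0 : 0 ≤ δ) (hδ1 : δ < 1) (hl : 0 < l)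
    (h : ∀ x, 0 < x → (1 - δ) * Real.log (1 + x) - Real.log (1 + x * l) ≤ R) :
    (1 - δ) * -Real.log l - Real.binEntropy δ ≤ R := by
  rcases hδ0.eq_or_lt with rfl | hδ
  · have h1 : ∀ t : ℝ, 0 < t → -Real.log (l + t) ≤ R := by
      intro t ht
      have h2 := h t⁻¹ (inv_pos.2 ht)
      have h3 : Real.log t⁻¹ ≤ Real.log (1 + t⁻¹) :=
        Real.log_le_log (inv_pos.2 ht) (by linarith)
      have h4 : 1 + t⁻¹ * l = t⁻¹ * (l + t) := by field_simp; ring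
      rw [h4, Real.log_mul (inv_pos.2 ht).ne' (by positivity)] at h2
      linarith
    have h5 : Tendsto (fun t => -Real.log (l + t)) (nhdsWithin 0 (Set.Ioi 0))
        (nhds (-Real.log (l + 0))) := by
      have : ContinuousAt (fun t => -Real.log (l + t)) 0 := by
        refine ContinuousAt.neg (ContinuousAt.log (by fun_prop) ?_)
        simpa using hl.ne'
      exact this.tendsto.mono_left nhdsWithin_le_nhds
    have := le_of_tendsto h5 (eventually_mem_nhdsWithin.mono h1)
    simpa using this
  · have hδ' : 0 < 1 - δ := by linarith
    have h1 := h ((1 - δ) / (δ * l)) (by positivity)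
    have h2 : 1 + (1 - δ) / (δ * l) * l = δ⁻¹ := by field_simp; ring
    have h3 : Real.log ((1 - δ) / (δ * l)) ≤ Real.log (1 + (1 - δ) / (δ * l)) :=
      Real.log_le_log (by positivity) (by linarith)
    rw [Real.log_div hδ'.ne' (by positivity), Real.log_mul hδ.ne' hl.ne'] at h3
    have h4 := mul_le_mul_of_nonneg_left h3 hδ'.le
    rw [h2, Real.log_inv] at h1
    rw [Real.binEntropy, Real.log_inv, Real.log_inv]
    linarith

/-- The bound `ℓ` as a function of `E[L(W_U, ε)]`. -/
def ellOf (L : ℝ≥0∞) (δ : ℝ) : EReal := ((1 - δ : ℝ) : EReal) * log2 L⁻¹ - ((h2 δ : ℝ) : EReal)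

lemma ellOf_coe {L : ℝ≥0∞} (h0 : L ≠ 0) (h1 : L ≠ ∞) (δ : ℝ) :
    ellOf L δ = (((1 - δ) * -Real.log L.toReal - Real.binEntropy δ) / Real.log 2 : ℝ) := by
  have : log2 L⁻¹ = ((-Real.log L.toReal / Real.log 2 : ℝ) : EReal) := by
    rw [log2, ENNReal.log_pos_real (ENNReal.inv_ne_zero.2 h1) (ENNReal.inv_ne_top.2 h0),
      ENNReal.toReal_inv, Real.log_inv, ← EReal.coe_div]
  rw [ellOf, this, ← EReal.coe_mul, ← EReal.coe_sub, h2]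
  congr 1
  ring

lemma ellOf_le {L : ℝ≥0∞} (hL : L ≠ ∞) {δ : ℝ} (hδ0 : 0 ≤ δ) (hδ1 : δ < 1) {b : ℝ≥0∞}
    (h : ∀ x, 0 < x → ENNReal.ofReal ((1 - δ) * Real.log (1 + x) - Real.log (1 + x * L.toReal)) ≤
      ENNReal.ofReal (Real.log 2) * b) : ellOf L δ ≤ (b : EReal) := by
  have hlog : 0 < Real.log 2 := Real.log_pos one_lt_two
  rcases eq_or_ne b ∞ with rfl | hb
  · simp
  lift b to ℝ≥0 using hb
  have h' : ∀ x, 0 < x → (1 - δ) * Real.log (1 + x) - Real.log (1 + x * L.toReal) ≤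
      Real.log 2 * b := by
    intro x hx
    have := h x hx
    rw [← ENNReal.ofReal_coe_nnreal, ← ENNReal.ofReal_mul hlog.le] at this
    exact (ENNReal.ofReal_le_ofReal_iff (by positivity)).1 this
  rcases eq_or_ne L 0 with rfl | hL0
  · exfalso
    have hδ' : 0 < 1 - δ := by linarith
    -- For `L = 0` nothing penalises large `x`, so no finite `b` is possible; this `x` exceeds the
    -- bound by one.
    have h1 := h' (Real.exp ((Real.log 2 * b + 1) / (1 - δ))) (Real.exp_pos _)
    have h3 : (Real.log 2 * b + 1) / (1 - δ) ≤
        Real.log (1 + Real.exp ((Real.log 2 * b + 1) / (1 - δ))) := by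
      rw [Real.le_log_iff_exp_le (by positivity)]
      linarith
    have h4 := mul_le_mul_of_nonneg_left h3 hδ'.le
    rw [mul_div_cancel₀ _ hδ'.ne'] at h4
    simp only [ENNReal.toReal_zero, mul_zero, add_zero, Real.log_one] at h1
    linarith
  · rw [ellOf_coe hL0 hL]
    have h1 := real_ell_le hδ0 hδ1 (ENNReal.toReal_pos hL0 hL) h'
    have h3 : ((1 - δ) * -Real.log L.toReal - Real.binEntropy δ) / Real.log 2 ≤ b := by
      rw [div_le_iff₀ hlog]
      linarith
    exact le_of_le_of_eq (EReal.coe_le_coe_iff.2 h3) rfl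

/-- If `ℓ > 0`, then the information is bounded away from `0`. -/
lemma exists_pos_le_of_ellOf_pos {δ : ℝ} (hδ0 : 0 < δ) (hδ1 : δ < 1) :
    ∃ κ x : ℝ, 0 < κ ∧ 0 < x ∧ ∀ L : ℝ≥0∞, L ≠ ∞ → 0 < ellOf L δ →
      κ ≤ (1 - δ) * Real.log (1 + x) - Real.log (1 + x * L.toReal) := by
  have hδ' : 0 < 1 - δ := by linarith
  -- `E₀` is the value of `L` at which `ℓ = 0`, and `x` is the optimal weight there. The gain `κ` is
  -- exactly what `real_ell_le` discards by replacing `log (1 + x)` with `log x`.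
  set E₀ : ℝ := Real.exp (-Real.binEntropy δ / (1 - δ)) with hE
  have hE0 : 0 < E₀ := Real.exp_pos _
  set x : ℝ := (1 - δ) / (δ * E₀) with hx
  have hx0 : 0 < x := by positivity
  refine ⟨(1 - δ) * (Real.log (1 + x) - Real.log x), x, ?_, hx0, fun L hL hpos => ?_⟩
  · exact mul_pos hδ' (sub_pos.2 (Real.log_lt_log hx0 (by linarith)))
  have hLE : L.toReal ≤ E₀ := by
    rcases eq_or_ne L 0 with rfl | hL0
    · simpa using hE0.le
    rw [ellOf_coe hL0 hL, EReal.coe_pos, div_pos_iff_of_pos_right (Real.log_pos one_lt_two)] at hpos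
    rw [← Real.log_le_log_iff (ENNReal.toReal_pos hL0 hL) hE0, hE, Real.log_exp, le_div_iff₀ hδ']
    linarith
  have h1 : Real.log (1 + x * L.toReal) ≤ Real.log (1 + x * E₀) :=
    Real.log_le_log (by positivity) (by gcongr)
  have h2 : 1 + x * E₀ = δ⁻¹ := by rw [hx]; field_simp; ring
  rw [h2, Real.log_inv] at h1
  have h3 : (1 - δ) * Real.log x = -Real.log δ := by
    rw [hx, Real.log_div hδ'.ne' (by positivity), Real.log_mul hδ0.ne' hE0.ne', hE, Real.log_exp,
      Real.binEntropy, Real.log_inv, Real.log_inv]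
    field_simp
    ring
  linarith

lemma exists_algorithm_of_compTime_eq {V : Type*} {E : V → V → Prop} [Fintype V] [DecidableEq V]
    [DecidableRel E] {W : V → Type*} {X Y : Edge E → Type*} [∀ e, Fintype (Y e)] {Z : Type*}
    [∀ v, MeasurableSpace (W v)] [MeasurableSpace Z] {K : ∀ e, X e → PMF (Y e)} {P : Problem W Z}
    {ε : ℝ≥0} {δ : ℝ} {T : ℕ} (h : compTime K P ε δ = T) :
    ∃ A : Algorithm E W X Y Z T, ∀ v, A.errorProb K P ε v ≤ ENNReal.ofReal δ := by
  classical
  by_contra hcon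
  have hle : ((T + 1 : ℕ) : ℕ∞) ≤ compTime K P ε δ := by
    refine le_iInf₂ fun T' hT' => ?_
    have h1 : compTime K P ε δ ≤ (T' : ℕ∞) := iInf₂_le T' hT'
    rw [h] at h1
    have h2 : T ≤ T' := by exact_mod_cast h1
    have h3 : T ≠ T' := by
      rintro rfl
      exact hcon hT'
    exact_mod_cast Nat.lt_of_le_of_ne h2 h3
  rw [h] at hle
  have : T + 1 ≤ T := by exact_mod_cast hle
  omega

/-! ### Bounds on `ℓ` for a given algorithm on the chain. -/

section Chain

variable {n : ℕ} (hn : 2 ≤ n)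

lemma mem_compl_firstNode {v : Fin n} : v ∈ (firstNode hn)ᶜ ↔ (v : ℕ) ≠ 0 := by
  rw [Finset.mem_compl, firstNode, Finset.mem_singleton, Fin.ext_iff]

lemma cutsetCapacity_compl_firstNode {X Y : Edge (chainAdj n) → Type*}
    (K : ∀ e, X e → PMF (Y e)) :
    cutsetCapacity K (firstNode hn)ᶜ = capacity (K (fwdEdge (i := 0) hn)) := by
  rw [cutsetCapacity]
  have : Finset.univ.filter (fun e : Edge (chainAdj n) =>
      e.1.1 ∉ (firstNode hn)ᶜ ∧ e.1.2 ∈ (firstNode hn)ᶜ) = {fwdEdge (i := 0) hn} := by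
    ext e
    simp only [Finset.mem_filter, Finset.mem_univ, true_and, mem_compl_firstNode,
      Finset.mem_singleton, not_not]
    constructor
    · obtain ⟨⟨u, v⟩, h⟩ := e
      rintro ⟨h1, h2⟩
      simp only at h1 h2
      refine Subtype.ext (Prod.ext (Fin.ext ?_) (Fin.ext ?_)) <;>
        rcases h with h | h <;> simp only at h ⊢ <;> omega
    · rintro rfl
      exact ⟨rfl, one_ne_zero⟩
  rw [this, Finset.sum_singleton]

variable {W : Fin n → Type*} {Z : Type*} [∀ v, MeasurableSpace (W v)]
  [∀ v, StandardBorelSpace (W v)] [∀ v, Nonempty (W v)] [MeasurableSpace Z]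
  {X Y : Edge (chainAdj n) → Type*} {T : ℕ} [∀ e, Fintype (X e)] [∀ e, Fintype (Y e)]
  {K : ∀ e, X e → PMF (Y e)} {P : Problem W Z} {ε : ℝ≥0} {δ η : ℝ}

/-- The last node of the chain. -/
def lastNode : Fin n := ⟨n - 1, by omega⟩

variable (A : Algorithm (chainAdj n) W X Y Z T)
  (herr : ∀ v, A.errorProb K P ε v ≤ ENNReal.ofReal δ) (hδ0 : 0 ≤ δ) (hδ1 : δ < 1)

include A herr hδ0 in
lemma le_lintegral_lastNode {F : (∀ v, W v) → ℝ≥0∞}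
    (hF : ∀ᵐ w ∂P.law, ENNReal.ofReal
      (blockInfo K (A.tableLaw (P.condLaw (firstNode hn)ᶜ w)) (n - 1) T) ≤ F w) {x : ℝ}
    (hx : 0 < x) :
    ENNReal.ofReal ((1 - δ) * Real.log (1 + x) -
      Real.log (1 + x * (P.meanSmallBall (firstNode hn)ᶜ ε).toReal)) ≤ ∫⁻ w, F w ∂P.law := by
  have h0 : ((lastNode hn : Fin n) : ℕ) ≠ 0 := by simp only [lastNode]; omega
  exact le_lintegral_of_blockInfo_le P (firstNode hn)ᶜ A K ε (lastNode hn) hδ0 (herr _)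
    ((mem_compl_firstNode hn).2 h0) h0 hF hx

lemma meanSmallBall_ne_top (S : Finset (Fin n)) : P.meanSmallBall S ε ≠ ∞ :=
  ne_top_of_le_ne_top ENNReal.one_ne_top (P.meanSmallBall_le_one S ε)

include A herr hδ0 hδ1 in
lemma ell_le_condEntropy_mul {a : ℝ} (ha0 : 0 ≤ a)
    (ha : ∀ (m : EncTable X Y T → ℝ) (c : EncTable X Y T), (∀ φ, 0 ≤ m φ) → ∑ φ, m φ = 1 →
      (∀ φ, m φ ≠ 0 → ∀ v : Fin n, (v : ℕ) ≠ 0 → φ v = c v) →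
      blockInfo K m (n - 1) T ≤ (∑ φ, Real.negMulLog (m φ)) * a) :
    P.ell (firstNode hn)ᶜ ε δ ≤
      ((P.condEntropy (firstNode hn) (firstNode hn)ᶜ * ENNReal.ofReal a : ℝ≥0∞) : EReal) := by
  refine ellOf_le (meanSmallBall_ne_top _) hδ0 hδ1 fun x hx => ?_
  refine (le_lintegral_lastNode hn A herr hδ0 (F := fun w => ENNReal.ofReal (Real.log 2) *
    shannonEntropy (condDistrib (firstNode hn).restrict (firstNode hn)ᶜ.restrict P.law
      ((firstNode hn)ᶜ.restrict w)) * ENNReal.ofReal a) ?_ hx).trans (le_of_eq ?_)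
  · filter_upwards [ae_entropy_table_le P A (firstNode hn), ae_exists_table P (firstNode hn)ᶜ A]
      with w hw ⟨c, hc⟩
    refine le_trans (ENNReal.ofReal_le_ofReal (ha _ c (A.tableLaw_nonneg _) (A.sum_tableLaw _)
      fun φ hφ v hv => hc φ hφ v ((mem_compl_firstNode hn).2 hv))) ?_
    rw [ENNReal.ofReal_mul' ha0]
    exact mul_le_mul_left hw _
  · rw [lintegral_mul_const' _ _ ENNReal.ofReal_ne_top,
      lintegral_const_mul' _ _ ENNReal.ofReal_ne_top, mul_assoc]
    rfl

include A herr hδ0 in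
-- The weight `x` is kept free here, because the argument for binary symmetric channels needs the
-- inequality at one fixed `x` rather than its optimised form.
lemma le_capacity_mul {a : ℝ}
    (ha : ∀ C : ℝ, 0 ≤ C →
      HasCapacityBound (fun x y => (K (fwdEdge (i := 0) hn) x y).toReal) C →
      ∀ (m : EncTable X Y T → ℝ) (c : EncTable X Y T), (∀ φ, 0 ≤ m φ) → ∑ φ, m φ = 1 →
      (∀ φ, m φ ≠ 0 → ∀ v : Fin n, (v : ℕ) ≠ 0 → φ v = c v) →
      blockInfo K m (n - 1) T ≤ C * a) {x : ℝ} (hx : 0 < x) :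
    ENNReal.ofReal ((1 - δ) * Real.log (1 + x) -
      Real.log (1 + x * (P.meanSmallBall (firstNode hn)ᶜ ε).toReal)) ≤
      ENNReal.ofReal (Real.log 2) *
        (cutsetCapacity K (firstNode hn)ᶜ * ENNReal.ofReal a) := by
  have hlog : 0 < Real.log 2 := Real.log_pos one_lt_two
  rw [cutsetCapacity_compl_firstNode hn]
  set C := (capacity (K (fwdEdge (i := 0) hn))).toReal with hC
  have hC' : capacity (K (fwdEdge (i := 0) hn)) = ENNReal.ofReal C :=
    (ENNReal.ofReal_toReal (capacity_ne_top _)).symm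
  have hC0 : 0 ≤ C := ENNReal.toReal_nonneg
  refine (le_lintegral_lastNode hn A herr hδ0 (F := fun _ => ENNReal.ofReal (Real.log 2) *
    (capacity (K (fwdEdge (i := 0) hn)) * ENNReal.ofReal a)) ?_ hx).trans (le_of_eq ?_)
  · filter_upwards [ae_exists_table P (firstNode hn)ᶜ A] with w ⟨c, hc⟩
    rw [hC', ← ENNReal.ofReal_mul hC0, ← ENNReal.ofReal_mul hlog.le]
    refine ENNReal.ofReal_le_ofReal ((ha (C * Real.log 2) (by positivity)
      (hasCapacityBound_of_capacity_le hC0 hC'.le) _ c (A.tableLaw_nonneg _) (A.sum_tableLaw _)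
      fun φ hφ v hv => hc φ hφ v ((mem_compl_firstNode hn).2 hv)).trans (le_of_eq ?_))
    ring
  · simp

variable (hη0 : 0 ≤ η) (hη1 : η ≤ 1) (hK : ∀ e, sdpiConst (K e) ≤ ENNReal.ofReal η)

include hη0 hK in
lemma hasSDPI_of_forall (e : Edge (chainAdj n)) : HasSDPI (fun x y => (K e x y).toReal) η :=
  hasSDPI_of_sdpiConst_le hη0 (hK e)

include A herr hδ0 hδ1 hη0 hη1 hK

lemma ell_le_entropy_sum : P.ell (firstNode hn)ᶜ ε δ ≤
    ((P.condEntropy (firstNode hn) (firstNode hn)ᶜ * ENNReal.ofReal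
      (η * ∑ i ∈ Finset.Icc 1 (T + 2 - n), binomProb (T - i) (n - 2) η) : ℝ≥0∞) : EReal) :=
  ell_le_condEntropy_mul hn A herr hδ0 hδ1
    (mul_nonneg hη0 (Finset.sum_nonneg fun _ _ => binomProb_nonneg _ _ hη0 hη1))
    fun _ _ hm hm1 hc => blockInfo_last_le_entropy_sum K hm hm1 hc hn hη0 hη1
      (hasSDPI_of_forall hη0 hK)

lemma ell_le_entropy_prod : P.ell (firstNode hn)ᶜ ε δ ≤
    ((P.condEntropy (firstNode hn) (firstNode hn)ᶜ * ENNReal.ofReal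
      ((1 - (1 - η) ^ (T + 2 - n)) ^ (n - 1)) : ℝ≥0∞) : EReal) :=
  ell_le_condEntropy_mul hn A herr hδ0 hδ1
    (pow_nonneg (sub_nonneg.2 (pow_le_one₀ (sub_nonneg.2 hη1) (by linarith))) _)
    fun _ _ hm hm1 hc => blockInfo_last_le_entropy_prod K hm hm1 hc hn hη0 hη1
      (hasSDPI_of_forall hη0 hK)

lemma ell_le_capacity_sum (hn3 : 3 ≤ n) : P.ell (firstNode hn)ᶜ ε δ ≤
    ((cutsetCapacity K (firstNode hn)ᶜ * ENNReal.ofReal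
      (η * ∑ i ∈ Finset.Icc 1 (T + 2 - n), binomProb (T - i - 1) (n - 3) η * i) : ℝ≥0∞) :
        EReal) :=
  ellOf_le (meanSmallBall_ne_top _) hδ0 hδ1 fun _ hx =>
    le_capacity_mul hn A herr hδ0 (fun _ _ hC _ _ hm hm1 hc =>
      blockInfo_last_le_capacity_sum K hm hm1 hc hn hη0 hη1 (hasSDPI_of_forall hη0 hK) hC hn3) hx

omit hδ1 in
lemma le_capacity_prod {x : ℝ} (hx : 0 < x) : ENNReal.ofReal ((1 - δ) * Real.log (1 + x) -
      Real.log (1 + x * (P.meanSmallBall (firstNode hn)ᶜ ε).toReal)) ≤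
      ENNReal.ofReal (Real.log 2) * (cutsetCapacity K (firstNode hn)ᶜ * ENNReal.ofReal
        ((T + 2 - n : ℕ) * (1 - (1 - η) ^ (T + 2 - n)) ^ (n - 2))) :=
  le_capacity_mul hn A herr hδ0 (fun _ hC0 hC _ _ hm hm1 hc =>
    blockInfo_last_le_capacity_prod K hm hm1 hc hn hη0 hη1 (hasSDPI_of_forall hη0 hK) hC0 hC) hx

lemma ell_le_capacity_prod : P.ell (firstNode hn)ᶜ ε δ ≤
    ((cutsetCapacity K (firstNode hn)ᶜ * ENNReal.ofReal
      ((T + 2 - n : ℕ) * (1 - (1 - η) ^ (T + 2 - n)) ^ (n - 2)) : ℝ≥0∞) : EReal) :=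
  ellOf_le (meanSmallBall_ne_top _) hδ0 hδ1 fun _ hx =>
    le_capacity_prod hn A herr hδ0 hη0 hη1 hK hx

end Chain

end

noncomputable section

/-! ### Analytic estimates -/

/-- With `y ^ m = r`, the last bound is Bernoulli's inequality. -/
lemma one_sub_rpow_bounds {r : ℝ} (hr0 : 0 ≤ r) (hr1 : r < 1) {m : ℕ} (hm : 1 ≤ m) :
    r ^ (1 / (m : ℝ)) < 1 ∧ 1 - r ^ (1 / (m : ℝ)) ≤ 1 - r ∧
      1 - r ≤ m * (1 - r ^ (1 / (m : ℝ))) := by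
  set y := r ^ (1 / (m : ℝ)) with hy
  have hy0 : 0 ≤ y := Real.rpow_nonneg hr0 _
  have hym : y ^ m = r := by
    rw [hy, one_div]
    exact Real.rpow_inv_natCast_pow hr0 (by omega)
  have hy1 : y < 1 := Real.rpow_lt_one hr0 hr1 (by positivity)
  refine ⟨hy1, ?_, ?_⟩
  · have := pow_le_of_le_one hy0 hy1.le (by omega : m ≠ 0)
    linarith
  · have := one_add_mul_le_pow (a := y - 1) (by linarith) m
    rw [add_sub_cancel, hym] at this
    linarith

lemma isEquivalent_chain_bound (η : ℝ) (r : ℕ → ℝ) (hη0 : 0 < η) (hη1 : η < 1)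
    (hr : ∀ n, 0 ≤ r n ∧ r n < 1) :
    Asymptotics.IsEquivalent atTop
      (fun n : ℕ => Real.logb 2 (1 - r n ^ (1 / ((n : ℝ) - 1)))⁻¹ /
        (2 * Real.logb 2 (1 - η)⁻¹) + ((n : ℝ) - 2))
      (fun n : ℕ => (Real.logb 2 ((n : ℝ) - 1) + Real.logb 2 (1 - r n)⁻¹) /
        (2 * Real.logb 2 (1 - η)⁻¹) + ((n : ℝ) - 2)) := by
  have h2 : 0 < Real.log 2 := Real.log_pos one_lt_two
  have ha : 0 < 2 * Real.logb 2 (1 - η)⁻¹ := by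
    have := Real.logb_pos one_lt_two ((one_lt_inv₀ (by linarith : 0 < 1 - η)).2 (by linarith))
    linarith
  set a := 2 * Real.logb 2 (1 - η)⁻¹ with hadef
  have hbd : ∀ n : ℕ, 2 ≤ n →
      Real.logb 2 (1 - r n ^ (1 / ((n : ℝ) - 1)))⁻¹ ≤
        Real.logb 2 ((n : ℝ) - 1) + Real.logb 2 (1 - r n)⁻¹ ∧
      Real.logb 2 (1 - r n)⁻¹ ≤ Real.logb 2 (1 - r n ^ (1 / ((n : ℝ) - 1)))⁻¹ ∧
      0 ≤ Real.logb 2 (1 - r n)⁻¹ ∧ 0 ≤ Real.logb 2 ((n : ℝ) - 1) := by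
    intro n hn
    have hcast : ((n - 1 : ℕ) : ℝ) = (n : ℝ) - 1 := by
      rw [Nat.cast_sub (by omega), Nat.cast_one]
    obtain ⟨h3, h4, h5⟩ := one_sub_rpow_bounds (hr n).1 (hr n).2 (by omega : 1 ≤ n - 1)
    rw [hcast] at h3 h4 h5
    have hn1 : (1 : ℝ) ≤ (n : ℝ) - 1 := by rw [← hcast]; exact_mod_cast (by omega : 1 ≤ n - 1)
    have hr1 : 0 < 1 - r n := sub_pos.2 (hr n).2
    have hy : 0 < 1 - r n ^ (1 / ((n : ℝ) - 1)) := sub_pos.2 h3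
    rw [Real.logb_inv, Real.logb_inv]
    refine ⟨?_, ?_, ?_, Real.logb_nonneg one_lt_two hn1⟩
    · have := Real.logb_le_logb_of_le one_lt_two hr1 h5
      rw [Real.logb_mul (by linarith) hy.ne'] at this
      linarith
    · have := Real.logb_le_logb_of_le one_lt_two hy h4
      linarith
    · have := Real.logb_nonpos one_lt_two hr1.le (by linarith [(hr n).1])
      linarith
  have h6 : (fun n : ℕ => Real.log (n : ℝ)) =o[atTop] fun n : ℕ => (n : ℝ) :=
    Real.isLittleO_log_id_atTop.comp_tendsto tendsto_natCast_atTop_atTop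
  -- By `hbd` the two sides differ by at most a multiple of `log n`, uniformly in `r`, while the
  -- right side is at least `n - 2 ≥ n / 2` for `n ≥ 4`.
  refine (Asymptotics.IsBigO.of_bound (1 / (Real.log 2 * a)) ?_).trans_isLittleO
    (h6.trans_isBigO (Asymptotics.IsBigO.of_bound 2 ?_))
  · filter_upwards [eventually_ge_atTop 2] with n hn
    obtain ⟨h3, h4, h5, h7⟩ := hbd n hn
    have hn1 : (2 : ℝ) ≤ n := by exact_mod_cast hn
    have h8 : Real.logb 2 ((n : ℝ) - 1) ≤ Real.log n / Real.log 2 :=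
      Real.logb_le_logb_of_le one_lt_two (by linarith) (by linarith)
    have h9 : 0 ≤ Real.log n := Real.log_nonneg (by linarith)
    simp only [Pi.sub_apply]
    rw [add_sub_add_right_eq_sub, ← sub_div, Real.norm_eq_abs, abs_div, abs_of_pos ha,
      abs_of_nonpos (by linarith), Real.norm_of_nonneg h9, div_le_iff₀ ha]
    have : 1 / (Real.log 2 * a) * Real.log n * a = Real.log n / Real.log 2 := by field_simp
    rw [this]
    linarith
  · filter_upwards [eventually_ge_atTop 4] with n hn
    obtain ⟨h3, h4, h5, h7⟩ := hbd n (by omega)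
    have hn1 : (4 : ℝ) ≤ n := by exact_mod_cast hn
    have h8 : 0 ≤ (Real.logb 2 ((n : ℝ) - 1) + Real.logb 2 (1 - r n)⁻¹) / a :=
      div_nonneg (by linarith) ha.le
    rw [Real.norm_of_nonneg (by linarith), Real.norm_of_nonneg (by linarith)]
    linarith

/-- A Chernoff bound with tilting parameter 3: the binomial probability is `exp (-3 k)` times one
term of the expansion of `(η e³ + 1 - η) ^ m`, and `e³ ≤ 21`. -/
lemma binomProb_le_exp (m k : ℕ) {η : ℝ} (h0 : 0 ≤ η) (h1 : η ≤ 1) :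
    binomProb m k η ≤ Real.exp (-3 * k + 20 * (m * η)) := by
  rcases lt_or_ge m k with h | h
  · rw [binomProb_of_lt h]
    exact (Real.exp_pos _).le
  have hq : 0 ≤ 1 - η := by linarith
  have he : Real.exp 3 ≤ 21 := by
    have h2 := Real.exp_one_lt_d9.le
    have h3 : Real.exp 3 = Real.exp 1 ^ 3 := by rw [← Real.exp_nat_mul]; norm_num
    rw [h3]
    exact (pow_le_pow_left₀ (Real.exp_pos 1).le h2 3).trans (by norm_num)
  have h2 : (η * Real.exp 3) ^ k * (1 - η) ^ (m - k) * (m.choose k : ℝ) ≤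
      (η * Real.exp 3 + (1 - η)) ^ m := by
    rw [add_pow]
    exact Finset.single_le_sum
      (f := fun i => (η * Real.exp 3) ^ i * (1 - η) ^ (m - i) * (m.choose i : ℝ))
      (fun i _ => by positivity) (Finset.mem_range.2 (by omega))
  have h3 : (η * Real.exp 3 + (1 - η)) ^ m ≤ Real.exp (20 * (m * η)) := by
    have h4 : η * Real.exp 3 + (1 - η) ≤ Real.exp (20 * η) := by
      have := Real.add_one_le_exp (20 * η)
      nlinarith
    refine (pow_le_pow_left₀ (by positivity) h4 m).trans (le_of_eq ?_)
    rw [← Real.exp_nat_mul]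
    congr 1
    ring
  rw [Real.exp_add, show -3 * (k : ℝ) = -(k * 3) by ring, Real.exp_neg, Real.exp_nat_mul,
    inv_mul_eq_div, le_div_iff₀ (by positivity), binomProb]
  refine le_trans (le_of_eq ?_) (h2.trans h3)
  rw [mul_pow]
  ring

/-- The weighted binomial sum is small if `T` is small compared with `n / η'`. -/
lemma binomSum_le_exp {n T : ℕ} {η η' : ℝ} (hn : 4 ≤ n) (hη : 0 < η) (hηη' : η ≤ η')
    (hη' : η' ≤ 1) (hT : (T : ℝ) < 1 / 80 * (n / η')) :
    η' * ∑ i ∈ Finset.Icc 1 (T + 2 - n), binomProb (T - i - 1) (n - 3) η' * i ≤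
      (n : ℝ) ^ 2 * ((n : ℝ) - 3) ^ 2 / (4 * η) * Real.exp (-2 * η ^ 2 * ((n : ℝ) - 3)) := by
  have hη'0 : 0 < η' := hη.trans_le hηη'
  have hn4 : (4 : ℝ) ≤ n := by exact_mod_cast hn
  have hTη : T * η' ≤ n / 80 := by
    have := mul_le_mul_of_nonneg_right hT.le hη'0.le
    have h2 : 1 / 80 * (n / η') * η' = (n : ℝ) / 80 := by field_simp
    linarith
  have hcast : ((n - 3 : ℕ) : ℝ) = (n : ℝ) - 3 := by rw [Nat.cast_sub (by omega)]; norm_num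
  have hη2 : η ^ 2 ≤ 1 := by nlinarith
  have hB : ∀ i, binomProb (T - i - 1) (n - 3) η' ≤ Real.exp (-2 * η ^ 2 * ((n : ℝ) - 3)) := by
    intro i
    refine (binomProb_le_exp _ _ hη'0.le hη').trans (Real.exp_le_exp.2 ?_)
    have h1 : ((T - i - 1 : ℕ) : ℝ) * η' ≤ T * η' :=
      mul_le_mul_of_nonneg_right (by exact_mod_cast (by omega : T - i - 1 ≤ T)) hη'0.le
    rw [hcast]
    -- The constant `1 / 80` turns the Chernoff error `20 T η'` into at most `n / 4`, which is at
    -- most `n - 3` precisely for `n ≥ 4`. So `-2 (n - 3)` is left in the exponent, and `η ^ 2 ≤ 1`.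
    nlinarith
  have hsum : ∑ i ∈ Finset.Icc 1 (T + 2 - n), binomProb (T - i - 1) (n - 3) η' * i ≤
      (T : ℝ) ^ 2 * Real.exp (-2 * η ^ 2 * ((n : ℝ) - 3)) := by
    calc ∑ i ∈ Finset.Icc 1 (T + 2 - n), binomProb (T - i - 1) (n - 3) η' * i
        ≤ ∑ _i ∈ Finset.Icc 1 (T + 2 - n), Real.exp (-2 * η ^ 2 * ((n : ℝ) - 3)) * T := by
          refine Finset.sum_le_sum fun i hi => mul_le_mul (hB i) ?_ (Nat.cast_nonneg _)
            (Real.exp_pos _).le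
          rw [Finset.mem_Icc] at hi
          exact_mod_cast (by omega : i ≤ T)
      _ = ((T + 2 - n : ℕ) : ℝ) * (Real.exp (-2 * η ^ 2 * ((n : ℝ) - 3)) * T) := by
          rw [Finset.sum_const, Nat.card_Icc, Nat.add_sub_cancel, nsmul_eq_mul]
      _ ≤ (T : ℝ) * (Real.exp (-2 * η ^ 2 * ((n : ℝ) - 3)) * T) :=
          mul_le_mul_of_nonneg_right (by exact_mod_cast (by omega : T + 2 - n ≤ T))
            (by positivity)
      _ = _ := by ring
  have h1 : η' * (T : ℝ) ^ 2 ≤ (n : ℝ) ^ 2 * ((n : ℝ) - 3) ^ 2 / (4 * η) := by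
    rw [le_div_iff₀ (by positivity)]
    have h2 : (T * η') ^ 2 ≤ (n / 80 : ℝ) ^ 2 := pow_le_pow_left₀ (by positivity) hTη 2
    have h3 : η' * (T : ℝ) ^ 2 * (4 * η) ≤ 4 * (T * η') ^ 2 := by
      have h0 : 0 ≤ 4 * (η' * (T : ℝ) ^ 2) := by positivity
      nlinarith [mul_le_mul_of_nonneg_left hηη' h0]
    have h4 : (n : ℝ) ^ 2 * 1 ≤ (n : ℝ) ^ 2 * ((n : ℝ) - 3) ^ 2 :=
      mul_le_mul_of_nonneg_left (by nlinarith) (sq_nonneg _)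
    nlinarith [sq_nonneg (n : ℝ)]
  calc _ ≤ η' * ((T : ℝ) ^ 2 * Real.exp (-2 * η ^ 2 * ((n : ℝ) - 3))) :=
        mul_le_mul_of_nonneg_left hsum hη'0.le
    _ = η' * (T : ℝ) ^ 2 * Real.exp (-2 * η ^ 2 * ((n : ℝ) - 3)) := by ring
    _ ≤ _ := mul_le_mul_of_nonneg_right h1 (Real.exp_pos _).le

/-- The hypothesis on `s` says `q ^ s > 1 / u` with `u = √(2 m)`. Hence `(1 - q ^ s) ^ (m - 1)` is
at most `exp (1 - u / 2)`, which beats `s = O(log m)`. -/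
lemma exists_forall_mul_pow_lt {q κ : ℝ} (hq0 : 0 < q) (hq1 : q < 1) (hκ : 0 < κ) :
    ∃ N : ℕ, ∀ m : ℕ, N ≤ m → ∀ s : ℕ, s * (2 * Real.log q⁻¹) < Real.log (2 * m) →
      Real.log 2 * (s * (1 - q ^ s) ^ (m - 1)) < κ := by
  set a := 2 * Real.log q⁻¹ with ha
  have ha0 : 0 < a := by
    have := Real.log_pos ((one_lt_inv₀ hq0).2 hq1)
    linarith
  have h2 : 0 < Real.log 2 := Real.log_pos one_lt_two
  set D : ℝ := 4 * Real.log 2 * Real.exp 1 / a with hD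
  have hlim : Tendsto (fun m : ℕ => D * ((Real.sqrt (2 * m) / 2) ^ 1 *
      Real.exp (-(Real.sqrt (2 * m) / 2)))) atTop (nhds (D * 0)) := by
    refine (Tendsto.comp (Real.tendsto_pow_mul_exp_neg_atTop_nhds_zero 1) ?_).const_mul D
    refine Tendsto.atTop_div_const two_pos (Real.tendsto_sqrt_atTop.comp ?_)
    exact Tendsto.const_mul_atTop two_pos tendsto_natCast_atTop_atTop
  rw [mul_zero] at hlim
  obtain ⟨N, hN⟩ := eventually_atTop.1 (hlim.eventually (gt_mem_nhds hκ))
  refine ⟨max N 1, fun m hm s hs => lt_of_le_of_lt ?_ (hN m (le_of_max_le_left hm))⟩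
  have hm1 : (1 : ℝ) ≤ m := by exact_mod_cast le_of_max_le_right hm
  set u := Real.sqrt (2 * m) with hu
  have hu2 : u ^ 2 = 2 * m := Real.sq_sqrt (by positivity)
  have hu1 : 1 ≤ u := by
    rw [hu, Real.one_le_sqrt]; linarith
  have hu0 : 0 < u := by linarith
  have hlogu : Real.log (2 * m) = 2 * Real.log u := by rw [← hu2, Real.log_pow]; norm_num
  have hsu : (s : ℝ) ≤ 2 * u / a := by
    rw [le_div_iff₀ ha0]
    have := Real.log_le_self hu0.le
    linarith
  have hqs : u⁻¹ ≤ q ^ s := by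
    rw [← Real.log_le_log_iff (inv_pos.2 hu0) (pow_pos hq0 s), Real.log_inv, Real.log_pow]
    rw [ha, Real.log_inv] at hs
    linarith
  have hpow : (1 - q ^ s) ^ (m - 1) ≤ Real.exp (1 - u / 2) := by
    have h3 : 1 - q ^ s ≤ Real.exp (-u⁻¹) := by
      have := Real.add_one_le_exp (-u⁻¹)
      linarith
    refine (pow_le_pow_left₀ (sub_nonneg.2 (pow_le_one₀ hq0.le hq1.le)) h3 _).trans ?_
    rw [← Real.exp_nat_mul, Real.exp_le_exp, Nat.cast_sub (le_of_max_le_right hm), Nat.cast_one]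
    have h4 : (m : ℝ) * u⁻¹ = u / 2 := by
      field_simp
      linarith
    have h5 : u⁻¹ ≤ 1 := inv_le_one_of_one_le₀ hu1
    nlinarith
  calc Real.log 2 * (s * (1 - q ^ s) ^ (m - 1))
      ≤ Real.log 2 * (2 * u / a * Real.exp (1 - u / 2)) := by
        refine mul_le_mul_of_nonneg_left (mul_le_mul hsu hpow ?_ (by positivity)) h2.le
        exact pow_nonneg (sub_nonneg.2 (pow_le_one₀ hq0.le hq1.le)) _
    _ = _ := by
        rw [hD, sub_eq_add_neg, Real.exp_add]
        field_simp
        ring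

/-- If `r ≥ 1 / 2`, then `r ≤ (1 - q ^ s) ^ m` gives a lower bound on `s` that is better by a factor
of almost two than the one that is claimed here. -/
lemma log_add_log_le_of_half_le {q r : ℝ} {m s : ℕ} (hq0 : 0 < q) (hq1 : q < 1) (hm : 2 ≤ m)
    (hr : 1 / 2 ≤ r) (hr1 : r < 1) (h : r ≤ (1 - q ^ s) ^ m) :
    Real.log m + Real.log (1 - r)⁻¹ ≤ s * (2 * Real.log q⁻¹) := by
  have hr0 : 0 < r := by linarith
  have hqs : 0 < q ^ s := pow_pos hq0 s
  have hm' : (2 : ℝ) ≤ m := by exact_mod_cast hm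
  have hm0 : (0 : ℝ) < m := by linarith
  have h1 : Real.log r ≤ -(m * q ^ s) := by
    rw [Real.log_le_iff_le_exp hr0]
    refine h.trans ?_
    have h2 : 1 - q ^ s ≤ Real.exp (-q ^ s) := by
      have := Real.add_one_le_exp (-q ^ s)
      linarith
    refine (pow_le_pow_left₀ (sub_nonneg.2 (pow_le_one₀ hq0.le hq1.le)) h2 _).trans (le_of_eq ?_)
    rw [← Real.exp_nat_mul]
    congr 1
    ring
  have h2 : m * q ^ s ≤ 2 * (1 - r) := by
    have h3 := Real.one_sub_inv_le_log_of_pos hr0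
    have h4 : r⁻¹ - 1 ≤ 2 * (1 - r) := by
      rw [inv_eq_one_div, div_sub_one hr0.ne', div_le_iff₀ hr0]
      nlinarith
    linarith
  -- Squaring gives `(m q ^ s)² ≤ 4 (1 - r)² ≤ 2 (1 - r) ≤ m (1 - r)`, since `1 - r ≤ 1 / 2` and `m
  -- ≥ 2`.
  have h3 : m * (q ^ s) ^ 2 ≤ 1 - r := by
    have h4 : m * (m * (q ^ s) ^ 2) ≤ m * (1 - r) := by
      have h5 : (m * q ^ s) ^ 2 ≤ (2 * (1 - r)) ^ 2 := pow_le_pow_left₀ (by positivity) h2 2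
      nlinarith
    exact le_of_mul_le_mul_left h4 hm0
  have h4 := Real.log_le_log (by positivity) h3
  rw [Real.log_mul hm0.ne' (by positivity), Real.log_pow, Real.log_pow] at h4
  rw [Real.log_inv, Real.log_inv]
  push_cast at h4
  linarith

/-- The bound on `T` from `r ≤ (1 - (1 - η) ^ (2 * s)) ^ m`. -/
lemma logb_div_le {η r : ℝ} {m s : ℕ} (hη0 : 0 ≤ η) (hη1 : η ≤ 1) (hm : 1 ≤ m) (hr0 : 0 ≤ r)
    (h : r ≤ (1 - (1 - η) ^ (2 * s)) ^ m) :
    Real.logb 2 (1 - r ^ (1 / (m : ℝ)))⁻¹ / (2 * Real.logb 2 (1 - η)⁻¹) ≤ s := by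
  -- For `η = 1` and `η = 0` the denominator is 0 and the quotient is 0 by convention.
  rcases hη1.eq_or_lt with rfl | hη1
  · simp
  rcases hη0.eq_or_lt with rfl | hη0
  · simp
  have hq : 0 < 1 - η := by linarith
  have ha : 0 < 2 * Real.logb 2 (1 - η)⁻¹ := by
    have := Real.logb_pos one_lt_two ((one_lt_inv₀ hq).2 (by linarith))
    linarith
  have h1 : 0 ≤ 1 - (1 - η) ^ (2 * s) := sub_nonneg.2 (pow_le_one₀ hq.le (by linarith))
  have h2 : r ^ (1 / (m : ℝ)) ≤ 1 - (1 - η) ^ (2 * s) := by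
    refine (Real.rpow_le_rpow hr0 h (by positivity)).trans (le_of_eq ?_)
    rw [one_div]
    exact Real.pow_rpow_inv_natCast h1 (by omega)
  rw [div_le_iff₀ ha]
  have h3 := Real.logb_le_logb_of_le one_lt_two (pow_pos hq (2 * s))
    (by linarith : (1 - η) ^ (2 * s) ≤ 1 - r ^ (1 / (m : ℝ)))
  rw [Real.logb_pow] at h3
  rw [Real.logb_inv, Real.logb_inv]
  push_cast at h3
  linarith

/-- If `H = ∞` the quotient is 0, as intended. If `H < ∞`, the bound makes `l` finite and excludes
`H = 0`, so `toReal` loses nothing. -/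
lemma toReal_div_bounds {l : EReal} {H : ℝ≥0∞} {a : ℝ} (ha : 0 ≤ a) (hl : 0 < l)
    (h : l ≤ ((H * ENNReal.ofReal a : ℝ≥0∞) : EReal)) :
    0 ≤ (l / (H : EReal)).toReal ∧ (l / (H : EReal)).toReal ≤ a := by
  rcases eq_or_ne H ∞ with rfl | hH
  · simp [ha]
  lift H to ℝ≥0 using hH
  have h1 : ((H * ENNReal.ofReal a : ℝ≥0∞) : EReal) = ((H * a : ℝ) : EReal) := by
    rw [← ENNReal.ofReal_coe_nnreal (p := H), ← ENNReal.ofReal_mul H.coe_nonneg,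
      EReal.coe_ennreal_ofReal, max_eq_left (mul_nonneg H.coe_nonneg ha), EReal.coe_mul]
  rw [h1] at h
  lift l to ℝ using ⟨ne_top_of_le_ne_top (EReal.coe_ne_top _) h, (bot_lt_iff_ne_bot.1
    (lt_trans EReal.bot_lt_zero hl))⟩
  have hl' : 0 < l := by exact_mod_cast hl
  have h' : l ≤ H * a := by exact_mod_cast h
  have hH0 : (0 : ℝ) < H := by
    refine H.2.lt_of_ne fun h0 => ?_
    have h0' : (H : ℝ) = 0 := h0.symm
    rw [h0', zero_mul] at h'
    linarith
  have h2 : ((l : EReal) / (((H : ℝ≥0∞)) : EReal)) = ((l / H : ℝ) : EReal) := by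
    rw [EReal.coe_div]
    rfl
  rw [h2, EReal.toReal_coe]
  exact ⟨by positivity, by rw [div_le_iff₀ hH0]; linarith⟩

end

/-! ### The bounds on the computation time of general chains. -/

section Main

variable {n T : ℕ} (hn : 2 ≤ n)

lemma one_le_of_pos_of_le_mul {l : EReal} {C : ℝ≥0∞} {s : ℕ} {a : ℝ} (hl : 0 < l)
    (h : l ≤ ((C * ENNReal.ofReal (s * a) : ℝ≥0∞) : EReal)) : 1 ≤ s := by
  rcases Nat.eq_zero_or_pos s with rfl | hs
  · simp at h
    exact absurd h (not_le.2 hl)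
  · exact hs

variable {W : Fin n → Type*} {Z : Type*} [∀ v, MeasurableSpace (W v)]
  [∀ v, StandardBorelSpace (W v)] [∀ v, Nonempty (W v)] [MeasurableSpace Z]
  {X Y : Edge (chainAdj n) → Type*} [∀ e, Fintype (X e)] [∀ e, Fintype (Y e)]
  {K : ∀ e, X e → PMF (Y e)} {P : Problem W Z} {ε : ℝ≥0} {δ η : ℝ}

/-- With fewer than `n - 1` steps the truncated `T + 2 - n` is zero, and the capacity bound
contradicts `ℓ > 0`. -/
lemma sub_one_le_of_algorithm (A : Algorithm (chainAdj n) W X Y Z T)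
    (herr : ∀ v, A.errorProb K P ε v ≤ ENNReal.ofReal δ) (hδ0 : 0 ≤ δ) (hδ1 : δ < 1)
    (hη0 : 0 ≤ η) (hη1 : η ≤ 1) (hK : ∀ e, sdpiConst (K e) ≤ ENNReal.ofReal η)
    (hl : 0 < P.ell (firstNode hn)ᶜ ε δ) : n - 1 ≤ T := by
  have := one_le_of_pos_of_le_mul hl (ell_le_capacity_prod hn A herr hδ0 hδ1 hη0 hη1 hK)
  omega

lemma le_one_sub_sq (hη0 : 0 ≤ η) (hη1 : η ≤ 1) : η ≤ 1 - (1 - η) ^ 2 := by nlinarith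

lemma one_sub_sq_le_one : 1 - (1 - η) ^ 2 ≤ 1 := by nlinarith [sq_nonneg (1 - η)]

lemma one_sub_pow_eq (s : ℕ) : (1 - (1 - (1 - η) ^ 2)) ^ s = (1 - η) ^ (2 * s) := by
  rw [sub_sub_cancel, pow_mul]

theorem chain_bounds (hδ0 : 0 ≤ δ) (hδ1 : δ < 1) (hη0 : 0 ≤ η) (hη1 : η ≤ 1)
    (hK : ∀ e, sdpiConst (K e) ≤ ENNReal.ofReal η) (hl : 0 < P.ell (firstNode hn)ᶜ ε δ)
    (hT : compTime K P ε δ = T) :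
    n - 1 ≤ T ∧
    P.ell (firstNode hn)ᶜ ε δ ≤ ((P.condEntropy (firstNode hn) (firstNode hn)ᶜ * ENNReal.ofReal
      ((1 - (1 - η) ^ 2) * ∑ i ∈ Finset.Icc 1 (T + 2 - n),
        binomProb (T - i) (n - 2) (1 - (1 - η) ^ 2)) : ℝ≥0∞) : EReal) ∧
    (3 ≤ n → P.ell (firstNode hn)ᶜ ε δ ≤ ((cutsetCapacity K (firstNode hn)ᶜ * ENNReal.ofReal
      ((1 - (1 - η) ^ 2) * ∑ i ∈ Finset.Icc 1 (T + 2 - n),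
        binomProb (T - i - 1) (n - 3) (1 - (1 - η) ^ 2) * i) : ℝ≥0∞) : EReal)) ∧
    P.ell (firstNode hn)ᶜ ε δ ≤ ((P.condEntropy (firstNode hn) (firstNode hn)ᶜ * ENNReal.ofReal
      (∏ _i ∈ Finset.Icc 2 n, (1 - (1 - η) ^ (2 * (T + 2 - n)))) : ℝ≥0∞) : EReal) ∧
    P.ell (firstNode hn)ᶜ ε δ ≤ ((cutsetCapacity K (firstNode hn)ᶜ * ENNReal.ofReal
      (((T + 2 - n : ℕ) : ℝ) * ∏ _i ∈ Finset.Icc 3 n, (1 - (1 - η) ^ (2 * (T + 2 - n)))) :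
        ℝ≥0∞) : EReal) ∧
    Real.logb 2 (1 - (P.ell (firstNode hn)ᶜ ε δ /
        (P.condEntropy (firstNode hn) (firstNode hn)ᶜ : EReal)).toReal ^ (1 / ((n : ℝ) - 1)))⁻¹ /
      (2 * Real.logb 2 (1 - η)⁻¹) + ((n : ℝ) - 2) ≤ T := by
  obtain ⟨A, herr⟩ := exists_algorithm_of_compTime_eq hT
  have h0 : 0 ≤ 1 - (1 - η) ^ 2 := hη0.trans (le_one_sub_sq hη0 hη1)
  have h1 : 1 - (1 - η) ^ 2 ≤ 1 := one_sub_sq_le_one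
  -- The channels also contract with the larger constant `1 - (1 - η) ^ 2`; everything below is
  -- applied with it.
  have hK' : ∀ e, sdpiConst (K e) ≤ ENNReal.ofReal (1 - (1 - η) ^ 2) := fun e =>
    (hK e).trans (ENNReal.ofReal_le_ofReal (le_one_sub_sq hη0 hη1))
  have hnT := sub_one_le_of_algorithm hn A herr hδ0 hδ1 hη0 hη1 hK hl
  have hH := ell_le_entropy_prod hn A herr hδ0 hδ1 h0 h1 hK'
  have hC := ell_le_capacity_prod hn A herr hδ0 hδ1 h0 h1 hK'
  rw [one_sub_pow_eq] at hH hC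
  refine ⟨hnT, ell_le_entropy_sum hn A herr hδ0 hδ1 h0 h1 hK',
    ell_le_capacity_sum hn A herr hδ0 hδ1 h0 h1 hK', ?_, ?_, ?_⟩
  · rwa [Finset.prod_const, Nat.card_Icc, show n + 1 - 2 = n - 1 by omega]
  · rwa [Finset.prod_const, Nat.card_Icc, show n + 1 - 3 = n - 2 by omega]
  · have ha : 0 ≤ 1 - (1 - η) ^ (2 * (T + 2 - n)) :=
      sub_nonneg.2 (pow_le_one₀ (sub_nonneg.2 hη1) (by linarith))
    obtain ⟨hr0, hr⟩ := toReal_div_bounds (pow_nonneg ha (n - 1)) hl hH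
    have := logb_div_le hη0 hη1 (by omega : 1 ≤ n - 1) hr0 hr
    rw [Nat.cast_sub (by omega : 1 ≤ n), Nat.cast_one, Nat.cast_sub (by omega : n ≤ T + 2),
      Nat.cast_add, Nat.cast_ofNat] at this
    linarith

theorem div_capacity_add_le_compTime (hδ0 : 0 ≤ δ) (hδ1 : δ < 1) (hη0 : 0 ≤ η) (hη1 : η ≤ 1)
    (hK : ∀ e, sdpiConst (K e) ≤ ENNReal.ofReal η) (hl : 0 < P.ell (firstNode hn)ᶜ ε δ) :
    (P.ell (firstNode hn)ᶜ ε δ).toENNReal / cutsetCapacity K (firstNode hn)ᶜ +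
      ((n - 2 : ℕ) : ℝ≥0∞) ≤ (compTime K P ε δ : ℝ≥0∞) := by
  rcases hT : compTime K P ε δ with _ | T
  · exact le_top
  obtain ⟨A, herr⟩ := exists_algorithm_of_compTime_eq hT
  have hnT := sub_one_le_of_algorithm hn A herr hδ0 hδ1 hη0 hη1 hK hl
  have hC := ell_le_capacity_prod hn A herr hδ0 hδ1 hη0 hη1 hK
  have h1 : (P.ell (firstNode hn)ᶜ ε δ).toENNReal ≤
      ((T + 2 - n : ℕ) : ℝ≥0∞) * cutsetCapacity K (firstNode hn)ᶜ := by
    refine (EReal.toENNReal_le_toENNReal hC).trans ?_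
    rw [EReal.toENNReal_coe, mul_comm]
    gcongr
    rw [← ENNReal.ofReal_natCast]
    refine ENNReal.ofReal_le_ofReal (mul_le_of_le_one_right (Nat.cast_nonneg _) ?_)
    have h2 : (0 : ℝ) ≤ (1 - η) ^ (T + 2 - n) := pow_nonneg (sub_nonneg.2 hη1) _
    have h3 : (1 - η) ^ (T + 2 - n) ≤ 1 := pow_le_one₀ (sub_nonneg.2 hη1) (by linarith)
    exact pow_le_one₀ (by linarith) (by linarith)
  calc _ ≤ ((T + 2 - n : ℕ) : ℝ≥0∞) + ((n - 2 : ℕ) : ℝ≥0∞) := by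
        gcongr
        exact ENNReal.div_le_of_le_mul h1
    _ = ((T : ℕ) : ℝ≥0∞) := by rw [← Nat.cast_add]; congr 1; omega
    _ = _ := rfl

theorem linear_lower_bound {C : ℝ} (hδ0 : 0 ≤ δ) (hδ1 : δ < 1) (hη0 : 0 < η) (hη1 : η ≤ 1)
    (hK : ∀ e, sdpiConst (K e) ≤ ENNReal.ofReal η) (hl : 0 < P.ell (firstNode hn)ᶜ ε δ)
    (hn4 : 4 ≤ n) (hC : ∀ e, capacity (K e) ≤ ENNReal.ofReal C)
    (hlC : ((C * (n : ℝ) ^ 2 * ((n : ℝ) - 3) ^ 2 / (4 * η) *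
      Real.exp (-2 * η ^ 2 * ((n : ℝ) - 3)) : ℝ) : EReal) < P.ell (firstNode hn)ᶜ ε δ) :
    ENNReal.ofReal (1 / 80 * (n / (1 - (1 - η) ^ 2))) ≤ (compTime K P ε δ : ℝ≥0∞) := by
  rcases hT : compTime K P ε δ with _ | T
  · exact le_top
  obtain ⟨A, herr⟩ := exists_algorithm_of_compTime_eq hT
  have hle : η ≤ 1 - (1 - η) ^ 2 := le_one_sub_sq hη0.le hη1
  have h1 : 1 - (1 - η) ^ 2 ≤ 1 := one_sub_sq_le_one
  have hS := ell_le_capacity_sum hn A herr hδ0 hδ1 (hη0.le.trans hle) h1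
    (fun e => (hK e).trans (ENNReal.ofReal_le_ofReal hle)) (by omega)
  change _ ≤ ((T : ℕ) : ℝ≥0∞)
  rw [← ENNReal.ofReal_natCast]
  refine ENNReal.ofReal_le_ofReal (not_lt.1 fun hlt => ?_)
  have hB := binomSum_le_exp hn4 hη0 hle h1 hlt
  rw [cutsetCapacity_compl_firstNode] at hS
  set R := (1 - (1 - η) ^ 2) * ∑ i ∈ Finset.Icc 1 (T + 2 - n),
    binomProb (T - i - 1) (n - 3) (1 - (1 - η) ^ 2) * i with hR
  -- `C` is an arbitrary real number; if it is not positive, the capacities vanish and `ℓ > 0`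
  -- fails.
  have h2 : P.ell (firstNode hn)ᶜ ε δ ≤ ((max C 0 * max R 0 : ℝ) : EReal) := by
    refine hS.trans ?_
    rw [← max_eq_left (mul_nonneg (le_max_right C 0) (le_max_right R 0)),
      ← EReal.coe_ennreal_ofReal, ENNReal.ofReal_mul (le_max_right _ _), EReal.coe_ennreal_le_coe_ennreal_iff,
      ENNReal.ofReal_max, ENNReal.ofReal_max]
    simp only [ENNReal.ofReal_zero, zero_le, max_eq_left]
    gcongr
    exact hC _
  have hR0 : 0 ≤ R := mul_nonneg (hη0.le.trans hle) (Finset.sum_nonneg fun i _ =>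
    mul_nonneg (binomProb_nonneg _ _ (hη0.le.trans hle) h1) (Nat.cast_nonneg _))
  rw [max_eq_left hR0] at h2
  rcases le_or_gt C 0 with hC0 | hC0
  · rw [max_eq_right hC0, zero_mul] at h2
    exact absurd h2 (not_le.2 hl)
  · rw [max_eq_left hC0.le] at h2
    have h3 : C * (n : ℝ) ^ 2 * ((n : ℝ) - 3) ^ 2 / (4 * η) *
      Real.exp (-2 * η ^ 2 * ((n : ℝ) - 3)) < C * R := by exact_mod_cast hlC.trans_le h2
    have h4 := mul_le_mul_of_nonneg_left hB hC0.le
    refine absurd (h3.trans_le h4) (not_lt.2 (le_of_eq ?_))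
    ring

end Main

/-! ### Chains of binary symmetric channels. -/

section BinarySymmetric

variable {n T : ℕ} (hn : 2 ≤ n) {W : Fin n → Type*} {Z : Type*} [∀ v, MeasurableSpace (W v)]
  [∀ v, StandardBorelSpace (W v)] [∀ v, Nonempty (W v)] [MeasurableSpace Z]
  {P : Problem W Z} {ε : ℝ≥0} {δ : ℝ} {p : ℝ≥0} (hp : p ≤ 1)

lemma cutsetCapacity_bsc_le : cutsetCapacity (fun _ : Edge (chainAdj n) => bsc p hp)
    (firstNode hn)ᶜ ≤ ENNReal.ofReal (1 - h2 p) := by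
  rw [cutsetCapacity_compl_firstNode]
  exact capacity_bsc_le p hp

lemma h2_lt_one {p : ℝ} (hp : p ≠ 1 / 2) : h2 p < 1 := by
  rw [h2, div_lt_one (Real.log_pos one_lt_two), Real.binEntropy_lt_log_two]
  rwa [inv_eq_one_div]

include hp in
lemma one_sub_two_mul_sq_le_one : (1 - 2 * (p : ℝ)) ^ 2 ≤ 1 := by
  have h1 : (p : ℝ) ≤ 1 := by exact_mod_cast hp
  nlinarith [p.coe_nonneg]

lemma ell_le_bsc (A : Algorithm (chainAdj n) W (fun _ => Bool) (fun _ => Bool) Z T)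
    (herr : ∀ v, A.errorProb (fun _ => bsc p hp) P ε v ≤ ENNReal.ofReal δ) (hδ0 : 0 ≤ δ)
    (hδ1 : δ < 1) : P.ell (firstNode hn)ᶜ ε δ ≤
      ((ENNReal.ofReal (1 - h2 p) * ((T + 2 - n : ℕ) : ℝ≥0∞) : ℝ≥0∞) : EReal) := by
  have hη0 : 0 ≤ (1 - 2 * (p : ℝ)) ^ 2 := sq_nonneg _
  have hη1 := one_sub_two_mul_sq_le_one hp
  refine (ell_le_capacity_prod hn A herr hδ0 hδ1 hη0 hη1
    fun _ => sdpiConst_bsc_le p hp).trans (EReal.coe_ennreal_le_coe_ennreal_iff.2 ?_)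
  refine mul_le_mul' (cutsetCapacity_bsc_le hn hp) ?_
  rw [← ENNReal.ofReal_natCast]
  refine ENNReal.ofReal_le_ofReal (mul_le_of_le_one_right (Nat.cast_nonneg _) ?_)
  have h2 : (0 : ℝ) ≤ (1 - (1 - 2 * (p : ℝ)) ^ 2) ^ (T + 2 - n) := pow_nonneg (sub_nonneg.2 hη1) _
  have h3 : (1 - (1 - 2 * (p : ℝ)) ^ 2) ^ (T + 2 - n) ≤ 1 :=
    pow_le_one₀ (sub_nonneg.2 hη1) (by linarith)
  exact pow_le_one₀ (by linarith) (by linarith)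

theorem compTime_bsc_half (hδ0 : 0 ≤ δ) (hδ1 : δ < 1) (hl : 0 < P.ell (firstNode hn)ᶜ ε δ)
    (h : p = 1 / 2) : compTime (fun _ : Edge (chainAdj n) => bsc p hp) P ε δ = ⊤ := by
  rcases hT : compTime (fun _ : Edge (chainAdj n) => bsc p hp) P ε δ with _ | T
  · rfl
  obtain ⟨A, herr⟩ := exists_algorithm_of_compTime_eq hT
  have h1 := ell_le_bsc hn hp A herr hδ0 hδ1
  have h2 : h2 (p : ℝ) = 1 := by
    have h3 : (p : ℝ) = 2⁻¹ := by simp [h]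
    rw [_root_.h2, h3, Real.binEntropy_two_inv, div_self (Real.log_pos one_lt_two).ne']
  rw [h2, sub_self, ENNReal.ofReal_zero, zero_mul, EReal.coe_ennreal_zero] at h1
  exact absurd h1 (not_le.2 hl)

theorem div_add_le_of_compTime_bsc_eq (hδ0 : 0 ≤ δ) (hδ1 : δ < 1)
    (hl : 0 < P.ell (firstNode hn)ᶜ ε δ) (h : p ≠ 1 / 2)
    (hT : compTime (fun _ : Edge (chainAdj n) => bsc p hp) P ε δ = T) : n - 1 ≤ T ∧
    P.ell (firstNode hn)ᶜ ε δ / ((1 - h2 p : ℝ) : EReal) + (((n : ℝ) - 2 : ℝ) : EReal) ≤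
      ((T : ℝ) : EReal) := by
  obtain ⟨A, herr⟩ := exists_algorithm_of_compTime_eq hT
  have h1 := ell_le_bsc hn hp A herr hδ0 hδ1
  have hnT := sub_one_le_of_algorithm hn A herr hδ0 hδ1 (sq_nonneg _)
    (one_sub_two_mul_sq_le_one hp) (fun _ => sdpiConst_bsc_le p hp) hl
  have hp' : (p : ℝ) ≠ 1 / 2 := fun h' => h (NNReal.eq (by simpa using h'))
  have hpos : 0 < 1 - h2 p := sub_pos.2 (h2_lt_one hp')
  refine ⟨hnT, ?_⟩
  rw [← ENNReal.ofReal_natCast, ← ENNReal.ofReal_mul hpos.le, EReal.coe_ennreal_ofReal,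
    max_eq_left (mul_nonneg hpos.le (Nat.cast_nonneg _)), EReal.coe_mul] at h1
  have h3 := (EReal.div_le_iff_le_mul (by exact_mod_cast hpos) (EReal.coe_ne_top _)).2 h1
  refine (add_le_add_left h3 _).trans (le_of_eq ?_)
  rw [← EReal.coe_add, EReal.coe_eq_coe_iff, Nat.cast_sub (by omega : n ≤ T + 2)]
  push_cast
  ring

/-- The logarithmic lower bound for noisy binary symmetric channels, in terms of the number of
steps that exceed the length of the chain. -/
lemma log_le_of_algorithm_bsc {κ x q : ℝ} (hδ0 : 0 ≤ δ) (hδ1 : δ < 1) (hx : 0 < x)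
    (hq : q = 4 * (p : ℝ) * (1 - p)) (hq0 : 0 < q) (hq1 : q < 1) (hn3 : 3 ≤ n)
    (hκ : κ ≤ (1 - δ) * Real.log (1 + x) -
      Real.log (1 + x * (P.meanSmallBall (firstNode hn)ᶜ ε).toReal))
    (hN : ∀ s : ℕ, s * (2 * Real.log q⁻¹) < Real.log (2 * (n - 1 : ℕ)) →
      Real.log 2 * (s * (1 - q ^ s) ^ (n - 1 - 1)) < κ)
    (hl : 0 < P.ell (firstNode hn)ᶜ ε δ)
    (A : Algorithm (chainAdj n) W (fun _ => Bool) (fun _ => Bool) Z T)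
    (herr : ∀ v, A.errorProb (fun _ => bsc p hp) P ε v ≤ ENNReal.ofReal δ) :
    Real.log (n - 1 : ℕ) + Real.log (1 - (P.ell (firstNode hn)ᶜ ε δ /
      (P.condEntropy (firstNode hn) (firstNode hn)ᶜ : EReal)).toReal)⁻¹ ≤
        (T + 2 - n : ℕ) * (2 * Real.log q⁻¹) := by
  have hη0 : 0 ≤ (1 - 2 * (p : ℝ)) ^ 2 := sq_nonneg _
  have hη1 := one_sub_two_mul_sq_le_one hp
  have hK : ∀ _ : Edge (chainAdj n), sdpiConst (bsc p hp) ≤ ENNReal.ofReal ((1 - 2 * p) ^ 2) :=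
    fun _ => sdpiConst_bsc_le p hp
  have hqη : 1 - (1 - 2 * (p : ℝ)) ^ 2 = q := by rw [hq]; ring
  have hH := ell_le_entropy_prod hn A herr hδ0 hδ1 hη0 hη1 hK
  have hC := le_capacity_prod hn A herr hδ0 hη0 hη1 hK hx
  have hnT := sub_one_le_of_algorithm hn A herr hδ0 hδ1 hη0 hη1 hK hl
  rw [hqη] at hH hC
  set s := T + 2 - n
  have hs : 1 ≤ s := by omega
  have hqs : 0 < q ^ s := pow_pos hq0 s
  have hqs1 : 0 ≤ 1 - q ^ s := sub_nonneg.2 (pow_le_one₀ hq0.le hq1.le)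
  obtain ⟨hr0, hr⟩ := toReal_div_bounds (pow_nonneg hqs1 (n - 1)) hl hH
  set r := (P.ell (firstNode hn)ᶜ ε δ /
    (P.condEntropy (firstNode hn) (firstNode hn)ᶜ : EReal)).toReal
  have hr1 : r < 1 := hr.trans_lt (pow_lt_one₀ hqs1 (by linarith) (by omega))
  rcases le_or_gt (1 / 2) r with hr2 | hr2
  -- For `r ≥ 1 / 2` the entropy bound is enough. Otherwise `(1 - r)⁻¹ ≤ 2`, so failure of the claim
  -- gives the hypothesis of `hN`, and the capacity bound falls below `κ`.
  · exact log_add_log_le_of_half_le hq0 hq1 (by omega) hr2 hr1 hr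
  by_contra! hlt
  have hm : (0 : ℝ) < (n - 1 : ℕ) := by exact_mod_cast (by omega : 0 < n - 1)
  refine absurd (hN s (hlt.trans_le ?_)) (not_lt.2 ?_)
  · rw [← Real.log_mul hm.ne' (inv_pos.2 (by linarith)).ne']
    refine Real.log_le_log (mul_pos hm (inv_pos.2 (by linarith))) ?_
    rw [mul_comm]
    gcongr
    rw [inv_le_comm₀ (by linarith) two_pos]
    linarith
  · have h1 : cutsetCapacity (fun _ : Edge (chainAdj n) => bsc p hp) (firstNode hn)ᶜ ≤ 1 := by
      refine (cutsetCapacity_bsc_le hn hp).trans ?_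
      rw [ENNReal.ofReal_le_one, sub_le_self_iff]
      exact div_nonneg (Real.binEntropy_nonneg p.coe_nonneg (by exact_mod_cast hp))
        (Real.log_pos one_lt_two).le
    have h2 := hC.trans (mul_le_mul' le_rfl (mul_le_mul' h1 le_rfl))
    have h0 : (0 : ℝ) ≤ s * (1 - q ^ s) ^ (n - 2) :=
      mul_nonneg (Nat.cast_nonneg _) (pow_nonneg hqs1 _)
    have hlog := Real.log_pos one_lt_two
    rw [one_mul, ← ENNReal.ofReal_mul hlog.le,
      ENNReal.ofReal_le_ofReal_iff (mul_nonneg hlog.le h0)] at h2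
    rw [show n - 1 - 1 = n - 2 by omega]
    exact hκ.trans h2

lemma bsc_apply_ne_zero (h0 : p ≠ 0) (h1 : p ≠ 1) (x y : Bool) : bsc p hp x y ≠ 0 := by
  have h2 : 1 - p ≠ 0 := (tsub_pos_of_lt (lt_of_le_of_ne hp h1)).ne'
  rw [bsc, PMF.ofFintype_apply]
  split_ifs
  · exact_mod_cast h2
  · exact_mod_cast h0

lemma ell_zero_le_of_algorithm_bsc (h0 : p ≠ 0) (h1 : p ≠ 1)
    (A : Algorithm (chainAdj n) W (fun _ => Bool) (fun _ => Bool) Z T)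
    (herr : ∀ v, A.errorProb (fun _ => bsc p hp) P ε v ≤ ENNReal.ofReal 0) :
    P.ell (firstNode hn)ᶜ ε 0 ≤ 0 := by
  have h2 : P.meanSmallBall (firstNode hn)ᶜ ε = 1 :=
    le_antisymm (P.meanSmallBall_le_one _ ε) (one_le_meanSmallBall_of_errorProb_eq_zero P _ A _ ε
      (lastNode hn) ((mem_compl_firstNode hn).2 (by simp only [lastNode]; omega))
      (fun _ => bsc_apply_ne_zero hp h0 h1) (fun _ _ => true)
      (le_antisymm ((herr _).trans (by simp)) zero_le))
  change ellOf _ _ ≤ 0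
  rw [h2, ellOf_coe one_ne_zero ENNReal.one_ne_top]
  simp

theorem exists_log_lower_bound_bsc (hδ0 : 0 ≤ δ) (hδ1 : δ < 1) (hph : p ≠ 1 / 2) :
    ∃ N : ℕ, ∀ (n : ℕ) (hn : 2 ≤ n), N ≤ n → ∀ (W : Fin n → Type*) (Z : Type*)
      [∀ v, MeasurableSpace (W v)] [∀ v, StandardBorelSpace (W v)] [∀ v, Nonempty (W v)]
      [MeasurableSpace Z] (P : Problem W Z) (ε : ℝ≥0), 0 < P.ell (firstNode hn)ᶜ ε δ →
      ∀ T : ℕ, compTime (fun _ : Edge (chainAdj n) => bsc p hp) P ε δ = T →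
      (Real.logb 2 ((n : ℝ) - 1) + Real.logb 2 (1 - (P.ell (firstNode hn)ᶜ ε δ /
        (P.condEntropy (firstNode hn) (firstNode hn)ᶜ : EReal)).toReal)⁻¹) /
          (2 * Real.logb 2 (4 * (p : ℝ) * (1 - p))⁻¹) ≤ (T + 2 - n : ℕ) := by
  -- For `p ∈ {0, 1}` the denominator is the logarithm of `0⁻¹ = 0`, hence 0, and the left side is
  -- 0.
  by_cases h0 : p = 0
  · refine ⟨0, fun n hn _ W Z _ _ _ _ P ε _ T _ => ?_⟩
    simp [h0]
  by_cases h1 : p = 1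
  · refine ⟨0, fun n hn _ W Z _ _ _ _ P ε _ T _ => ?_⟩
    simp [h1]
  -- The uniform `κ` requires `δ > 0`; for `δ = 0` no algorithm with finite `T` exists.
  rcases hδ0.eq_or_lt with rfl | hδ
  · refine ⟨0, fun n hn _ W Z _ _ _ _ P ε hl T hT => ?_⟩
    obtain ⟨A, herr⟩ := exists_algorithm_of_compTime_eq hT
    exact absurd (ell_zero_le_of_algorithm_bsc hn hp h0 h1 A herr) (not_le.2 hl)
  have hp0 : (0 : ℝ) < p := lt_of_le_of_ne p.coe_nonneg fun h => h0 (NNReal.eq h.symm)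
  have hp1 : (p : ℝ) < 1 := lt_of_le_of_ne (by exact_mod_cast hp) fun h => h1 (NNReal.eq h)
  have hp2 : 1 - 2 * (p : ℝ) ≠ 0 := fun h => hph (NNReal.eq (by push_cast; linarith))
  set q := 4 * (p : ℝ) * (1 - p) with hq
  have hq0 : 0 < q := mul_pos (by linarith) (by linarith)
  have hq1 : q < 1 := by have := pow_pos (abs_pos.2 hp2) 2; rw [sq_abs] at this; nlinarith
  obtain ⟨κ, x, hκ0, hx, hκ⟩ := exists_pos_le_of_ellOf_pos hδ hδ1
  obtain ⟨N, hN⟩ := exists_forall_mul_pow_lt hq0 hq1 hκ0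
  -- The threshold `N` applies to the number `n - 1` of links, and the case `r ≥ 1 / 2` needs at
  -- least two links.
  refine ⟨max (N + 1) 3, fun n hn hNn W Z _ _ _ _ P ε hl T hT => ?_⟩
  obtain ⟨A, herr⟩ := exists_algorithm_of_compTime_eq hT
  have h2 := log_le_of_algorithm_bsc hn hp hδ0 hδ1 hx hq hq0 hq1 (by omega)
    (hκ _ (meanSmallBall_ne_top _) hl) (hN (n - 1) (by omega)) hl A herr
  rw [Nat.cast_sub (by omega : 1 ≤ n), Nat.cast_one] at h2
  have hlog := Real.log_pos one_lt_two
  have hlq : 0 < Real.log q⁻¹ := Real.log_pos ((one_lt_inv₀ hq0).2 hq1)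
  rw [Real.logb, Real.logb, Real.logb, ← add_div, mul_div_assoc', div_div_div_cancel_right₀ hlog.ne',
    div_le_iff₀ (by positivity)]
  exact h2

end BinarySymmetric

theorem mainTheorem12 :
    -- the inequalities of the general theorem, for chains
    (∃ c : ℝ, 0 < c ∧ ∀ (n : ℕ) (hn : 2 ≤ n) (W : Fin n → Type*) (Z : Type*)
      [∀ v, MeasurableSpace (W v)] [∀ v, StandardBorelSpace (W v)] [∀ v, Nonempty (W v)]
      [MeasurableSpace Z] (X Y : Edge (chainAdj n) → Type*)
      [∀ e, Fintype (X e)] [∀ e, Fintype (Y e)] (K : ∀ e, X e → PMF (Y e)) (P : Problem W Z)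
      (ε : ℝ≥0) (δ η : ℝ), 0 ≤ δ → δ < 1 → 0 ≤ η → η ≤ 1 →
      (∀ e, sdpiConst (K e) ≤ ENNReal.ofReal η) →
      P.meanSmallBall (firstNode hn)ᶜ ε ≤ ENNReal.ofReal (1 - δ) →
      0 < P.ell (firstNode hn)ᶜ ε δ →
      let S₁ := firstNode hn
      let ell := P.ell S₁ᶜ ε δ
      let H := P.condEntropy S₁ S₁ᶜ
      let C₁ := cutsetCapacity K S₁ᶜ
      let η' := 1 - (1 - η) ^ 2
      let r : ℝ := (ell / (H : EReal)).toReal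
      (∀ T : ℕ, compTime K P ε δ = T →
        n - 1 ≤ T ∧
        ell ≤ ((H * ENNReal.ofReal
          (η' * ∑ i ∈ Finset.Icc 1 (T + 2 - n), binomProb (T - i) (n - 2) η') : ℝ≥0∞) : EReal) ∧
        (3 ≤ n → ell ≤ ((C₁ * ENNReal.ofReal
          (η' * ∑ i ∈ Finset.Icc 1 (T + 2 - n), binomProb (T - i - 1) (n - 3) η' * i) : ℝ≥0∞) :
            EReal)) ∧
        ell ≤ ((H * ENNReal.ofReal
          (∏ _i ∈ Finset.Icc 2 n, (1 - (1 - η) ^ (2 * (T + 2 - n)))) : ℝ≥0∞) : EReal) ∧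
        ell ≤ ((C₁ * ENNReal.ofReal (((T + 2 - n : ℕ) : ℝ) *
          ∏ _i ∈ Finset.Icc 3 n, (1 - (1 - η) ^ (2 * (T + 2 - n)))) : ℝ≥0∞) : EReal) ∧
        Real.logb 2 (1 - r ^ (1 / ((n : ℝ) - 1)))⁻¹ / (2 * Real.logb 2 (1 - η)⁻¹) + ((n : ℝ) - 2)
          ≤ T) ∧
      ell.toENNReal / C₁ + ((n - 2 : ℕ) : ℝ≥0∞) ≤ (compTime K P ε δ : ℝ≥0∞) ∧
      (∀ C : ℝ, 4 ≤ n → 0 < η → (∀ e, capacity (K e) ≤ ENNReal.ofReal C) →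
        ((C * (n : ℝ) ^ 2 * ((n : ℝ) - 3) ^ 2 / (4 * η) *
          Real.exp (-2 * η ^ 2 * ((n : ℝ) - 3)) : ℝ) : EReal) < ell →
        ENNReal.ofReal (c * (n / η')) ≤ (compTime K P ε δ : ℝ≥0∞))) ∧
    -- the asymptotic form of the second lower bound
    (∀ (η : ℝ) (r : ℕ → ℝ), 0 < η → η < 1 → (∀ n, 0 ≤ r n ∧ r n < 1) →
      Asymptotics.IsEquivalent atTop
        (fun n : ℕ => Real.logb 2 (1 - r n ^ (1 / ((n : ℝ) - 1)))⁻¹ /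
          (2 * Real.logb 2 (1 - η)⁻¹) + ((n : ℝ) - 2))
        (fun n : ℕ => (Real.logb 2 ((n : ℝ) - 1) + Real.logb 2 (1 - r n)⁻¹) /
          (2 * Real.logb 2 (1 - η)⁻¹) + ((n : ℝ) - 2))) ∧
    -- binary symmetric channels
    (∀ (p : ℝ≥0) (hp : p ≤ 1) (δ : ℝ), 0 ≤ δ → δ < 1 → ∃ N : ℕ, ∀ (n : ℕ) (hn : 2 ≤ n), N ≤ n →
      ∀ (W : Fin n → Type*) (Z : Type*)
      [∀ v, MeasurableSpace (W v)] [∀ v, StandardBorelSpace (W v)] [∀ v, Nonempty (W v)]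
      [MeasurableSpace Z] (P : Problem W Z) (ε : ℝ≥0),
      P.meanSmallBall (firstNode hn)ᶜ ε ≤ ENNReal.ofReal (1 - δ) →
      0 < P.ell (firstNode hn)ᶜ ε δ →
      let S₁ := firstNode hn
      let ell := P.ell S₁ᶜ ε δ
      let H := P.condEntropy S₁ S₁ᶜ
      let r : ℝ := (ell / (H : EReal)).toReal
      let τ : ℕ∞ := compTime (fun _ : Edge (chainAdj n) => bsc p hp) P ε δ
      (p ≠ 1 / 2 →
        max (ell / ((1 - h2 p : ℝ) : EReal))
          (((Real.logb 2 ((n : ℝ) - 1) + Real.logb 2 (1 - r)⁻¹) /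
            (2 * Real.logb 2 (4 * (p : ℝ) * (1 - p))⁻¹) : ℝ) : EReal) + (((n : ℝ) - 2 : ℝ) : EReal)
          ≤ ((τ : ℝ≥0∞) : EReal)) ∧
      (p = 1 / 2 → τ = ⊤)) := by
  refine ⟨⟨1 / 80, by norm_num, ?_⟩, isEquivalent_chain_bound, ?_⟩
  · intro n hn W Z _ _ _ _ X Y _ _ K P ε δ η hδ0 hδ1 hη0 hη1 hK _ hl
    exact ⟨fun T => chain_bounds hn hδ0 hδ1 hη0 hη1 hK hl,
      div_capacity_add_le_compTime hn hδ0 hδ1 hη0 hη1 hK hl,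
      fun C hn4 hη hC => linear_lower_bound hn hδ0 hδ1 hη hη1 hK hl hn4 hC⟩
  · intro p hp δ hδ0 hδ1
    by_cases hph : p = 1 / 2
    · exact ⟨0, fun n hn _ W Z _ _ _ _ P ε _ hl =>
        ⟨fun h => absurd hph h, compTime_bsc_half hn hp hδ0 hδ1 hl⟩⟩
    obtain ⟨N, hN⟩ := exists_log_lower_bound_bsc hp hδ0 hδ1 hph
    refine ⟨N, fun n hn hNn W Z _ _ _ _ P ε _ hl => ⟨fun _ => ?_, fun h => absurd h hph⟩⟩
    rcases hT : compTime (fun _ : Edge (chainAdj n) => bsc p hp) P ε δ with _ | T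
    · exact le_top
    obtain ⟨hnT, h1⟩ := div_add_le_of_compTime_bsc_eq hn hp hδ0 hδ1 hl hph hT
    have h3 := hN n hn hNn W Z P ε hl T hT
    change _ ≤ ((T : ℝ) : EReal)
    rcases max_choice (P.ell (firstNode hn)ᶜ ε δ / ((1 - h2 p : ℝ) : EReal))
      (((Real.logb 2 ((n : ℝ) - 1) + Real.logb 2 (1 - (P.ell (firstNode hn)ᶜ ε δ /
        (P.condEntropy (firstNode hn) (firstNode hn)ᶜ : EReal)).toReal)⁻¹) /
          (2 * Real.logb 2 (4 * (p : ℝ) * (1 - p))⁻¹) : ℝ) : EReal) with h | h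
    · rw [h]
      exact h1
    · rw [h, ← EReal.coe_add, EReal.coe_le_coe_iff]
      rw [Nat.cast_sub (by omega : n ≤ T + 2)] at h3
      push_cast at h3
      linarith
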